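/- Let $\Omega\subset\mathbb R^2$ be an open set decomposed into finitely many nonoverlapping (closed, simple) polygonal elements, $\overline\Omega=\bigcup_{K\in\mathcal P}K$, such that any two different elements intersect in a (possibly empty) union of common vertices and common edges; vertices with straight angle are allowed. Assume that for some $\rho>0$ and every $K\in\mathcal P$, with $h_K=\operatorname{diam}K$, every edge of $K$ is longer than $\rho h_K$ and $K$ is star-shaped with respect to some ball of radius $\rho h_K$. For an element $K$ set $$V_c(K)=\{v\in H^1(K):\Delta v=0 \text{ in } K,\ v|_{\partial K}\in C^0(\partial K),\ v|_e\in\mathbb P_1(e)\ \text{for every edge } e\subset\partial K\},$$ $$V_{nc}(K)=\{v\in H^1(K):\Delta v=0\text{ in }K,\ (n_K\cdot\nabla v)|_e\in\mathbb P_0(e)\ \text{for every edge } e\subset\partial K\},$$ where $n_K$ is the exterior unit normal of $K$. Let $x\in\Omega$ be a vertex of the decomposition, and let $M=M_x$ be the macroelement consisting of all elements having $x$ as a vertex (identified, when it carries function spaces, with the interior of their union). Let $\mathcal E_M$ be the set of all edges of elements of $M$; for $e\in\mathcal E_M$ let $[v]_e$ be, up to a fixed sign, the difference of the traces of $v$ from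 the two elements of $M$ sharing $e$, or the trace of $v$ on $e$ if $e$ belongs to only one element of $M$. Define $$V_{nc}(M)=\Big\{v\in L^2(M): v|_K\in V_{nc}(K)\ \forall K\subset M,\ \int_e[v]_e\,ds=0\ \forall e\in\mathcal E_M\Big\},$$ $$V_c(M)=\{v\in H^1_0(M): v|_K\in V_c(K)\ \forall K\subset M\},\qquad V(M)=V_{nc}(M)\times V_c(M),$$ $$Q(M)=\{q\in L^2(M): q|_K\in\mathbb P_0(K)\ \forall K\subset M\}.$$ Then the space $$N(M)=\Big\{q\in Q(M):\ \sum_{K\subset M}\int_K (\operatorname{div}v)\,q\,dx=0\quad\forall v\in V(M)\Big\}$$ is one-dimensional, and it consists precisely of the functions that are constant on $M$. -/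

import Mathlib

open MeasureTheory Filter Topology Set
open scoped ENNReal ContDiff Gradient

noncomputable section

namespace KouhiaStenberg

/-- The Euclidean plane. -/
abbrev Plane : Type := EuclideanSpace ℝ (Fin 2)

/-! ### Polygonal elements -/

/-- A closed polygonal element: the compact region bounded by a simple closed polygon with `n ≥ 3`
vertices. Straight angles at vertices are allowed. The last three fields say that `carrier` is the
closed bounded region enclosed by the polygon. -/
structure PolygonalElement where
  n : ℕ
  three_le : 3 ≤ n
  poly : Polygon Plane n
  injective : Function.Injective poly.vertices
  simple : ∀ i j : Fin n, i ≠ j → poly.edgeSet ℝ i ∩ poly.edgeSet ℝ j ⊆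
    {poly i, poly (finRotate n i)} ∩ {poly j, poly (finRotate n j)}
  carrier : Set Plane
  isCompact : IsCompact carrier
  closure_interior : closure (interior carrier) = carrier
  frontier_eq : frontier carrier = poly.boundary ℝ

namespace PolygonalElement

/-- The open polygon. Integrals and Lebesgue or Sobolev spaces on an element are taken on this open
set (the boundary is a Lebesgue null set). -/
def openRegion (K : PolygonalElement) : Set Plane := interior K.carrier

/-- `x` is a vertex of `K`. -/
def IsVertex (K : PolygonalElement) (x : Plane) : Prop := ∃ a, K.poly a = x

/-- The `a`-th closed edge of `K`, as a set. -/
def edge (K : PolygonalElement) (a : Fin K.n) : Set Plane := K.poly.edgeSet ℝ a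

/-- The length of the `a`-th edge. -/
def edgeLength (K : PolygonalElement) (a : Fin K.n) : ℝ :=
  dist (K.poly a) (K.poly (finRotate K.n a))

/-- Arc length measure `ds` on the `a`-th edge. -/
def edgeMeasure (K : PolygonalElement) (a : Fin K.n) : Measure Plane :=
  ENNReal.ofReal (K.edgeLength a) •
    (volume.restrict (Icc (0 : ℝ) 1)).map (K.poly.edgePath ℝ a)

/-- Arc length measure `ds` on the boundary `∂K`. -/
def boundaryMeasure (K : PolygonalElement) : Measure Plane := ∑ a, K.edgeMeasure a

end PolygonalElement

/-! ### Sobolev spaces -/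

/-- `v ∈ H¹(U)` with weak gradient `G ∈ L²(U)²`. -/
def IsWeakGradOn (U : Set Plane) (v : Plane → ℝ) (G : Plane → Plane) : Prop :=
  MemLp v 2 (volume.restrict U) ∧ MemLp G 2 (volume.restrict U) ∧
    ∀ φ : Plane → ℝ, ContDiff ℝ ∞ φ → HasCompactSupport φ → tsupport φ ⊆ U →
      ∫ x in U, v x • ∇ φ x = - ∫ x in U, φ x • G x

/-- `φ n → v` and `∇ (φ n) → G`, both in `L²(U)`. -/
def TendstoH1 (U : Set Plane) (φ : ℕ → Plane → ℝ) (v : Plane → ℝ) (G : Plane → Plane) : Prop :=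
  Tendsto (fun n => eLpNorm (φ n - v) 2 (volume.restrict U)) atTop (𝓝 0) ∧
    Tendsto (fun n => eLpNorm (∇ (φ n) - G) 2 (volume.restrict U)) atTop (𝓝 0)

/-- `v ∈ H₀¹(U)`: `v` is the limit in `H¹(U)` of smooth functions with compact support in `U`. -/
def MemH10 (U : Set Plane) (v : Plane → ℝ) : Prop :=
  ∃ G, IsWeakGradOn U v G ∧ ∃ φ : ℕ → Plane → ℝ,
    (∀ n, ContDiff ℝ ∞ (φ n) ∧ HasCompactSupport (φ n) ∧ tsupport (φ n) ⊆ U) ∧ TendstoH1 U φ v G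

/-- `v ∈ H¹(K)` and `g ∈ L²(∂K)` is its trace: the trace operator is the continuous extension of
the restriction map `φ ↦ φ|_∂K` from smooth functions to `H¹(K)`. -/
def HasTrace (K : PolygonalElement) (v g : Plane → ℝ) : Prop :=
  MemLp g 2 K.boundaryMeasure ∧ ∃ G, IsWeakGradOn K.openRegion v G ∧ ∃ φ : ℕ → Plane → ℝ,
    (∀ n, ContDiff ℝ ∞ (φ n)) ∧ TendstoH1 K.openRegion φ v G ∧
      Tendsto (fun n => eLpNorm (φ n - g) 2 K.boundaryMeasure) atTop (𝓝 0)

/-- A function with weak gradient `G` is harmonic in the weak sense in `U`. -/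
def IsWeaklyHarmonic (U : Set Plane) (G : Plane → Plane) : Prop :=
  ∀ φ : Plane → ℝ, ContDiff ℝ ∞ φ → HasCompactSupport φ → tsupport φ ⊆ U →
    ∫ x in U, inner ℝ (G x) (∇ φ x) = 0

/-- The outward normal derivative on `∂K` of a weakly harmonic function with weak gradient `G` is,
in the weak sense (Green's formula), the constant `c a` on the `a`-th edge, for every `a`. -/
def HasNormalDeriv (K : PolygonalElement) (G : Plane → Plane) (c : Fin K.n → ℝ) : Prop :=
  ∀ w : Plane → ℝ, ContDiff ℝ ∞ w →
    ∫ x in K.openRegion, inner ℝ (G x) (∇ w x) = ∑ a, ∫ z, c a * w z ∂(K.edgeMeasure a)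

/-! ### Local virtual element spaces -/

/-- `g ∈ B(∂K)`: continuous on `∂K` and affine on every edge. -/
def MemB (K : PolygonalElement) (g : Plane → ℝ) : Prop :=
  ContinuousOn g (K.poly.boundary ℝ) ∧ ∀ a, ∃ p : Plane →ᵃ[ℝ] ℝ, EqOn g p (K.edge a)

/-- The conforming space `V_c(K)`. -/
def MemVc (K : PolygonalElement) (v : Plane → ℝ) : Prop :=
  (∃ G, IsWeakGradOn K.openRegion v G ∧ IsWeaklyHarmonic K.openRegion G) ∧ ∃ g, HasTrace K v g ∧ MemB K g

/-- The nonconforming space `V_nc(K)`. -/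
def MemVnc (K : PolygonalElement) (v : Plane → ℝ) : Prop :=
  ∃ G, IsWeakGradOn K.openRegion v G ∧ IsWeaklyHarmonic K.openRegion G ∧ ∃ c, HasNormalDeriv K G c

/-! ### Macroelements

A macroelement is given by a finite set `M` of indices into a family `K` of elements. -/

section Macro

variable {ι : Type*} (K : ι → PolygonalElement) (M : Finset ι)

/-- The open region covered by the macroelement `M`. -/
def macroDomain : Set Plane := interior (⋃ i ∈ M, (K i).carrier)

/-- `V_nc(M)`. Here `g i` is the trace on `∂(K i)` of the restriction of `v` to `K i`. On an edge
shared by two elements of `M` the jump is, up to sign, the difference of the two traces; on an edge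
belonging to only one element of `M` it is the trace itself. -/
def MemMacroVnc (v : Plane → ℝ) : Prop :=
  MemLp v 2 (volume.restrict (macroDomain K M)) ∧ (∀ i ∈ M, MemVnc (K i) v) ∧
    ∃ g : ι → Plane → ℝ, (∀ i ∈ M, HasTrace (K i) v (g i)) ∧
      ∀ i ∈ M, ∀ a : Fin (K i).n,
        (∀ j ∈ M, j ≠ i → (∃ b, (K j).edge b = (K i).edge a) →
          ∫ z, (g i z - g j z) ∂((K i).edgeMeasure a) = 0) ∧
        ((∀ j ∈ M, j ≠ i → ∀ b, (K j).edge b ≠ (K i).edge a) →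
          ∫ z, g i z ∂((K i).edgeMeasure a) = 0)

/-- `V_c(M)`. -/
def MemMacroVc (v : Plane → ℝ) : Prop :=
  MemH10 (macroDomain K M) v ∧ ∀ i ∈ M, MemVc (K i) v

/-- The space `L²(M)`. -/
abbrev MacroL2 : Type := Lp ℝ 2 (volume.restrict (macroDomain K M))

theorem openRegion_subset_macroDomain {i : ι} (hi : i ∈ M) : (K i).openRegion ⊆ macroDomain K M :=
  interior_mono (subset_iUnion₂ (s := fun j (_ : j ∈ M) => (K j).carrier) i hi)

theorem restrict_le {i : ι} (hi : i ∈ M) :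
    volume.restrict (K i).openRegion ≤ volume.restrict (macroDomain K M) :=
  Measure.restrict_mono (openRegion_subset_macroDomain K M hi) le_rfl

/-- `Q(M)`: the functions in `L²(M)` that are constant on every element of `M`. -/
def macroQ : Submodule ℝ (MacroL2 K M) where
  carrier := {q | ∀ i ∈ M, ∃ c : ℝ, q =ᵐ[volume.restrict (K i).openRegion] fun _ => c}
  zero_mem' i hi :=
    ⟨0, ae_mono (restrict_le K M hi) (Lp.coeFn_zero ℝ 2 (volume.restrict (macroDomain K M)))⟩
  add_mem' {q r} hq hr i hi := by
    obtain ⟨c, hc⟩ := hq i hi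
    obtain ⟨d, hd⟩ := hr i hi
    refine ⟨c + d, ?_⟩
    filter_upwards [ae_mono (restrict_le K M hi) (Lp.coeFn_add q r), hc, hd] with x h1 h2 h3
    rw [h1, Pi.add_apply, h2, h3]
  smul_mem' t q hq i hi := by
    obtain ⟨c, hc⟩ := hq i hi
    refine ⟨t * c, ?_⟩
    filter_upwards [ae_mono (restrict_le K M hi) (Lp.coeFn_smul t q), hc] with x h1 h2
    rw [h1, Pi.smul_apply, h2, smul_eq_mul]

/-- `∑_{K ⊂ M} ∫_K (div v) q` for `v = (v₁, v₂)`, in terms of the elementwise weak gradients `G₁`,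
`G₂` of `v₁`, `v₂`. -/
def divPairing (G₁ G₂ : Plane → Plane) (q : Plane → ℝ) : ℝ :=
  ∑ i ∈ M, ∫ x in (K i).openRegion, (G₁ x 0 + G₂ x 1) * q x

theorem integrable_div_mul {G₁ G₂ : Plane → Plane} {i : ι} (hi : i ∈ M)
    (h₁ : MemLp G₁ 2 (volume.restrict (K i).openRegion))
    (h₂ : MemLp G₂ 2 (volume.restrict (K i).openRegion)) (q : MacroL2 K M) :
    Integrable (fun x => (G₁ x 0 + G₂ x 1) * q x) (volume.restrict (K i).openRegion) := by
  have a₁ : MemLp (fun x => G₁ x 0) 2 (volume.restrict (K i).openRegion) :=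
    (EuclideanSpace.proj 0 : Plane →L[ℝ] ℝ).comp_memLp' h₁
  have a₂ : MemLp (fun x => G₂ x 1) 2 (volume.restrict (K i).openRegion) :=
    (EuclideanSpace.proj 1 : Plane →L[ℝ] ℝ).comp_memLp' h₂
  exact (a₁.add a₂).integrable_mul ((Lp.memLp q).mono_measure (restrict_le K M hi))

/-- `N(M)`: the `q ∈ Q(M)` with `∑_{K ⊂ M} ∫_K (div v) q = 0` for all
`v = (v₁, v₂) ∈ V_nc(M) × V_c(M)`. -/
def macroN : Submodule ℝ (MacroL2 K M) where
  carrier := {q | q ∈ macroQ K M ∧ ∀ v₁ v₂ : Plane → ℝ, MemMacroVnc K M v₁ → MemMacroVc K M v₂ →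
    ∀ G₁ G₂ : Plane → Plane, (∀ i ∈ M, IsWeakGradOn (K i).openRegion v₁ G₁) →
      (∀ i ∈ M, IsWeakGradOn (K i).openRegion v₂ G₂) → divPairing K M G₁ G₂ q = 0}
  zero_mem' := by
    refine ⟨Submodule.zero_mem _, fun v₁ v₂ _ _ G₁ G₂ _ _ => Finset.sum_eq_zero fun i hi => ?_⟩
    refine integral_eq_zero_of_ae ?_
    filter_upwards [ae_mono (restrict_le K M hi)
      (Lp.coeFn_zero ℝ 2 (volume.restrict (macroDomain K M)))] with x hx
    simp only [hx, Pi.zero_apply, mul_zero]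
  add_mem' {q r} hq hr := by
    refine ⟨Submodule.add_mem _ hq.1 hr.1, fun v₁ v₂ h₁ h₂ G₁ G₂ g₁ g₂ => ?_⟩
    have e : divPairing K M G₁ G₂ (q + r : MacroL2 K M) =
        divPairing K M G₁ G₂ q + divPairing K M G₁ G₂ r := by
      rw [divPairing, divPairing, divPairing, ← Finset.sum_add_distrib]
      refine Finset.sum_congr rfl fun i hi => ?_
      rw [← integral_add (integrable_div_mul K M hi (g₁ i hi).2.1 (g₂ i hi).2.1 q)
        (integrable_div_mul K M hi (g₁ i hi).2.1 (g₂ i hi).2.1 r)]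
      refine integral_congr_ae ?_
      filter_upwards [ae_mono (restrict_le K M hi) (Lp.coeFn_add q r)] with x hx
      rw [hx, Pi.add_apply, mul_add]
    rw [e, hq.2 v₁ v₂ h₁ h₂ G₁ G₂ g₁ g₂, hr.2 v₁ v₂ h₁ h₂ G₁ G₂ g₁ g₂, add_zero]
  smul_mem' t q hq := by
    refine ⟨Submodule.smul_mem _ t hq.1, fun v₁ v₂ h₁ h₂ G₁ G₂ g₁ g₂ => ?_⟩
    have e : divPairing K M G₁ G₂ (t • q : MacroL2 K M) = t * divPairing K M G₁ G₂ q := by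
      rw [divPairing, divPairing, Finset.mul_sum]
      refine Finset.sum_congr rfl fun i hi => ?_
      rw [← integral_const_mul]
      refine integral_congr_ae ?_
      filter_upwards [ae_mono (restrict_le K M hi) (Lp.coeFn_smul t q)] with x hx
      rw [hx, Pi.smul_apply, smul_eq_mul]
      ring
    rw [e, hq.2 v₁ v₂ h₁ h₂ G₁ G₂ g₁ g₂, mul_zero]

end Macro

/-! ### Meshes -/

/-- A decomposition of `Ω` into finitely many nonoverlapping polygonal elements. Two different
elements meet in a (possibly empty) union of common vertices and common edges, so a vertex of one
element that lies on the boundary of another one is counted as a vertex of both. -/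
structure PolygonalMesh (ι : Type*) [Fintype ι] (Ω : Set Plane) where
  elem : ι → PolygonalElement
  closure_eq : closure Ω = ⋃ i, (elem i).carrier
  nonoverlapping : ∀ i j, i ≠ j → Disjoint (elem i).openRegion (elem j).openRegion
  conforming : ∀ i j, i ≠ j → ∀ z ∈ (elem i).carrier ∩ (elem j).carrier,
    ((elem i).IsVertex z ∧ (elem j).IsVertex z) ∨
      ∃ a b, (elem i).edge a = (elem j).edge b ∧ z ∈ (elem i).edge a

namespace PolygonalMesh

variable {ι : Type*} [Fintype ι] {Ω : Set Plane}

/-- Mesh regularity with parameter `ρ`: every edge of an element `K` is longer than `ρ h_K`, and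
`K` is star-shaped with respect to a ball of radius `ρ h_K`, where `h_K` is the diameter of `K`. -/
def IsRegular (P : PolygonalMesh ι Ω) (ρ : ℝ) : Prop :=
  0 < ρ ∧ ∀ i,
    (∀ a, ρ * Metric.diam (P.elem i).carrier < (P.elem i).edgeLength a) ∧
    ∃ c : Plane, ∀ y ∈ Metric.ball c (ρ * Metric.diam (P.elem i).carrier),
      StarConvex ℝ y (P.elem i).carrier

/-- `x` is an interior vertex of the mesh. -/
def IsInteriorVertex (P : PolygonalMesh ι Ω) (x : Plane) : Prop :=
  (∃ i, (P.elem i).IsVertex x) ∧ x ∈ Ω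

open Classical in
/-- The macroelement `M_x` of all elements having `x` as a vertex. -/
def vertexPatch (P : PolygonalMesh ι Ω) (x : Plane) : Finset ι :=
  Finset.univ.filter fun i => (P.elem i).IsVertex x

end PolygonalMesh

end KouhiaStenberg

end

/-! Constants lie in `N(M)` by the divergence theorem. For a nonconforming component, Green's
formula on each element turns the integral of a partial derivative into a sum over edges of a normal
component times the edge integral of the trace. On a shared edge the two normals are opposite and
the two integrals agree; on any other edge the integral vanishes. For a component in `H₀¹`, the
integral of the gradient is a limit of integrals of gradients of test functions, all zero. See
`sum_edges_eq_zero` and `const_mem_macroN`.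

Conversely, let `q ∈ N(M)` take the value `s i` on the element `i`. The edge integrals of a function
of `V_nc(K)` can be prescribed (`exists_neumann`), so there is a nonconforming `v₁` whose only
nonzero edge integrals are on one shared edge. The condition on `q` then says that the jump of `s`
times the first component of the normal is zero, so `q` does not jump across an edge that is not
horizontal (`eq_of_mem_macroN`). Near the interior vertex `x` the elements of the patch fill a disc.
Its open upper half is connected and contains no point of a horizontal edge at `x`, so all elements
meeting it carry one value; likewise for the lower half (`eq_of_halfDisc`).

Suppose that the upper and lower values differ. Crossing the right half disc from top to bottom must
meet a jump, hence a horizontal edge at `x` (`exists_horizontal`). Test with the conforming `v₂`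
whose trace is the nodal function of `x`: the pairing is, up to sign, the difference of the two
values times half the total length of the horizontal edges at `x`. If there are two such edges, as
at a straight angle, their contributions have the same sign and cannot cancel. Hence the values
agree (`eq_of_above_of_below`).

The analysis rests on star-shapedness. An element is, up to a null set, a disjoint union of
triangles with apex at the center `c` of the ball; polar-type coordinates on them give Green's
formula and the trace inequality, and averaging over segments that end in the ball gives Poincaré's
inequality. Together they make the gradient plus the edge integrals coercive, and Lax–Milgram then
solves the Neumann and Dirichlet problems. The nodal function is a maximum of thin Lipschitz hat
functions along the edges at `x`. It is placed in `H₀¹(M)` by mollification and weak compactness,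
then made harmonic element by element without changing its traces. -/

noncomputable section

namespace KouhiaStenberg

/-! ### Planar cross product and integration over triangles. -/

/-- The planar cross product. -/
def cross (u v : Plane) : ℝ := u 0 * v 1 - u 1 * v 0

theorem cross_add_left (u v w : Plane) : cross (u + v) w = cross u w + cross v w := by
  simp [cross]; ring

theorem cross_add_right (u v w : Plane) : cross u (v + w) = cross u v + cross u w := by
  simp [cross]; ring

theorem cross_sub_left (u v w : Plane) : cross (u - v) w = cross u w - cross v w := by
  simp [cross]; ring

theorem cross_sub_right (u v w : Plane) : cross u (v - w) = cross u v - cross u w := by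
  simp [cross]; ring

theorem cross_smul_left (t : ℝ) (u v : Plane) : cross (t • u) v = t * cross u v := by
  simp [cross]; ring

theorem cross_smul_right (t : ℝ) (u v : Plane) : cross u (t • v) = t * cross u v := by
  simp [cross]; ring

theorem cross_neg_left (u v : Plane) : cross (-u) v = - cross u v := by
  simp [cross]; ring

theorem cross_neg_right (u v : Plane) : cross u (-v) = - cross u v := by
  simp [cross]; ring

@[simp] theorem cross_self (u : Plane) : cross u u = 0 := by
  simp [cross]; ring

@[simp] theorem cross_zero_left (u : Plane) : cross 0 u = 0 := by
  simp [cross]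

theorem cross_comm (u v : Plane) : cross u v = - cross v u := by
  simp [cross]; ring

theorem exists_smul_eq_of_cross_eq_zero {u v : Plane} (hu : u ≠ 0) (h : cross u v = 0) :
    ∃ k : ℝ, v = k • u := by
  have h' : u 0 * v 1 = u 1 * v 0 := by simp only [cross] at h; linarith
  by_cases h0 : u 0 = 0
  · have h1 : u 1 ≠ 0 := by
      intro h1
      apply hu
      ext i
      fin_cases i <;> simp [h0, h1]
    refine ⟨v 1 / u 1, ?_⟩
    have hv : v 0 = 0 := by
      rw [h0, zero_mul] at h'
      exact (mul_eq_zero.1 h'.symm).resolve_left h1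
    ext i
    fin_cases i
    · simp [h0, hv]
    · simp [h1]
  · refine ⟨v 0 / u 0, ?_⟩
    ext i
    fin_cases i
    · simp [h0]
    · simp; field_simp; linarith

/-- Expansion of a vector in the basis `u`, `v`. -/
theorem cross_smul_eq (u v e : Plane) :
    cross u v • e = cross e v • u + cross u e • v := by
  ext i
  fin_cases i <;> simp [cross] <;> ring

/-- The map `(s, t) ↦ c + t (p + s τ)` parametrizing a triangle. -/
def coneMap (c p τ : Plane) (w : Plane) : Plane := c + w 1 • (p + w 0 • τ)

/-- The open unit square. -/
def openSquare : Set Plane := {w | w 0 ∈ Ioo (0 : ℝ) 1 ∧ w 1 ∈ Ioo (0 : ℝ) 1}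

theorem measurableSet_openSquare : MeasurableSet openSquare := by
  apply MeasurableSet.inter
  · exact measurableSet_Ioo.preimage (by fun_prop : Measurable fun w : Plane => w 0)
  · exact measurableSet_Ioo.preimage (by fun_prop : Measurable fun w : Plane => w 1)

/-- The open triangle with vertices `c`, `c + p`, `c + p + τ`. -/
def openTriangle (c p τ : Plane) : Set Plane := coneMap c p τ '' openSquare

theorem coneMap_injOn {c p τ : Plane} (h : cross p τ ≠ 0) : InjOn (coneMap c p τ) openSquare := by
  rintro w ⟨-, hw⟩ w' ⟨-, hw'⟩ hww
  have h1 : w 1 • (p + w 0 • τ) = w' 1 • (p + w' 0 • τ) := by simpa [coneMap] using hww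
  have e1 : w 1 = w' 1 := by
    have := congrArg (fun z => cross z τ) h1
    simp only [cross_smul_left, cross_add_left, cross_self, mul_zero, add_zero] at this
    exact mul_right_cancel₀ h this
  have e0 : w 0 = w' 0 := by
    have := congrArg (fun z => cross p z) h1
    simp only [cross_smul_right, cross_add_right, cross_self, zero_add, e1] at this
    exact mul_right_cancel₀ h (mul_left_cancel₀ hw'.1.ne' this)
  ext i
  fin_cases i
  · exact e0
  · exact e1

theorem lin_det (a b : Plane) :
    ((EuclideanSpace.proj 0 : Plane →L[ℝ] ℝ).smulRight a +
      (EuclideanSpace.proj 1 : Plane →L[ℝ] ℝ).smulRight b).det = cross a b := by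
  rw [ContinuousLinearMap.det, ← LinearMap.det_toMatrix (EuclideanSpace.basisFun (Fin 2) ℝ).toBasis,
    Matrix.det_fin_two]
  simp [LinearMap.toMatrix_apply, cross]
  ring

theorem coneMap_hasFDerivAt (c p τ w : Plane) :
    HasFDerivAt (coneMap c p τ) ((EuclideanSpace.proj 0 : Plane →L[ℝ] ℝ).smulRight (w 1 • τ) +
      (EuclideanSpace.proj 1 : Plane →L[ℝ] ℝ).smulRight (p + w 0 • τ)) w := by
  have h0 : HasFDerivAt (fun w : Plane => w 0) (EuclideanSpace.proj 0 : Plane →L[ℝ] ℝ) w :=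
    (EuclideanSpace.proj 0 : Plane →L[ℝ] ℝ).hasFDerivAt
  have h1 : HasFDerivAt (fun w : Plane => w 1) (EuclideanSpace.proj 1 : Plane →L[ℝ] ℝ) w :=
    (EuclideanSpace.proj 1 : Plane →L[ℝ] ℝ).hasFDerivAt
  have := (h1.smul ((h0.smul_const τ).const_add p)).const_add c
  refine this.congr_fderiv ?_
  ext v i
  simp
  ring

theorem measurableSet_openTriangle {c p τ : Plane} (h : cross p τ ≠ 0) :
    MeasurableSet (openTriangle c p τ) :=
  measurable_image_of_fderivWithin measurableSet_openSquare
    (fun w _ => (coneMap_hasFDerivAt c p τ w).hasFDerivWithinAt) (coneMap_injOn h)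

theorem setIntegral_openSquare (g : ℝ → ℝ → ℝ) (hg : Continuous fun w : ℝ × ℝ => g w.1 w.2) :
    ∫ w in openSquare, g (w 0) (w 1) = ∫ s in (0 : ℝ)..1, ∫ t in (0 : ℝ)..1, g s t := by
  have hm : MeasurePreserving (fun w : Plane => (w 0, w 1)) volume volume :=
    (volume_preserving_finTwoArrow ℝ).comp (EuclideanSpace.volume_preserving_symm_measurableEquiv_toLp (Fin 2))
  have he : MeasurableEmbedding (fun w : Plane => (w 0, w 1)) :=
    (MeasurableEquiv.finTwoArrow.measurableEmbedding).comp
      (MeasurableEquiv.toLp 2 (Fin 2 → ℝ)).symm.measurableEmbedding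
  have hs : openSquare = (fun w : Plane => (w 0, w 1)) ⁻¹' (Ioo (0 : ℝ) 1 ×ˢ Ioo (0 : ℝ) 1) := by
    ext w; simp [openSquare]
  rw [hs, hm.setIntegral_preimage_emb he (fun w => g w.1 w.2), Measure.volume_eq_prod,
    setIntegral_prod]
  · simp_rw [intervalIntegral.integral_of_le zero_le_one, integral_Ioc_eq_integral_Ioo]
  · exact (hg.continuousOn.integrableOn_compact (isCompact_Icc.prod isCompact_Icc)).mono_set
      (prod_mono Ioo_subset_Icc_self Ioo_subset_Icc_self)

/-- Change of variables along `coneMap`, whose Jacobian determinant at `(s, t)` is `-t * cross p τ`;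
this produces the weight `t`. -/
theorem setIntegral_openTriangle {c p τ : Plane} (h : cross p τ ≠ 0) {f : Plane → ℝ}
    (hf : Continuous f) :
    ∫ z in openTriangle c p τ, f z =
      |cross p τ| * ∫ s in (0 : ℝ)..1, ∫ t in (0 : ℝ)..1, t * f (c + t • (p + s • τ)) := by
  rw [openTriangle, integral_image_eq_integral_abs_det_fderiv_smul volume measurableSet_openSquare
    (fun w _ => (coneMap_hasFDerivAt c p τ w).hasFDerivWithinAt) (coneMap_injOn h) f]
  rw [← intervalIntegral.integral_const_mul]
  simp_rw [← intervalIntegral.integral_const_mul]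
  rw [← setIntegral_openSquare (fun s t => |cross p τ| * (t * f (c + t • (p + s • τ))))
    (by fun_prop)]
  refine setIntegral_congr_fun measurableSet_openSquare fun w hw => ?_
  have : cross (w 1 • τ) (p + w 0 • τ) = - (w 1 * cross p τ) := by
    simp [cross]; ring
  simp only [lin_det, this, abs_neg, abs_mul, abs_of_pos hw.2.1, coneMap, smul_eq_mul]
  ring

theorem finRotate_ne_self {n : ℕ} (hn : 2 ≤ n) (i : Fin n) : finRotate n i ≠ i := by
  obtain ⟨m, rfl⟩ : ∃ m, n = m + 2 := ⟨n - 2, by omega⟩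
  intro h
  rw [finRotate_apply] at h
  have := congrArg Fin.val h
  rw [Fin.val_add_one] at this
  split_ifs at this with h1
  · rw [h1] at this; simp at this
  · omega

theorem finRotate_finRotate_ne_self {n : ℕ} (hn : 3 ≤ n) (i : Fin n) :
    finRotate n (finRotate n i) ≠ i := by
  obtain ⟨m, rfl⟩ : ∃ m, n = m + 3 := ⟨n - 3, by omega⟩
  intro h
  rw [finRotate_apply, finRotate_apply] at h
  have := congrArg Fin.val h
  rw [Fin.val_add_one, Fin.val_add_one] at this
  have hi := i.2
  split_ifs at this with h1 h2
  · rw [Fin.ext_iff, Fin.val_add_one] at h1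
    split_ifs at h1
    · simp at h1
    · simp at h1; omega
  · rw [h2] at this; simp at this
  · omega

/-- A property that propagates along the cyclic rotation holds everywhere. -/
theorem forall_of_finRotate {n : ℕ} {Q : Fin n → Prop} (h : ∀ i, Q i → Q (finRotate n i))
    {i₀ : Fin n} (h₀ : Q i₀) : ∀ i, Q i := by
  obtain ⟨m, rfl⟩ : ∃ m, n = m + 1 := ⟨n - 1, by have := i₀.2; omega⟩
  have key : ∀ k : ℕ, Q (i₀ + Fin.ofNat (m + 1) k) := by
    intro k
    induction k with
    | zero => simpa using h₀
    | succ k ih =>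
      have := h _ ih
      rw [finRotate_apply] at this
      convert this using 1
      rw [add_assoc]
      congr 1
      ext
      simp [Fin.val_add]
  intro i
  have := key (i - i₀).val
  rwa [Fin.ofNat_val_eq_self, add_sub_cancel] at this

/-- Otherwise the interior of `s` and the complement of its closure would separate `t`. -/
theorem inter_frontier_nonempty_of_isPreconnected {X : Type*} [TopologicalSpace X] {s t : Set X}
    (ht : IsPreconnected t) (h1 : (t ∩ s).Nonempty) (h2 : (t ∩ sᶜ).Nonempty) :
    (t ∩ frontier s).Nonempty := by
  by_contra hne
  rw [not_nonempty_iff_eq_empty] at hne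
  have hcl : t ∩ closure s ⊆ interior s := fun z hz => by
    by_contra h
    exact (hne ▸ (⟨hz.1, hz.2, h⟩ : z ∈ t ∩ frontier s) : z ∈ (∅ : Set X))
  obtain ⟨y, hy, hyi, hyc⟩ := ht (interior s) (closure s)ᶜ isOpen_interior
    isClosed_closure.isOpen_compl
    (fun z hz => (em (z ∈ closure s)).imp (fun h => hcl ⟨hz, h⟩) id)
    (h1.mono fun z hz => ⟨hz.1, hcl ⟨hz.1, subset_closure hz.2⟩⟩)
    (h2.mono fun z hz => ⟨hz.1, fun h => hz.2 (interior_subset (hcl ⟨hz.1, h⟩))⟩)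
  exact hyc (subset_closure (interior_subset hyi))

/-! ### Edges, vertices and star-shaped elements. -/

namespace PolygonalElement

variable (K : PolygonalElement)

/-- The edge vector of the `a`-th edge. -/
def edgeVec (a : Fin K.n) : Plane := K.poly (finRotate K.n a) - K.poly a

theorem edgeVec_ne_zero (a : Fin K.n) : K.edgeVec a ≠ 0 := by
  rw [edgeVec, sub_ne_zero]
  exact fun h => finRotate_ne_self (by have := K.three_le; omega) a (K.injective h)

theorem edgeLength_eq (a : Fin K.n) : K.edgeLength a = ‖K.edgeVec a‖ := by
  rw [edgeLength, edgeVec, dist_comm, dist_eq_norm]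

theorem edgeLength_pos (a : Fin K.n) : 0 < K.edgeLength a := by
  rw [edgeLength_eq]; exact norm_pos_iff.2 (K.edgeVec_ne_zero a)

theorem edgePath_apply (a : Fin K.n) (s : ℝ) :
    K.poly.edgePath ℝ a s = K.poly a + s • K.edgeVec a := by
  rw [Polygon.edgePath, AffineMap.lineMap_apply, edgeVec]
  simp [add_comm]

theorem mem_edge {a : Fin K.n} {z : Plane} :
    z ∈ K.edge a ↔ ∃ s ∈ Icc (0 : ℝ) 1, K.poly a + s • K.edgeVec a = z := by
  rw [edge, Polygon.edgeSet_eq_image_edgePath]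
  simp only [mem_image, edgePath_apply]

theorem left_mem_edge (a : Fin K.n) : K.poly a ∈ K.edge a :=
  K.mem_edge.2 ⟨0, by simp, by simp⟩

theorem right_mem_edge (a : Fin K.n) : K.poly (finRotate K.n a) ∈ K.edge a :=
  K.mem_edge.2 ⟨1, by simp, by simp [edgeVec]⟩

theorem edge_subset_frontier (a : Fin K.n) : K.edge a ⊆ frontier K.carrier := by
  rw [K.frontier_eq]
  exact subset_iUnion (fun i => K.poly.edgeSet ℝ i) a

theorem frontier_subset : frontier K.carrier ⊆ K.carrier :=
  K.isCompact.isClosed.frontier_subset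

theorem edge_subset_carrier (a : Fin K.n) : K.edge a ⊆ K.carrier :=
  (K.edge_subset_frontier a).trans K.frontier_subset

theorem exists_edge_of_mem_frontier {z : Plane} (h : z ∈ frontier K.carrier) :
    ∃ a, z ∈ K.edge a := by
  rw [K.frontier_eq] at h
  exact mem_iUnion.1 h

theorem isCompact_edge (a : Fin K.n) : IsCompact (K.edge a) := by
  rw [edge, Polygon.edgeSet_eq_image_edgePath]
  exact isCompact_Icc.image (by
    have : (K.poly.edgePath ℝ a : ℝ → Plane) = fun s => K.poly a + s • K.edgeVec a :=
      funext fun s => K.edgePath_apply a s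
    rw [this]; fun_prop)

/-- Two different edges meet at most in common end points. -/
theorem isVertex_of_mem_edges {a b : Fin K.n} (hab : a ≠ b) {z : Plane} (ha : z ∈ K.edge a)
    (hb : z ∈ K.edge b) : (z = K.poly a ∨ z = K.poly (finRotate K.n a)) ∧
      (z = K.poly b ∨ z = K.poly (finRotate K.n b)) := by
  simpa using K.simple a b hab ⟨ha, hb⟩

/-- A vertex on an edge is one of its end points. -/
theorem eq_or_eq_of_isVertex {a : Fin K.n} {z : Plane} (hz : K.IsVertex z) (ha : z ∈ K.edge a) :
    z = K.poly a ∨ z = K.poly (finRotate K.n a) := by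
  obtain ⟨b, rfl⟩ := hz
  by_cases h : a = b
  · exact Or.inl (by rw [h])
  · exact (K.isVertex_of_mem_edges h ha (K.left_mem_edge b)).1

theorem edge_eq_of_mem {a b : Fin K.n} {z : Plane} (ha : z ∈ K.edge a) (hb : z ∈ K.edge b)
    (hz : ¬ K.IsVertex z) : a = b := by
  by_contra h
  rcases (K.isVertex_of_mem_edges h ha hb).1 with h | h
  · exact hz ⟨_, h.symm⟩
  · exact hz ⟨_, h.symm⟩

/-- `K` is star-shaped with respect to the ball of radius `r > 0` around `c`. -/
def IsStar (c : Plane) (r : ℝ) : Prop :=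
  0 < r ∧ ∀ y ∈ Metric.ball c r, StarConvex ℝ y K.carrier

variable {K} {c : Plane} {r : ℝ}

/-- The homothety with center `z` and ratio `t` maps the ball around `c` onto a ball of radius `t *
r` around the given point, and star-shapedness keeps the image in the element. -/
theorem IsStar.mem_interior (h : K.IsStar c r) {z : Plane} (hz : z ∈ K.carrier) {t : ℝ}
    (ht : 0 < t) (ht1 : t ≤ 1) : z + t • (c - z) ∈ K.openRegion := by
  rw [openRegion, _root_.mem_interior]
  refine ⟨Metric.ball (z + t • (c - z)) (t * r), ?_, Metric.isOpen_ball,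
    Metric.mem_ball_self (mul_pos ht h.1)⟩
  intro w hw
  rw [Metric.mem_ball, dist_eq_norm] at hw
  have hy : c + t⁻¹ • (w - (z + t • (c - z))) ∈ Metric.ball c r := by
    rw [Metric.mem_ball, dist_eq_norm, add_sub_cancel_left, norm_smul, norm_inv,
      Real.norm_of_nonneg ht.le, inv_mul_lt_iff₀ ht]
    exact hw
  have := h.2 _ hy hz ht.le (sub_nonneg.2 ht1) (by ring)
  convert this using 1
  rw [smul_add, smul_smul, mul_inv_cancel₀ ht.ne']
  module

theorem IsStar.center_mem (h : K.IsStar c r) : c ∈ K.openRegion := by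
  have := h.mem_interior (K.edge_subset_carrier ⟨0, by have := K.three_le; omega⟩
    (K.left_mem_edge _)) one_pos le_rfl
  simpa using this

theorem not_mem_frontier_of_mem_openRegion {z : Plane} (hz : z ∈ K.openRegion) :
    z ∉ frontier K.carrier := fun h => h.2 hz

theorem not_mem_edge_of_mem_openRegion {z : Plane} (hz : z ∈ K.openRegion) (a : Fin K.n) :
    z ∉ K.edge a := fun h => not_mem_frontier_of_mem_openRegion hz (K.edge_subset_frontier a h)

/-- A boundary point is determined by its direction from the center. -/
theorem IsStar.eq_of_ray (h : K.IsStar c r) {z w : Plane} (hz : z ∈ frontier K.carrier)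
    (hw : w ∈ frontier K.carrier) {k : ℝ} (hk : 0 < k) (e : w - c = k • (z - c)) : w = z := by
  -- If `k < 1`, then `w` lies strictly between `z` and `c`, hence in the interior. Applying this
  -- both ways gives `k = 1`.
  have key : ∀ {z w : Plane}, z ∈ frontier K.carrier → w ∈ frontier K.carrier → ∀ {k : ℝ}, 0 < k →
      w - c = k • (z - c) → 1 ≤ k := by
    intro z w hz hw k hk e
    by_contra! hk1
    have := h.mem_interior (K.frontier_subset hz) (t := 1 - k) (by linarith) (by linarith)
    refine not_mem_frontier_of_mem_openRegion this ?_
    convert hw using 1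
    rw [sub_eq_iff_eq_add] at e
    rw [e]; module
  have h1 := key hz hw hk e
  have h2 := key hw hz (inv_pos.2 hk) (by rw [e, smul_smul, inv_mul_cancel₀ hk.ne', one_smul])
  have h3 : k = 1 := le_antisymm ((one_le_inv₀ hk).1 h2) h1
  rw [h3, one_smul] at e
  exact sub_left_injective e

/-- The ray from `c` through `z`, followed beyond `z`, leaves the bounded element and must cross its
frontier on the way. -/
theorem exists_ray {z : Plane} (hz : z ∈ K.carrier) (hzc : z ≠ c) :
    ∃ k : ℝ, 1 ≤ k ∧ c + k • (z - c) ∈ frontier K.carrier := by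
  have hp : IsPreconnected ((fun k : ℝ => c + k • (z - c)) '' Ici 1) :=
    isPreconnected_Ici.image _ (by fun_prop)
  have hd : 0 < ‖z - c‖ := norm_pos_iff.2 (sub_ne_zero.2 hzc)
  have hne : ((fun k : ℝ => c + k • (z - c)) '' Ici 1 ∩ K.carrierᶜ).Nonempty := by
    obtain ⟨R, hR⟩ := K.isCompact.isBounded.subset_closedBall c
    refine ⟨_, ⟨⟨max 1 ((|R| + 1) / ‖z - c‖), mem_Ici.2 (le_max_left _ _), rfl⟩, fun hm => ?_⟩⟩
    have := hR hm
    rw [Metric.mem_closedBall, dist_eq_norm, add_sub_cancel_left, norm_smul] at this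
    have h2 : (|R| + 1) / ‖z - c‖ ≤ ‖max 1 ((|R| + 1) / ‖z - c‖)‖ :=
      (le_max_right _ _).trans (le_abs_self _)
    rw [div_le_iff₀ hd] at h2
    linarith [le_abs_self R]
  obtain ⟨w, ⟨k, hk, rfl⟩, hw⟩ :=
    inter_frontier_nonempty_of_isPreconnected hp ⟨z, ⟨1, by simp, by simp⟩, hz⟩ hne
  exact ⟨k, hk, hw⟩

theorem IsStar.vertex_ne (h : K.IsStar c r) (a : Fin K.n) : K.poly a - c ≠ 0 := by
  rw [sub_ne_zero]
  intro e
  exact not_mem_edge_of_mem_openRegion h.center_mem a (e ▸ K.left_mem_edge a)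

/-- If `c` were on the line of the edge, either both end points would lie on one ray from `c`,
against `eq_of_ray`, or `c` would lie on the edge itself, against `center_mem`. -/
theorem IsStar.cross_ne_zero (h : K.IsStar c r) (a : Fin K.n) :
    cross (K.poly a - c) (K.edgeVec a) ≠ 0 := by
  intro h0
  obtain ⟨k, hk⟩ := exists_smul_eq_of_cross_eq_zero (h.vertex_ne a) h0
  rcases lt_or_ge 0 (1 + k) with h1 | h1
  · have : K.poly (finRotate K.n a) - c = (1 + k) • (K.poly a - c) := by
      rw [add_smul, one_smul, ← hk, edgeVec]; abel
    have e := h.eq_of_ray (K.edge_subset_frontier a (K.left_mem_edge a))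
      (K.edge_subset_frontier a (K.right_mem_edge a)) h1 this
    exact K.edgeVec_ne_zero a (by rw [edgeVec, e, sub_self])
  · have hk0 : k ≤ -1 := by linarith
    refine not_mem_edge_of_mem_openRegion h.center_mem a (K.mem_edge.2 ⟨-k⁻¹, ⟨?_, ?_⟩, ?_⟩)
    · rw [Left.nonneg_neg_iff]; exact inv_nonpos.2 (by linarith)
    · rw [← inv_neg]; exact inv_le_one_of_one_le₀ (by linarith)
    · rw [hk, smul_smul, neg_mul, inv_mul_cancel₀ (by linarith)]; module

/-- Consecutive edges have the same orientation with respect to the center. -/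
theorem IsStar.cross_mul_cross_pos (h : K.IsStar c r) (a : Fin K.n) :
    0 < cross (K.poly a - c) (K.edgeVec a) *
      cross (K.poly (finRotate K.n a) - c) (K.edgeVec (finRotate K.n a)) := by
  -- With opposite signs the boundary folds back at the shared vertex, so a ray from `c` close to
  -- that vertex hits both edges away from it. By `eq_of_ray` the two hits are a single point common
  -- to both edges, which simplicity of the polygon forbids. Below, `s t` solves `cross u w = 0`,
  -- and `D * E < 0` makes it positive.
  by_contra hneg
  set b := finRotate K.n a with hb
  set p := K.poly b - c with hp
  set D := cross (K.poly a - c) (K.edgeVec a) with hD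
  set E := cross p (K.edgeVec b) with hE
  have hD0 : D ≠ 0 := h.cross_ne_zero a
  have hE0 : E ≠ 0 := h.cross_ne_zero b
  have hDE : D * E < 0 := lt_of_le_of_ne (not_lt.1 hneg) (mul_ne_zero hD0 hE0)
  have hab : a ≠ b := (finRotate_ne_self (by have := K.three_le; omega) a).symm
  have haa : K.poly a - c = p - K.edgeVec a := by rw [hp, edgeVec]; abel
  have hDp : D = cross p (K.edgeVec a) := by rw [hD, haa, cross_sub_left, cross_self, sub_zero]
  -- the points `p - s τ` and `p + t τ'` are parallel for `s = s(t)` small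
  set m := cross (K.edgeVec a) (K.edgeVec b) with hm
  let den : ℝ → ℝ := fun t => D - t * m
  let s : ℝ → ℝ := fun t => - (t * E) / den t
  have hden0 : ContinuousAt den 0 := by fun_prop
  have hd : den 0 ≠ 0 := by simpa [den] using hD0
  have hs : ContinuousAt s 0 := ContinuousAt.div (by fun_prop) hden0 hd
  have hs0 : s 0 = 0 := by simp [s]
  have hpp : 0 < inner ℝ p p := by
    rw [real_inner_self_eq_norm_sq]
    exact pow_pos (norm_pos_iff.2 (h.vertex_ne b)) 2
  have e1 : ∀ᶠ t in 𝓝 (0 : ℝ), s t < 1 := hs.eventually_lt_const (by rw [hs0]; norm_num)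
  have e2 : ∀ᶠ t in 𝓝 (0 : ℝ), 0 < D * den t := by
    refine (show ContinuousAt (fun t => D * den t) 0 by fun_prop).eventually (lt_mem_nhds ?_)
    simp only [den, zero_mul, sub_zero]; exact mul_self_pos.2 hD0
  have e3 : ∀ᶠ t in 𝓝 (0 : ℝ), 0 < inner ℝ p (p - s t • K.edgeVec a) := by
    have hc : ContinuousAt (fun t => inner ℝ p (p - s t • K.edgeVec a)) 0 :=
      continuousAt_const.inner (continuousAt_const.sub (hs.smul continuousAt_const))
    refine hc.eventually (lt_mem_nhds ?_)
    beta_reduce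
    rw [hs0, zero_smul, sub_zero]
    exact hpp
  have e4 : ∀ᶠ t in 𝓝 (0 : ℝ), 0 < inner ℝ p (p + t • K.edgeVec b) := by
    have hc : ContinuousAt (fun t : ℝ => inner ℝ p (p + t • K.edgeVec b)) 0 :=
      continuousAt_const.inner (by fun_prop)
    refine hc.eventually (lt_mem_nhds ?_)
    beta_reduce
    rw [zero_smul, add_zero]
    exact hpp
  have e5 : ∀ᶠ t in 𝓝[>] (0 : ℝ), t < 1 := nhdsWithin_le_nhds (gt_mem_nhds one_pos)
  obtain ⟨t, ht1, ht0, h1, h2, h3, h4⟩ := (e5.and (eventually_mem_nhdsWithin.and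
    (nhdsWithin_le_nhds (e1.and (e2.and (e3.and e4)))))).exists
  have ht0 : 0 < t := ht0
  have hdt : den t ≠ 0 := fun h => by rw [h, mul_zero] at h2; exact h2.false
  have hst : 0 < s t := by
    have : s t = -(D * E) * t / (D * den t) := by
      simp only [s]; field_simp
    rw [this]
    exact div_pos (mul_pos (by linarith) ht0) h2
  set u := p - s t • K.edgeVec a with hu
  set w := p + t • K.edgeVec b with hw
  have hue : c + u ∈ K.edge a := by
    refine K.mem_edge.2 ⟨1 - s t, ⟨by linarith, by linarith⟩, ?_⟩
    rw [sub_eq_iff_eq_add] at haa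
    rw [hu, haa]; module
  have hwe : c + w ∈ K.edge b := by
    refine K.mem_edge.2 ⟨t, ⟨ht0.le, ht1.le⟩, ?_⟩
    rw [hw, hp]; module
  have hcr : cross u w = 0 := by
    have : cross u w = t * E + s t * den t := by
      rw [hu, hw, cross_sub_left, cross_add_right, cross_add_right, cross_self, cross_smul_left,
        cross_smul_right, cross_smul_left, cross_smul_right, cross_comm (K.edgeVec a) p, ← hDp]
      simp only [den]; ring
    rw [this]; simp only [s]; field_simp; ring
  have hu0 : u ≠ 0 := fun h => by rw [h, inner_zero_right] at h3; exact h3.false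
  obtain ⟨k, hk⟩ := exists_smul_eq_of_cross_eq_zero hu0 hcr
  have hk0 : 0 < k := by
    rw [hk, inner_smul_right] at h4
    exact (pos_iff_pos_of_mul_pos h4).2 h3
  have heq := h.eq_of_ray (K.edge_subset_frontier a hue) (K.edge_subset_frontier b hwe) hk0
    (by simpa using hk)
  rw [heq] at hwe
  have hv := K.isVertex_of_mem_edges hab hue hwe
  -- `c + u` is neither the right end point of `a` nor the left one
  have hne : c + u ≠ K.poly b := by
    intro e
    have : s t • K.edgeVec a = 0 := by
      have : u = p := by rw [hp, ← e]; abel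
      rw [hu] at this; simpa using this
    rcases smul_eq_zero.1 this with h | h
    · exact hst.ne' h
    · exact K.edgeVec_ne_zero a h
  rcases hv.1 with h5 | h5
  · rcases hv.2 with h6 | h6
    · exact hne h6
    -- Here the two edges would share both end points, impossible with at least three vertices.
    · rw [h5] at h6
      exact finRotate_finRotate_ne_self K.three_le a (K.injective h6).symm
  · exact hne h5

/-- `σ` is the orientation of the polygon around `c`: the sign found on one edge propagates to the
next one, and so around the whole boundary. -/
theorem IsStar.exists_sign (h : K.IsStar c r) : ∃ σ : ℝ, (σ = 1 ∨ σ = -1) ∧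
    ∀ a, 0 < σ * cross (K.poly a - c) (K.edgeVec a) := by
  have a₀ : Fin K.n := ⟨0, by have := K.three_le; omega⟩
  have key : ∀ σ : ℝ, 0 < σ * cross (K.poly a₀ - c) (K.edgeVec a₀) →
      ∀ a, 0 < σ * cross (K.poly a - c) (K.edgeVec a) := by
    intro σ h0
    refine forall_of_finRotate (Q := fun a => 0 < σ * cross (K.poly a - c) (K.edgeVec a)) ?_ h0
    intro a ha
    have h1 := h.cross_mul_cross_pos a
    rcases pos_and_pos_or_neg_and_neg_of_mul_pos ha with ⟨h2, h3⟩ | ⟨h2, h3⟩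
    · exact mul_pos h2 ((pos_iff_pos_of_mul_pos h1).1 h3)
    · exact mul_pos_of_neg_of_neg h2 ((neg_iff_neg_of_mul_pos h1).1 h3)
  rcases (h.cross_ne_zero a₀).lt_or_gt with h0 | h0
  · exact ⟨-1, Or.inr rfl, key _ (by linarith)⟩
  · exact ⟨1, Or.inl rfl, key _ (by linarith)⟩

end PolygonalElement

/-! ### Null sets and the decomposition of an element into triangular sectors. -/

theorem volume_line (c : Plane) {v : Plane} (hv : v ≠ 0) :
    volume {z : Plane | cross (z - c) v = 0} = 0 := by
  let L : Plane →ₗ[ℝ] ℝ :=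
    { toFun := fun z => cross z v
      map_add' := fun x y => cross_add_left x y v
      map_smul' := fun t x => cross_smul_left t x v }
  have hL : L.ker ≠ ⊤ := by
    intro h
    rw [LinearMap.ker_eq_top] at h
    apply hv
    have h0 : cross (EuclideanSpace.single 0 1) v = 0 := LinearMap.congr_fun h _
    have h1 : cross (EuclideanSpace.single 1 1) v = 0 := LinearMap.congr_fun h _
    simp [cross] at h0 h1
    ext i
    fin_cases i
    · exact h1
    · exact h0
  have := (measurePreserving_sub_right (volume : Measure Plane) c).measure_preimage
    (L.ker.closed_of_finiteDimensional.measurableSet.nullMeasurableSet)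
  rw [Measure.addHaar_submodule _ _ hL] at this
  exact this

namespace PolygonalElement

variable (K : PolygonalElement)

theorem volume_edge (a : Fin K.n) : volume (K.edge a) = 0 := by
  refine measure_mono_null (fun z hz => ?_) (volume_line (K.poly a) (K.edgeVec_ne_zero a))
  obtain ⟨s, -, rfl⟩ := K.mem_edge.1 hz
  simp [cross_smul_left]

theorem volume_frontier : volume (frontier K.carrier) = 0 := by
  rw [K.frontier_eq]
  exact measure_iUnion_null fun a => K.volume_edge a

theorem isOpen_openRegion : IsOpen K.openRegion := isOpen_interior

theorem measurableSet_openRegion : MeasurableSet K.openRegion := isOpen_interior.measurableSet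

theorem openRegion_subset : K.openRegion ⊆ K.carrier := interior_subset

theorem carrier_diff : K.carrier \ K.openRegion = frontier K.carrier :=
  K.isCompact.isClosed.frontier_eq.symm

theorem openRegion_ae_eq : K.openRegion =ᵐ[volume] K.carrier := by
  rw [ae_eq_set]
  refine ⟨by rw [sdiff_eq_empty.2 K.openRegion_subset]; exact measure_empty, ?_⟩
  rw [carrier_diff]; exact K.volume_frontier

theorem volume_openRegion_lt_top : volume K.openRegion < ⊤ :=
  (measure_mono K.openRegion_subset).trans_lt K.isCompact.measure_lt_top

instance isFiniteMeasure_openRegion : IsFiniteMeasure (volume.restrict K.openRegion) :=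
  ⟨by rw [Measure.restrict_apply_univ]; exact K.volume_openRegion_lt_top⟩

theorem integrableOn_of_continuous {E : Type*} [NormedAddCommGroup E] {f : Plane → E}
    (hf : Continuous f) : IntegrableOn f K.openRegion :=
  (hf.continuousOn.integrableOn_compact K.isCompact).mono_set K.openRegion_subset

variable {K} {c : Plane} {r : ℝ}

/-- The open triangle spanned by `c` and the `a`-th edge. -/
def sector (K : PolygonalElement) (c : Plane) (a : Fin K.n) : Set Plane :=
  openTriangle c (K.poly a - c) (K.edgeVec a)

theorem mem_sector {a : Fin K.n} {z : Plane} : z ∈ K.sector c a ↔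
    ∃ s ∈ Ioo (0 : ℝ) 1, ∃ t ∈ Ioo (0 : ℝ) 1, z = c + t • (K.poly a + s • K.edgeVec a - c) := by
  constructor
  · rintro ⟨w, ⟨h0, h1⟩, rfl⟩
    exact ⟨w 0, h0, w 1, h1, by simp only [coneMap]; module⟩
  · rintro ⟨s, hs, t, ht, rfl⟩
    exact ⟨!₂[s, t], ⟨by simpa using hs, by simpa using ht⟩, by simp only [coneMap]; simp; module⟩

theorem IsStar.measurableSet_sector (h : K.IsStar c r) (a : Fin K.n) :
    MeasurableSet (K.sector c a) :=
  measurableSet_openTriangle (h.cross_ne_zero a)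

theorem edge_point_mem {a : Fin K.n} {s : ℝ} (hs : s ∈ Ioo (0 : ℝ) 1) :
    K.poly a + s • K.edgeVec a ∈ K.edge a := K.mem_edge.2 ⟨s, Ioo_subset_Icc_self hs, rfl⟩

theorem edge_point_ne {a : Fin K.n} {s : ℝ} (hs : s ∈ Ioo (0 : ℝ) 1) :
    ¬ K.IsVertex (K.poly a + s • K.edgeVec a) := by
  intro hv
  rcases K.eq_or_eq_of_isVertex hv (edge_point_mem hs) with h | h
  · have : s • K.edgeVec a = 0 := by simpa using h
    exact (smul_ne_zero hs.1.ne' (K.edgeVec_ne_zero a)) this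
  · have : (1 - s) • K.edgeVec a = 0 := by
      have h2 : K.poly (finRotate K.n a) = K.poly a + K.edgeVec a := by rw [edgeVec]; abel
      rw [h2] at h
      rw [sub_smul, one_smul, sub_eq_zero]
      exact (add_left_cancel h).symm
    exact (smul_ne_zero (sub_pos.2 hs.2).ne' (K.edgeVec_ne_zero a)) this

theorem IsStar.sector_subset (h : K.IsStar c r) (a : Fin K.n) : K.sector c a ⊆ K.openRegion := by
  intro z hz
  obtain ⟨s, hs, t, ht, rfl⟩ := mem_sector.1 hz
  have := h.mem_interior (K.edge_subset_carrier a (edge_point_mem hs)) (t := 1 - t)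
    (by linarith [ht.2]) (by linarith [ht.1])
  convert this using 1
  module

/-- A common point would put relative interior points of both edges on one ray from `c`; by
`eq_of_ray` they coincide, and a point that is not a vertex lies on only one edge. -/
theorem IsStar.disjoint_sector (h : K.IsStar c r) {a b : Fin K.n} (hab : a ≠ b) :
    Disjoint (K.sector c a) (K.sector c b) := by
  rw [Set.disjoint_left]
  intro z ha hb
  obtain ⟨s, hs, t, ht, rfl⟩ := mem_sector.1 ha
  obtain ⟨s', hs', t', ht', e⟩ := mem_sector.1 hb
  have hh := h.eq_of_ray (K.edge_subset_frontier a (edge_point_mem hs))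
    (K.edge_subset_frontier b (edge_point_mem hs')) (k := t'⁻¹ * t)
    (mul_pos (inv_pos.2 ht'.1) ht.1) (by
      rw [mul_smul, add_left_cancel e, smul_smul, inv_mul_cancel₀ ht'.1.ne', one_smul])
  have h2 := edge_point_mem (K := K) (a := b) hs'
  rw [hh] at h2
  exact hab (K.edge_eq_of_mem (edge_point_mem hs) h2 (edge_point_ne hs))

/-- A point off the finitely many lines joining `c` to the vertices belongs to the sector of the
edge that its ray from `c` hits; those lines are null sets. -/
theorem IsStar.iUnion_sector_ae_eq (h : K.IsStar c r) :
    (⋃ a, K.sector c a) =ᵐ[volume] K.openRegion := by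
  rw [ae_eq_set]
  refine ⟨by rw [sdiff_eq_empty.2 (iUnion_subset h.sector_subset)]; exact measure_empty, ?_⟩
  refine measure_mono_null (t := ⋃ a, {z | cross (z - c) (K.poly a - c) = 0}) ?_
    (measure_iUnion_null fun a => volume_line c (h.vertex_ne a))
  rintro z ⟨hz, hz'⟩
  rw [mem_iUnion]
  by_cases hzc : z = c
  · exact ⟨⟨0, by have := K.three_le; omega⟩, by simp [hzc]⟩
  obtain ⟨k, hk, hf⟩ := exists_ray (K.openRegion_subset hz) hzc
  obtain ⟨a, ha⟩ := K.exists_edge_of_mem_frontier hf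
  obtain ⟨s, hs, e⟩ := K.mem_edge.1 ha
  have hk0 : 0 < k := by linarith
  have hz1 : z - c = k⁻¹ • (K.poly a + s • K.edgeVec a - c) := by
    rw [e, add_sub_cancel_left, smul_smul, inv_mul_cancel₀ hk0.ne', one_smul]
  rcases hs.1.eq_or_lt with h0 | h0
  · refine ⟨a, ?_⟩
    rw [mem_ofPred_eq, hz1, ← h0, zero_smul, add_zero, cross_smul_left, cross_self, mul_zero]
  rcases hs.2.eq_or_lt with h1 | h1
  · refine ⟨finRotate K.n a, ?_⟩
    rw [mem_ofPred_eq, hz1, h1, one_smul, edgeVec, add_sub_cancel, cross_smul_left, cross_self,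
      mul_zero]
  exfalso
  refine hz' (mem_iUnion.2 ⟨a, mem_sector.2 ⟨s, ⟨h0, h1⟩, k⁻¹, ⟨inv_pos.2 hk0, ?_⟩, ?_⟩⟩)
  · refine inv_lt_one_of_one_lt₀ (lt_of_le_of_ne hk ?_)
    rintro rfl
    rw [one_smul, add_sub_cancel] at hf
    exact not_mem_frontier_of_mem_openRegion hz hf
  · rw [← hz1]; abel

theorem IsStar.setIntegral_eq_sum (h : K.IsStar c r) {f : Plane → ℝ} (hf : Continuous f) :
    ∫ z in K.openRegion, f z = ∑ a, ∫ z in K.sector c a, f z := by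
  rw [← setIntegral_congr_set h.iUnion_sector_ae_eq]
  exact integral_iUnion_fintype (fun a => h.measurableSet_sector a)
    (fun a b hab => h.disjoint_sector hab)
    fun a => (K.integrableOn_of_continuous hf).mono_set (h.sector_subset a)

theorem IsStar.setIntegral_sector (h : K.IsStar c r) (a : Fin K.n) {f : Plane → ℝ}
    (hf : Continuous f) : ∫ z in K.sector c a, f z =
      |cross (K.poly a - c) (K.edgeVec a)| * ∫ s in (0 : ℝ)..1, ∫ t in (0 : ℝ)..1,
        t * f (c + t • (K.poly a - c + s • K.edgeVec a)) :=
  setIntegral_openTriangle (h.cross_ne_zero a) hf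

end PolygonalElement

/-! ### Smooth functions on a triangle. -/

section Smooth

variable {φ : Plane → ℝ}

theorem gradient_inner (φ : Plane → ℝ) (z e : Plane) : inner ℝ (∇ φ z) e = fderiv ℝ φ z e := by
  rw [gradient, InnerProductSpace.toDual_symm_apply]

theorem gradient_apply (φ : Plane → ℝ) (z : Plane) (k : Fin 2) :
    (∇ φ z) k = fderiv ℝ φ z (EuclideanSpace.single k 1) := by
  rw [← gradient_inner, EuclideanSpace.inner_single_right]
  simp

theorem norm_gradient (φ : Plane → ℝ) (z : Plane) : ‖∇ φ z‖ = ‖fderiv ℝ φ z‖ := by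
  rw [gradient, LinearIsometryEquiv.norm_map]

theorem continuous_gradient (hφ : ContDiff ℝ ∞ φ) : Continuous (∇ φ) :=
  (InnerProductSpace.toDual ℝ Plane).symm.continuous.comp (hφ.continuous_fderiv (by simp))

theorem continuous_fderiv_comp {X : Type*} [TopologicalSpace X] (hφ : ContDiff ℝ ∞ φ)
    {f g : X → Plane} (hf : Continuous f) (hg : Continuous g) :
    Continuous fun x => fderiv ℝ φ (f x) (g x) :=
  ((hφ.continuous_fderiv (by simp)).comp hf).clm_apply hg

theorem hasFDerivAt_of_smooth (hφ : ContDiff ℝ ∞ φ) (z : Plane) :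
    HasFDerivAt φ (fderiv ℝ φ z) z :=
  (hφ.differentiable (by simp) z).hasFDerivAt

theorem hasDerivAt_line (hφ : ContDiff ℝ ∞ φ) (z v : Plane) (t : ℝ) :
    HasDerivAt (fun t : ℝ => φ (z + t • v)) (fderiv ℝ φ (z + t • v) v) t := by
  have h1 : HasDerivAt (fun t : ℝ => z + t • v) v t := by
    simpa using ((hasDerivAt_id t).smul_const v).const_add z
  exact (hasFDerivAt_of_smooth hφ _).comp_hasDerivAt t h1

/-- Green's formula on one triangle. By `cross_smul_eq`, the direction `e` splits into a radial part
along `p + s • τ` and a part along `τ`. The first is integrated by parts in `t`, the second in `s`.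
The two remaining area integrals cancel, leaving the integral over the outer edge and one integral
along each of the two sides through `c`. -/
theorem integral_cone_deriv (hφ : ContDiff ℝ ∞ φ) (c p τ e : Plane) :
    cross p τ * ∫ s in (0 : ℝ)..1, ∫ t in (0 : ℝ)..1, t * fderiv ℝ φ (c + t • (p + s • τ)) e =
      cross e τ * (∫ s in (0 : ℝ)..1, φ (c + p + s • τ)) +
        ((∫ t in (0 : ℝ)..1, cross (p + τ) e * φ (c + t • (p + τ))) -
          ∫ t in (0 : ℝ)..1, cross p e * φ (c + t • p)) := by
  have hφc : Continuous φ := hφ.continuous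
  have hcF : Continuous fun w : ℝ × ℝ => φ (c + w.2 • (p + w.1 • τ)) := by fun_prop
  -- the derivative in the `t` direction
  have h1 : ∀ s : ℝ, ∫ t in (0 : ℝ)..1, t * fderiv ℝ φ (c + t • (p + s • τ)) (p + s • τ) =
      φ (c + p + s • τ) - ∫ t in (0 : ℝ)..1, φ (c + t • (p + s • τ)) := by
    intro s
    have hd : ∀ t ∈ uIcc (0 : ℝ) 1, HasDerivAt (fun t : ℝ => t * φ (c + t • (p + s • τ)))
        (φ (c + t • (p + s • τ)) + t * fderiv ℝ φ (c + t • (p + s • τ)) (p + s • τ)) t := by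
      intro t _
      exact ((hasDerivAt_id' t).fun_mul (hasDerivAt_line hφ c (p + s • τ) t)).congr_deriv (by ring)
    have hc1 : Continuous fun t : ℝ => φ (c + t • (p + s • τ)) := by fun_prop
    have hc2 : Continuous fun t : ℝ => t * fderiv ℝ φ (c + t • (p + s • τ)) (p + s • τ) :=
      continuous_id.mul (continuous_fderiv_comp hφ (by fun_prop) (by fun_prop))
    have := intervalIntegral.integral_eq_sub_of_hasDerivAt hd
      ((hc1.add hc2).intervalIntegrable _ _)
    rw [intervalIntegral.integral_add (hc1.intervalIntegrable _ _)
      (hc2.intervalIntegrable _ _)] at this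
    simp only [one_smul, one_mul, zero_mul, sub_zero, ← add_assoc] at this
    linarith
  -- the derivative in the `s` direction
  have h2 : ∀ t : ℝ, ∫ s in (0 : ℝ)..1,
      cross (p + s • τ) e * (t * fderiv ℝ φ (c + t • (p + s • τ)) τ) =
      cross (p + τ) e * φ (c + t • (p + τ)) - cross p e * φ (c + t • p) -
        cross τ e * ∫ s in (0 : ℝ)..1, φ (c + t • (p + s • τ)) := by
    intro t
    have hd : ∀ s ∈ uIcc (0 : ℝ) 1, HasDerivAt
        (fun s : ℝ => (cross p e + s * cross τ e) * φ (c + t • (p + s • τ)))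
        (cross τ e * φ (c + t • (p + s • τ)) +
          cross (p + s • τ) e * (t * fderiv ℝ φ (c + t • (p + s • τ)) τ)) s := by
      intro s _
      have ha : HasDerivAt (fun s : ℝ => cross p e + s * cross τ e) (cross τ e) s := by
        simpa using ((hasDerivAt_id s).mul_const (cross τ e)).const_add (cross p e)
      have hb : HasDerivAt (fun s : ℝ => φ (c + t • (p + s • τ)))
          (t * fderiv ℝ φ (c + t • (p + s • τ)) τ) s := by
        have := hasDerivAt_line hφ (c + t • p) (t • τ) s
        have hx : ∀ s : ℝ, c + t • p + s • t • τ = c + t • (p + s • τ) := fun s => by module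
        simpa only [map_smul, smul_eq_mul, hx] using this
      refine (ha.fun_mul hb).congr_deriv ?_
      rw [cross_add_left, cross_smul_left]
    have hc1 : Continuous fun s : ℝ => cross τ e * φ (c + t • (p + s • τ)) := by fun_prop
    have hc0 : Continuous fun s : ℝ => cross (p + s • τ) e := by
      simp only [cross_add_left, cross_smul_left]; fun_prop
    have hc2 : Continuous fun s : ℝ =>
        cross (p + s • τ) e * (t * fderiv ℝ φ (c + t • (p + s • τ)) τ) :=
      hc0.mul (continuous_const.mul (continuous_fderiv_comp hφ (by fun_prop) (by fun_prop)))
    have := intervalIntegral.integral_eq_sub_of_hasDerivAt hd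
      ((hc1.add hc2).intervalIntegrable _ _)
    rw [intervalIntegral.integral_add (hc1.intervalIntegrable _ _)
      (hc2.intervalIntegrable _ _), intervalIntegral.integral_const_mul] at this
    simp only [one_smul, one_mul, zero_mul, zero_smul, add_zero, ← cross_add_left] at this
    linarith
  have hsplit : ∀ s t : ℝ, cross p τ * (t * fderiv ℝ φ (c + t • (p + s • τ)) e) =
      cross e τ * (t * fderiv ℝ φ (c + t • (p + s • τ)) (p + s • τ)) +
        cross (p + s • τ) e * (t * fderiv ℝ φ (c + t • (p + s • τ)) τ) := by
    intro s t
    have := congrArg (fderiv ℝ φ (c + t • (p + s • τ))) (cross_smul_eq (p + s • τ) τ e)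
    rw [cross_add_left, cross_smul_left, cross_self, mul_zero, add_zero, map_add, map_smul,
      map_smul, map_smul, smul_eq_mul, smul_eq_mul, smul_eq_mul] at this
    linear_combination t * this
  have hcA : Continuous fun w : ℝ × ℝ =>
      w.2 * fderiv ℝ φ (c + w.2 • (p + w.1 • τ)) (p + w.1 • τ) :=
    continuous_snd.mul (continuous_fderiv_comp hφ (by fun_prop) (by fun_prop))
  have hc0 : Continuous fun w : ℝ × ℝ => cross (p + w.1 • τ) e := by
    simp only [cross_add_left, cross_smul_left]; fun_prop
  have hcB : Continuous fun w : ℝ × ℝ =>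
      cross (p + w.1 • τ) e * (w.2 * fderiv ℝ φ (c + w.2 • (p + w.1 • τ)) τ) :=
    hc0.mul (continuous_snd.mul (continuous_fderiv_comp hφ (by fun_prop) (by fun_prop)))
  have sec : ∀ {g : ℝ × ℝ → ℝ}, Continuous g → ∀ s, IntervalIntegrable (fun t => g (s, t)) volume 0 1 :=
    fun hg s => (hg.comp (by fun_prop : Continuous fun t : ℝ => (s, t))).intervalIntegrable _ _
  have par : ∀ {g : ℝ × ℝ → ℝ}, Continuous g → Continuous fun s => ∫ t in (0 : ℝ)..1, g (s, t) :=
    fun {g} hg => intervalIntegral.continuous_parametric_intervalIntegral_of_continuous'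
      (f := fun s t => g (s, t)) hg 0 1
  have swap : ∀ {g : ℝ × ℝ → ℝ}, Continuous g → ∫ s in (0 : ℝ)..1, ∫ t in (0 : ℝ)..1, g (s, t) =
      ∫ t in (0 : ℝ)..1, ∫ s in (0 : ℝ)..1, g (s, t) := by
    intro g hg
    simp_rw [intervalIntegral.integral_of_le zero_le_one]
    refine integral_integral_swap (f := fun s t => g (s, t)) ?_
    rw [Measure.prod_restrict, ← Measure.volume_eq_prod]
    exact (hg.continuousOn.integrableOn_compact (isCompact_Icc.prod isCompact_Icc)).mono_set
      (prod_mono Ioc_subset_Icc_self Ioc_subset_Icc_self)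
  rw [← intervalIntegral.integral_const_mul]
  simp_rw [← intervalIntegral.integral_const_mul, hsplit]
  have e1 : ∀ s : ℝ, ∫ t in (0 : ℝ)..1,
      (cross e τ * (t * fderiv ℝ φ (c + t • (p + s • τ)) (p + s • τ)) +
        cross (p + s • τ) e * (t * fderiv ℝ φ (c + t • (p + s • τ)) τ)) =
      cross e τ * (φ (c + p + s • τ) - ∫ t in (0 : ℝ)..1, φ (c + t • (p + s • τ))) +
      ∫ t in (0 : ℝ)..1, cross (p + s • τ) e * (t * fderiv ℝ φ (c + t • (p + s • τ)) τ) := by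
    intro s
    rw [intervalIntegral.integral_add ((sec hcA s).const_mul _) (sec hcB s),
      intervalIntegral.integral_const_mul, h1]
  simp_rw [e1]
  have hct : Continuous fun s : ℝ => φ (c + p + s • τ) := by fun_prop
  rw [intervalIntegral.integral_add, intervalIntegral.integral_const_mul,
    intervalIntegral.integral_sub (hct.intervalIntegrable _ _) ((par hcF).intervalIntegrable _ _),
    swap hcB]
  · simp_rw [h2]
    have hcl1 : Continuous fun t : ℝ => cross (p + τ) e * φ (c + t • (p + τ)) := by fun_prop
    have hcl2 : Continuous fun t : ℝ => cross p e * φ (c + t • p) := by fun_prop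
    have hcl3 : Continuous fun t : ℝ => ∫ s in (0 : ℝ)..1, φ (c + t • (p + s • τ)) :=
      par (g := fun w => φ (c + w.1 • (p + w.2 • τ))) (by fun_prop)
    have hcl12 : Continuous fun t : ℝ =>
        cross (p + τ) e * φ (c + t • (p + τ)) - cross p e * φ (c + t • p) := hcl1.sub hcl2
    have hcl4 : Continuous fun t : ℝ =>
        cross τ e * ∫ s in (0 : ℝ)..1, φ (c + t • (p + s • τ)) := continuous_const.mul hcl3
    rw [intervalIntegral.integral_sub (hcl12.intervalIntegrable _ _)
      (hcl4.intervalIntegrable _ _),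
      intervalIntegral.integral_sub (hcl1.intervalIntegrable _ _) (hcl2.intervalIntegrable _ _),
      intervalIntegral.integral_const_mul (cross τ e), ← swap hcF, cross_comm τ e,
      intervalIntegral.integral_const_mul (cross e τ)]
    ring
  · exact ((hct.sub (par hcF)).const_smul (cross e τ)).intervalIntegrable _ _
  · exact (par hcB).intervalIntegrable _ _

/-- The fundamental theorem of calculus for `t ^ 2 * φ ^ 2` on each ray: it vanishes at `c` and
equals `φ ^ 2` on the edge. The square of `t` leaves in the derivative the factor `t` that matches
the area element of the cone coordinates. -/
theorem integral_cone_sq (hφ : ContDiff ℝ ∞ φ) (c p τ : Plane) :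
    ∫ s in (0 : ℝ)..1, φ (c + p + s • τ) ^ 2 =
      ∫ s in (0 : ℝ)..1, ∫ t in (0 : ℝ)..1, t * (2 * φ (c + t • (p + s • τ)) ^ 2 +
        2 * φ (c + t • (p + s • τ)) *
          fderiv ℝ φ (c + t • (p + s • τ)) (c + t • (p + s • τ) - c)) := by
  have hφc : Continuous φ := hφ.continuous
  refine intervalIntegral.integral_congr fun s _ => ?_
  have hd : ∀ t ∈ uIcc (0 : ℝ) 1, HasDerivAt (fun t : ℝ => t ^ 2 * φ (c + t • (p + s • τ)) ^ 2)
      (t * (2 * φ (c + t • (p + s • τ)) ^ 2 + 2 * φ (c + t • (p + s • τ)) *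
          fderiv ℝ φ (c + t • (p + s • τ)) (c + t • (p + s • τ) - c))) t := by
    intro t _
    have h1 : HasDerivAt (fun t : ℝ => t ^ 2) (2 * t) t := by simpa using hasDerivAt_pow 2 t
    have h2 := (hasDerivAt_line hφ c (p + s • τ) t).pow 2
    refine (h1.mul h2).congr_deriv ?_
    rw [add_sub_cancel_left, map_smul, smul_eq_mul]
    simp
    ring
  have hc : Continuous fun t : ℝ => t * (2 * φ (c + t • (p + s • τ)) ^ 2 +
      2 * φ (c + t • (p + s • τ)) *
        fderiv ℝ φ (c + t • (p + s • τ)) (c + t • (p + s • τ) - c)) := by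
    refine continuous_id.mul (Continuous.add (by fun_prop) (Continuous.mul (by fun_prop) ?_))
    exact continuous_fderiv_comp hφ (by fun_prop) (by fun_prop)
  beta_reduce
  rw [intervalIntegral.integral_eq_sub_of_hasDerivAt hd (hc.intervalIntegrable _ _)]
  simp [add_assoc]

end Smooth

/-! ### Green's formula and the trace inequality on an element. -/

namespace PolygonalElement

variable {K : PolygonalElement} {c : Plane} {r : ℝ}

theorem measurable_edgePath (K : PolygonalElement) (a : Fin K.n) :
    Measurable (K.poly.edgePath ℝ a) := by
  have : (K.poly.edgePath ℝ a : ℝ → Plane) = fun s => K.poly a + s • K.edgeVec a :=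
    funext fun s => K.edgePath_apply a s
  rw [this]; fun_prop

theorem integral_edgeMeasure (a : Fin K.n) {f : Plane → ℝ} (hf : Continuous f) :
    ∫ z, f z ∂(K.edgeMeasure a) =
      K.edgeLength a * ∫ s in (0 : ℝ)..1, f (K.poly a + s • K.edgeVec a) := by
  rw [edgeMeasure, integral_smul_measure, ENNReal.toReal_ofReal (K.edgeLength_pos a).le,
    integral_map (K.measurable_edgePath a).aemeasurable hf.aestronglyMeasurable,
    intervalIntegral.integral_of_le zero_le_one, integral_Icc_eq_integral_Ioc]
  simp only [edgePath_apply, smul_eq_mul]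

/-- The coefficients of Green's formula: the outward unit normal on the `a`-th edge, with respect to
the orientation given by the center `c` of a star-shaped element. -/
def normal (K : PolygonalElement) (c : Plane) (a : Fin K.n) (e : Plane) : ℝ :=
  SignType.sign (cross (K.poly a - c) (K.edgeVec a)) * cross e (K.edgeVec a) / K.edgeLength a

/-- Green's formula on a star-shaped element. -/
theorem IsStar.green (h : K.IsStar c r) {φ : Plane → ℝ} (hφ : ContDiff ℝ ∞ φ) (e : Plane) :
    ∫ z in K.openRegion, fderiv ℝ φ z e = ∑ a, K.normal c a e * ∫ z, φ z ∂(K.edgeMeasure a) := by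
  obtain ⟨σ, hσ, hpos⟩ := h.exists_sign
  have hcf : Continuous fun z => fderiv ℝ φ z e :=
    continuous_fderiv_comp hφ continuous_id continuous_const
  -- Contributions of the segments from `c` to the vertices. Each is met by two consecutive sectors
  -- with opposite signs, so they telescope in the cyclic sum.
  set B : Fin K.n → ℝ := fun a =>
    ∫ t in (0 : ℝ)..1, cross (K.poly a - c) e * φ (c + t • (K.poly a - c)) with hB
  have key : ∀ a, ∫ z in K.sector c a, fderiv ℝ φ z e =
      K.normal c a e * ∫ z, φ z ∂(K.edgeMeasure a) + (σ * B (finRotate K.n a) - σ * B a) := by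
    intro a
    have habs : |cross (K.poly a - c) (K.edgeVec a)| = σ * cross (K.poly a - c) (K.edgeVec a) := by
      rw [← abs_of_pos (hpos a), abs_mul]
      rcases hσ with rfl | rfl <;> simp
    have hsg : (SignType.sign (cross (K.poly a - c) (K.edgeVec a)) : ℝ) = σ := by
      have := hpos a
      rcases hσ with rfl | rfl
      · rw [sign_pos (by linarith)]; simp
      · rw [sign_neg (by linarith)]; simp
    rw [h.setIntegral_sector a hcf, habs, mul_assoc,
      integral_cone_deriv hφ c (K.poly a - c) (K.edgeVec a) e, normal, hsg,
      integral_edgeMeasure a hφ.continuous, add_sub_cancel]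
    have e1 : K.poly a - c + K.edgeVec a = K.poly (finRotate K.n a) - c := by rw [edgeVec]; abel
    have := (K.edgeLength_pos a).ne'
    rw [e1]
    simp only [hB]
    field_simp
  rw [h.setIntegral_eq_sum hcf, Finset.sum_congr rfl fun a _ => key a, Finset.sum_add_distrib,
    Finset.sum_sub_distrib, Equiv.sum_comp (finRotate K.n) fun a => σ * B a, sub_self, add_zero]

instance isFiniteMeasure_edgeMeasure (a : Fin K.n) : IsFiniteMeasure (K.edgeMeasure a) := by
  rw [edgeMeasure]
  have : IsFiniteMeasure ((volume.restrict (Icc (0 : ℝ) 1)).map (K.poly.edgePath ℝ a)) :=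
    Measure.isFiniteMeasure_map _ _
  exact Measure.smul_finite _ ENNReal.ofReal_ne_top

instance isFiniteMeasure_boundaryMeasure : IsFiniteMeasure K.boundaryMeasure := by
  rw [boundaryMeasure]; infer_instance

theorem integrable_edgeMeasure (a : Fin K.n) {f : Plane → ℝ} (hf : Continuous f) :
    Integrable f (K.edgeMeasure a) := by
  rw [edgeMeasure]
  refine Integrable.smul_measure ?_ ENNReal.ofReal_ne_top
  rw [integrable_map_measure hf.aestronglyMeasurable (K.measurable_edgePath a).aemeasurable]
  have : f ∘ (K.poly.edgePath ℝ a) = fun s => f (K.poly a + s • K.edgeVec a) :=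
    funext fun s => by simp only [Function.comp, K.edgePath_apply a s]
  rw [this]
  exact (by fun_prop : Continuous fun s : ℝ => f (K.poly a + s • K.edgeVec a)).continuousOn.integrableOn_compact isCompact_Icc

/-- The trace inequality. `integral_cone_sq` expresses the edge integral through an area integral,
whose integrand is at most `3 φ² + R² ‖∇ φ‖²` by Young's inequality, because `‖z - c‖ ≤ R` on the
element. -/
theorem IsStar.edge_sq_le (h : K.IsStar c r) : ∃ C : ℝ, 0 ≤ C ∧ ∀ φ : Plane → ℝ, ContDiff ℝ ∞ φ →
    ∀ a, ∫ z, φ z ^ 2 ∂(K.edgeMeasure a) ≤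
      C * ((∫ z in K.openRegion, φ z ^ 2) + ∫ z in K.openRegion, ‖∇ φ z‖ ^ 2) := by
  obtain ⟨R, hR0, hR⟩ := K.isCompact.isBounded.subset_closedBall_lt 0 c
  have main : ∀ a, ∃ C : ℝ, 0 ≤ C ∧ ∀ φ : Plane → ℝ, ContDiff ℝ ∞ φ →
      ∫ z, φ z ^ 2 ∂(K.edgeMeasure a) ≤
      C * ((∫ z in K.openRegion, φ z ^ 2) + ∫ z in K.openRegion, ‖∇ φ z‖ ^ 2) := by
    intro a
    set D := |cross (K.poly a - c) (K.edgeVec a)| with hD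
    have hD0 : 0 < D := abs_pos.2 (h.cross_ne_zero a)
    have hl := K.edgeLength_pos a
    refine ⟨K.edgeLength a / D * (3 + R ^ 2), by positivity, fun φ hφ => ?_⟩
    have hg := continuous_gradient hφ
    have hφc := hφ.continuous
    have hcf : Continuous fun z => 2 * φ z ^ 2 + 2 * φ z * fderiv ℝ φ z (z - c) := by
      refine Continuous.add (by fun_prop) (Continuous.mul (by fun_prop) ?_)
      exact continuous_fderiv_comp hφ (by fun_prop) (by fun_prop)
    have h1 := h.setIntegral_sector a hcf
    rw [← integral_cone_sq hφ, add_sub_cancel, ← hD] at h1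
    have i1 := K.integrableOn_of_continuous (f := fun z => φ z ^ 2) (by fun_prop)
    have i2 := K.integrableOn_of_continuous (f := fun z => ‖∇ φ z‖ ^ 2) (by fun_prop)
    have h2 : ∫ z in K.sector c a, (2 * φ z ^ 2 + 2 * φ z * fderiv ℝ φ z (z - c)) ≤
        ∫ z in K.openRegion, (3 * φ z ^ 2 + R ^ 2 * ‖∇ φ z‖ ^ 2) := by
      have hi : IntegrableOn (fun z => 3 * φ z ^ 2 + R ^ 2 * ‖∇ φ z‖ ^ 2) K.openRegion :=
        (i1.const_mul 3).add (i2.const_mul (R ^ 2))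
      refine (setIntegral_mono_on
        ((K.integrableOn_of_continuous hcf).mono_set (h.sector_subset a))
        (hi.mono_set (h.sector_subset a)) (h.measurableSet_sector a) fun z hz => ?_).trans
        (setIntegral_mono_set hi (ae_of_all _ fun z => by simp only [Pi.zero_apply]; positivity)
          (h.sector_subset a).eventuallyLE)
      have hzR : ‖z - c‖ ≤ R := by
        have := hR (K.openRegion_subset (h.sector_subset a hz))
        rwa [Metric.mem_closedBall, dist_eq_norm] at this
      have h3 : |fderiv ℝ φ z (z - c)| ≤ ‖∇ φ z‖ * R := by
        rw [norm_gradient]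
        exact ((fderiv ℝ φ z).le_opNorm _).trans
          (mul_le_mul_of_nonneg_left hzR (norm_nonneg _))
      have h4 : fderiv ℝ φ z (z - c) ^ 2 ≤ (‖∇ φ z‖ * R) ^ 2 := sq_le_sq' (abs_le.1 h3).1 (abs_le.1 h3).2
      nlinarith [sq_nonneg (φ z - fderiv ℝ φ z (z - c))]
    rw [integral_add (i1.const_mul 3) (i2.const_mul _), integral_const_mul, integral_const_mul,
      h1] at h2
    have p1 : 0 ≤ ∫ z in K.openRegion, φ z ^ 2 := integral_nonneg fun z => by positivity
    have p2 : 0 ≤ ∫ z in K.openRegion, ‖∇ φ z‖ ^ 2 := integral_nonneg fun z => by positivity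
    rw [integral_edgeMeasure a (by fun_prop : Continuous fun z => φ z ^ 2)]
    rw [div_mul_eq_mul_div, div_mul_eq_mul_div, le_div_iff₀ hD0, mul_assoc, mul_assoc]
    refine mul_le_mul_of_nonneg_left ?_ hl.le
    rw [mul_comm]
    refine h2.trans ?_
    nlinarith [mul_nonneg (sq_nonneg R) p1]
  choose C hC0 hC using main
  refine ⟨∑ a, C a, Finset.sum_nonneg fun a _ => hC0 a, fun φ hφ a => (hC a φ hφ).trans ?_⟩
  refine mul_le_mul_of_nonneg_right (Finset.single_le_sum (fun a _ => hC0 a) (Finset.mem_univ a)) ?_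
  exact add_nonneg (integral_nonneg fun z => by positivity) (integral_nonneg fun z => by positivity)

end PolygonalElement

/-! ### Poincaré's inequality. -/

theorem lintegral_comp_smul_add_le {F : Plane → ℝ≥0∞} (hF : Measurable F) {s : ℝ}
    (hs : 1 / 2 ≤ s) (v : Plane) : ∫⁻ x, F (s • x + v) ≤ 4 * ∫⁻ x, F x := by
  have hs0 : s ≠ 0 := by linarith
  have h1 : ∫⁻ x, F (s • x + v) = ENNReal.ofReal |(s ^ 2)⁻¹| * ∫⁻ x, F x := by
    have := Measure.map_addHaar_smul (volume : Measure Plane) hs0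
    rw [finrank_euclideanSpace_fin] at this
    rw [← lintegral_add_right_eq_self F v, ← smul_eq_mul, ← lintegral_smul_measure, ← this,
      lintegral_map (by fun_prop) (by fun_prop)]
  rw [h1]
  gcongr
  rw [abs_of_nonneg (by positivity)]
  refine ENNReal.ofReal_le_of_le_toReal ?_
  rw [inv_le_comm₀ (by positivity) (by norm_num)]
  norm_num
  nlinarith

/-- The variance of `g` on the unit interval is nonnegative. -/
theorem sq_integral_le {g : ℝ → ℝ} (hg : Continuous g) :
    (∫ t in (0 : ℝ)..1, g t) ^ 2 ≤ ∫ t in (0 : ℝ)..1, g t ^ 2 := by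
  set m := ∫ t in (0 : ℝ)..1, g t with hm
  have h0 : 0 ≤ ∫ t in (0 : ℝ)..1, (g t - m) ^ 2 :=
    intervalIntegral.integral_nonneg zero_le_one fun t _ => sq_nonneg _
  have h1 : ∫ t in (0 : ℝ)..1, (g t - m) ^ 2 =
      (∫ t in (0 : ℝ)..1, g t ^ 2) - (∫ t in (0 : ℝ)..1, 2 * m * g t) +
        ∫ t in (0 : ℝ)..1, m ^ 2 := by
    rw [← intervalIntegral.integral_sub (Continuous.intervalIntegrable (by fun_prop) _ _)
      (Continuous.intervalIntegrable (by fun_prop) _ _),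
      ← intervalIntegral.integral_add (Continuous.intervalIntegrable (by fun_prop) _ _)
      (Continuous.intervalIntegrable (by fun_prop) _ _)]
    refine intervalIntegral.integral_congr fun t _ => ?_
    ring
  rw [intervalIntegral.integral_const_mul, ← hm] at h1
  simp at h1
  nlinarith

theorem sq_sub_le {φ : Plane → ℝ} (hφ : ContDiff ℝ ∞ φ) (x y : Plane) :
    (φ y - φ x) ^ 2 ≤ ‖y - x‖ ^ 2 * ∫ t in (0 : ℝ)..1, ‖∇ φ (x + t • (y - x))‖ ^ 2 := by
  have hc : Continuous fun t : ℝ => fderiv ℝ φ (x + t • (y - x)) (y - x) :=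
    continuous_fderiv_comp hφ (by fun_prop) (by fun_prop)
  have hg := continuous_gradient hφ
  have h1 := intervalIntegral.integral_eq_sub_of_hasDerivAt
    (fun t _ => hasDerivAt_line hφ x (y - x) t) (hc.intervalIntegrable 0 1)
  simp only [one_smul, zero_smul, add_zero, add_sub_cancel] at h1
  rw [← h1, ← intervalIntegral.integral_const_mul]
  refine (sq_integral_le hc).trans ?_
  refine intervalIntegral.integral_mono_on zero_le_one
    (Continuous.intervalIntegrable (by fun_prop) _ _)
    (Continuous.intervalIntegrable (by fun_prop) _ _) fun t _ => ?_
  rw [← mul_pow, norm_gradient, mul_comm]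
  exact sq_le_sq' (abs_le.1 ((fderiv ℝ φ _).le_opNorm _)).1 (abs_le.1 ((fderiv ℝ φ _).le_opNorm _)).2

namespace PolygonalElement

variable {K : PolygonalElement} {c : Plane} {r : ℝ}

/-- For fixed `t`, the substitution is made in whichever variable has weight at least `1 / 2`: in
`x`, with weight `1 - t`, if `t ≤ 1 / 2`, and in `y`, with weight `t`, otherwise. It costs a factor
of at most `4`, and the other variable contributes the measure of its domain. -/
theorem lintegral_segment_le (K : PolygonalElement) (c : Plane) (r : ℝ) {F : Plane → ℝ≥0∞} (hF : Measurable F) :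
    ∫⁻ y in Metric.ball c r, ∫⁻ x in K.carrier, ∫⁻ t in Icc (0 : ℝ) 1, F (x + t • (y - x)) ≤
      4 * (volume (Metric.ball c r) + volume K.carrier) * ∫⁻ x, F x := by
  have hsw : ∀ y, ∫⁻ x in K.carrier, ∫⁻ t in Icc (0 : ℝ) 1, F (x + t • (y - x)) =
      ∫⁻ t in Icc (0 : ℝ) 1, ∫⁻ x in K.carrier, F (x + t • (y - x)) := by
    intro y
    exact lintegral_lintegral_swap (hF.comp
      (by fun_prop : Measurable fun w : Plane × ℝ => w.1 + w.2 • (y - w.1))).aemeasurable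
  simp_rw [hsw]
  rw [lintegral_lintegral_swap]
  · have hb : ∀ t ∈ Icc (0 : ℝ) 1,
        ∫⁻ y in Metric.ball c r, ∫⁻ x in K.carrier, F (x + t • (y - x)) ≤
        4 * (volume (Metric.ball c r) + volume K.carrier) * ∫⁻ x, F x := by
      intro t ht
      rcases le_total t (1 / 2) with h1 | h1
      · have : ∀ y, ∫⁻ x in K.carrier, F (x + t • (y - x)) ≤ 4 * ∫⁻ x, F x := by
          intro y
          refine (lintegral_mono' Measure.restrict_le_self le_rfl).trans ?_
          have hx : ∀ x, (1 - t) • x + t • y = x + t • (y - x) := fun x => by module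
          simpa only [hx] using lintegral_comp_smul_add_le hF (s := 1 - t) (by linarith) (t • y)
        refine (lintegral_mono this).trans ?_
        rw [setLIntegral_const, mul_right_comm]
        gcongr
        exact le_self_add
      · rw [lintegral_lintegral_swap]
        · have : ∀ x, ∫⁻ y in Metric.ball c r, F (x + t • (y - x)) ≤ 4 * ∫⁻ x, F x := by
            intro x
            refine (lintegral_mono' Measure.restrict_le_self le_rfl).trans ?_
            have hy : ∀ y, t • y + (1 - t) • x = x + t • (y - x) := fun y => by module
            simpa only [hy] using lintegral_comp_smul_add_le hF (s := t) h1 ((1 - t) • x)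
          refine (lintegral_mono this).trans ?_
          rw [setLIntegral_const, mul_right_comm]
          gcongr
          exact le_add_self
        · exact (hF.comp
            (by fun_prop : Measurable fun w : Plane × Plane => w.2 + t • (w.1 - w.2))).aemeasurable
    refine (setLIntegral_mono measurable_const hb).trans ?_
    rw [setLIntegral_const]
    simp
  · refine Measurable.aemeasurable ?_
    exact Measurable.lintegral_prod_right' (f := fun w : (Plane × ℝ) × Plane =>
      F (w.2 + w.1.2 • (w.1.1 - w.2))) (hF.comp (by fun_prop))

/-- The Poincaré inequality on a star-shaped element. -/
theorem IsStar.poincare (h : K.IsStar c r) : ∃ C : ℝ, 0 ≤ C ∧ ∀ φ : Plane → ℝ, ContDiff ℝ ∞ φ →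
    ∃ m : ℝ, ∫ z in K.openRegion, (φ z - m) ^ 2 ≤ C * ∫ z in K.openRegion, ‖∇ φ z‖ ^ 2 := by
  set d := Metric.diam K.carrier with hd
  set β := volume (Metric.ball c r) with hβ
  have hβ0 : β ≠ 0 := (Metric.measure_ball_pos volume c h.1).ne'
  have hβt : β ≠ ⊤ := measure_ball_lt_top.ne
  have hUt : volume K.carrier ≠ ⊤ := K.isCompact.measure_lt_top.ne
  set C : ℝ≥0∞ := β⁻¹ * (ENNReal.ofReal (d ^ 2) * (4 * (β + volume K.carrier))) with hC
  have hCt : C ≠ ⊤ := by finiteness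
  refine ⟨C.toReal, ENNReal.toReal_nonneg, fun φ hφ => ?_⟩
  have hg := continuous_gradient hφ
  have hφc := hφ.continuous
  -- Extension by zero permits integration over the whole plane. Segments joining the ball to the
  -- element stay in the element, so nothing is lost on them.
  set F : Plane → ℝ≥0∞ := K.carrier.indicator fun z => ENNReal.ofReal (‖∇ φ z‖ ^ 2) with hFd
  have hF : Measurable F := by
    refine Measurable.indicator ?_ K.isCompact.measurableSet
    exact (by fun_prop : Continuous fun z => ‖∇ φ z‖ ^ 2).measurable.ennreal_ofReal
  have hball : ∀ y ∈ Metric.ball c r, y ∈ K.carrier := by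
    intro y hy
    have := h.2 y hy (K.openRegion_subset h.center_mem) zero_le_one le_rfl (by norm_num)
    simpa using this
  have hpt : ∀ y ∈ Metric.ball c r, ∀ x ∈ K.carrier, ENNReal.ofReal ((φ x - φ y) ^ 2) ≤
      ENNReal.ofReal (d ^ 2) * ∫⁻ t in Icc (0 : ℝ) 1, F (x + t • (y - x)) := by
    intro y hy x hx
    have h1 := sq_sub_le hφ x y
    have hle : ‖y - x‖ ≤ d := by
      rw [← dist_eq_norm]
      exact Metric.dist_le_diam_of_mem K.isCompact.isBounded (hball y hy) hx
    have hc : Continuous fun t : ℝ => ‖∇ φ (x + t • (y - x))‖ ^ 2 := by fun_prop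
    have h2 : ∫⁻ t in Icc (0 : ℝ) 1, F (x + t • (y - x)) =
        ENNReal.ofReal (∫ t in (0 : ℝ)..1, ‖∇ φ (x + t • (y - x))‖ ^ 2) := by
      rw [intervalIntegral.integral_of_le zero_le_one, ← integral_Icc_eq_integral_Ioc,
        ofReal_integral_eq_lintegral_ofReal (hc.continuousOn.integrableOn_compact isCompact_Icc)
          (ae_of_all _ fun t => by positivity)]
      refine setLIntegral_congr_fun measurableSet_Icc fun t ht => ?_
      have : x + t • (y - x) ∈ K.carrier := by
        have := h.2 y hy hx ht.1 (sub_nonneg.2 ht.2) (by ring)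
        convert this using 1; module
      rw [hFd, indicator_of_mem this]
    rw [h2, ← ENNReal.ofReal_mul (by positivity)]
    refine ENNReal.ofReal_le_ofReal ?_
    rw [← neg_sub, neg_sq]
    refine h1.trans ?_
    gcongr
    exact intervalIntegral.integral_nonneg zero_le_one fun t _ => by positivity
  have htot : ∫⁻ y in Metric.ball c r, ∫⁻ x in K.carrier, ENNReal.ofReal ((φ x - φ y) ^ 2) ≤
      ENNReal.ofReal (d ^ 2) * (4 * (β + volume K.carrier) * ∫⁻ x, F x) := by
    refine le_trans ?_ (mul_le_mul_right (K.lintegral_segment_le c r hF) _)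
    rw [← lintegral_const_mul' _ _ ENNReal.ofReal_ne_top]
    refine setLIntegral_mono' measurableSet_ball fun y hy => ?_
    rw [← lintegral_const_mul' _ _ ENNReal.ofReal_ne_top]
    exact setLIntegral_mono' K.isCompact.measurableSet fun x hx => hpt y hy x hx
  -- The constant to subtract is `φ y`, at a point `y` of the ball where the squared distance of `φ`
  -- from `φ y` is at most its average over the ball.
  obtain ⟨y, hy, hle⟩ := exists_le_setLAverage (μ := volume) (s := Metric.ball c r)
    (f := fun y => ∫⁻ x in K.carrier, ENNReal.ofReal ((φ x - φ y) ^ 2)) hβ0 hβt (by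
      refine Measurable.aemeasurable ?_
      exact Measurable.lintegral_prod_right' (f := fun w : Plane × Plane =>
        ENNReal.ofReal ((φ w.2 - φ w.1) ^ 2))
        (by fun_prop : Continuous fun w : Plane × Plane => (φ w.2 - φ w.1) ^ 2).measurable.ennreal_ofReal)
  refine ⟨φ y, ?_⟩
  rw [setLAverage_eq, ENNReal.div_eq_inv_mul] at hle
  have hfin : ∫⁻ x in K.carrier, ENNReal.ofReal ((φ x - φ y) ^ 2) ≤ C * ∫⁻ x, F x := by
    refine hle.trans ?_
    rw [hC, mul_assoc]
    refine mul_le_mul_right (htot.trans_eq ?_) _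
    ring
  have hFi : ∫⁻ x, F x = ENNReal.ofReal (∫ z in K.openRegion, ‖∇ φ z‖ ^ 2) := by
    rw [hFd, lintegral_indicator K.isCompact.measurableSet, setIntegral_congr_set K.openRegion_ae_eq,
      ofReal_integral_eq_lintegral_ofReal ((by fun_prop :
        Continuous fun z => ‖∇ φ z‖ ^ 2).continuousOn.integrableOn_compact K.isCompact)
        (ae_of_all _ fun t => by positivity)]
  rw [hFi, ← ofReal_integral_eq_lintegral_ofReal ((by fun_prop :
        Continuous fun x => (φ x - φ y) ^ 2).continuousOn.integrableOn_compact K.isCompact)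
        (ae_of_all _ fun t => by positivity), ← setIntegral_congr_set K.openRegion_ae_eq,
    ← ENNReal.ofReal_toReal hCt, ← ENNReal.ofReal_mul ENNReal.toReal_nonneg] at hfin
  exact (ENNReal.ofReal_le_ofReal_iff (mul_nonneg ENNReal.toReal_nonneg
    (integral_nonneg fun z => by positivity))).1 hfin

end PolygonalElement

/-! ### A variational problem on a closed subspace -/

/-- Lax–Milgram for the form `⟪T u, T w⟫` restricted to `V`; `hT` is coercivity, and `max C 1` only
ensures that the coercivity constant is positive. -/
theorem exists_variational_solution {X E : Type*} [NormedAddCommGroup X] [InnerProductSpace ℝ X]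
    [CompleteSpace X] [NormedAddCommGroup E] [InnerProductSpace ℝ E] (V : Submodule ℝ X)
    (hV : IsClosed (V : Set X)) (T : X →L[ℝ] E) {C : ℝ}
    (hT : ∀ u ∈ V, ‖u‖ ^ 2 ≤ C * ‖T u‖ ^ 2) (f : X →L[ℝ] ℝ) :
    ∃ u ∈ V, ∀ w ∈ V, inner ℝ (T u) (T w) = f w := by
  have : CompleteSpace V := hV.completeSpace_coe
  let B : V →L[ℝ] V →L[ℝ] ℝ := LinearMap.mkContinuous₂
    (LinearMap.mk₂ ℝ (fun u w : V => inner ℝ (T u) (T w))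
      (fun u u' w => by simp [inner_add_left]) (fun t u w => by simp [inner_smul_left])
      (fun u w w' => by simp [inner_add_right]) (fun t u w => by simp [inner_smul_right]))
    (‖T‖ * ‖T‖) (fun u w => by
      refine (norm_inner_le_norm (𝕜 := ℝ) (T u) (T w)).trans ?_
      calc ‖T u‖ * ‖T w‖ ≤ (‖T‖ * ‖u‖) * (‖T‖ * ‖w‖) := by
            gcongr <;> exact T.le_opNorm _
        _ = ‖T‖ * ‖T‖ * ‖u‖ * ‖w‖ := by ring)
  have hB : ∀ u w, B u w = inner ℝ (T u) (T w) := fun u w => rfl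
  have hco : IsCoercive B := by
    refine ⟨(max C 1)⁻¹, by positivity, fun u => ?_⟩
    rw [hB, real_inner_self_eq_norm_sq, mul_assoc, inv_mul_le_iff₀ (by positivity), ← pow_two]
    exact (hT u u.2).trans (by gcongr; exact le_max_left _ _)
  set u := hco.continuousLinearEquivOfBilin.symm ((InnerProductSpace.toDual ℝ V).symm
    (f.comp V.subtypeL)) with hu
  refine ⟨u, u.2, fun w hw => ?_⟩
  have := hco.continuousLinearEquivOfBilin_apply u ⟨w, hw⟩
  rw [hu, ContinuousLinearEquiv.apply_symm_apply, InnerProductSpace.toDual_symm_apply] at this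
  exact this.symm

/-! ### Sobolev spaces as closures of smooth functions -/

theorem gradient_add' {φ ψ : Plane → ℝ} (hφ : ContDiff ℝ ∞ φ) (hψ : ContDiff ℝ ∞ ψ) :
    ∇ (φ + ψ) = ∇ φ + ∇ ψ := by
  ext z k
  rw [gradient_apply, fderiv_add (hφ.differentiable (by simp) z) (hψ.differentiable (by simp) z)]
  simp [gradient_apply]

theorem gradient_smul' {φ : Plane → ℝ} (hφ : ContDiff ℝ ∞ φ) (t : ℝ) :
    ∇ (t • φ) = t • ∇ φ := by
  ext z k
  rw [gradient_apply, fderiv_const_smul (hφ.differentiable (by simp) z)]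
  simp [gradient_apply]

theorem tsupport_gradient_subset (φ : Plane → ℝ) : tsupport (∇ φ) ⊆ tsupport φ := by
  refine closure_minimal (fun z hz => ?_) (isClosed_tsupport φ)
  refine support_fderiv_subset ℝ (f := φ) ?_
  intro h
  exact hz (by rw [gradient, h, map_zero])

/-- The space `C_c^∞(U)`. -/
def testFunctions (U : Set Plane) : Submodule ℝ (Plane → ℝ) where
  carrier := {φ | ContDiff ℝ ∞ φ ∧ HasCompactSupport φ ∧ tsupport φ ⊆ U}
  zero_mem' := ⟨contDiff_const, HasCompactSupport.zero, by simp [tsupport]⟩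
  add_mem' {φ ψ} hφ hψ := ⟨hφ.1.add hψ.1, hφ.2.1.add hψ.2.1,
    (tsupport_add φ ψ).trans (union_subset hφ.2.2 hψ.2.2)⟩
  smul_mem' t φ hφ := ⟨contDiff_const.smul hφ.1, hφ.2.1.smul_left,
    (closure_mono (Function.support_const_smul_subset t φ)).trans hφ.2.2⟩

theorem testFunctions_mono {U V : Set Plane} (h : U ⊆ V) : testFunctions U ≤ testFunctions V :=
  fun _ hφ => ⟨hφ.1, hφ.2.1, hφ.2.2.trans h⟩

variable {μ ν : Measure Plane} [IsFiniteMeasureOnCompacts μ] [IsFiniteMeasureOnCompacts ν]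
  {U : Set Plane}

theorem testFunctions.memLp {φ : Plane → ℝ} (hφ : φ ∈ testFunctions U) : MemLp φ 2 μ :=
  hφ.1.continuous.memLp_of_hasCompactSupport hφ.2.1

theorem testFunctions.memLp_gradient {φ : Plane → ℝ} (hφ : φ ∈ testFunctions U) :
    MemLp (∇ φ) 2 μ :=
  (continuous_gradient hφ.1).memLp_of_hasCompactSupport
    (hφ.2.1.mono' ((subset_tsupport _).trans (tsupport_gradient_subset φ)))

/-- Triples `(v, G, g)` of a function, its weak gradient and its trace. -/
abbrev SobolevTriple (μ ν : Measure Plane) : Type :=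
  WithLp 2 (Lp ℝ 2 μ × WithLp 2 (Lp Plane 2 μ × Lp ℝ 2 ν))

variable (μ ν) in
/-- The function component. -/
def valL : SobolevTriple μ ν →L[ℝ] Lp ℝ 2 μ := WithLp.fstL 2 ℝ _ _

variable (μ ν) in
/-- The gradient component. -/
def gradL : SobolevTriple μ ν →L[ℝ] Lp Plane 2 μ := (WithLp.fstL 2 ℝ _ _).comp (WithLp.sndL 2 ℝ _ _)

variable (μ ν) in
/-- The trace component. -/
def traceL : SobolevTriple μ ν →L[ℝ] Lp ℝ 2 ν := (WithLp.sndL 2 ℝ _ _).comp (WithLp.sndL 2 ℝ _ _)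

variable (μ ν U) in
/-- The triple `(φ, ∇ φ, φ)` of a test function. -/
def testTriple : testFunctions U →ₗ[ℝ] SobolevTriple μ ν where
  toFun φ := WithLp.toLp 2 ((testFunctions.memLp φ.2).toLp φ.1,
    WithLp.toLp 2 ((testFunctions.memLp_gradient φ.2).toLp (∇ φ.1), (testFunctions.memLp φ.2).toLp φ.1))
  map_add' φ ψ := by
    have h : (testFunctions.memLp_gradient (φ + ψ).2).toLp (μ := μ) (∇ (φ + ψ).1) =
        (testFunctions.memLp_gradient φ.2).toLp (∇ φ.1) +
          (testFunctions.memLp_gradient ψ.2).toLp (∇ ψ.1) := by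
      rw [← MemLp.toLp_add]
      exact MemLp.toLp_congr _ _ (by
        rw [show (φ + ψ).1 = φ.1 + ψ.1 from rfl, gradient_add' φ.2.1 ψ.2.1])
    rw [h]
    rfl
  map_smul' t φ := by
    have h : (testFunctions.memLp_gradient (t • φ).2).toLp (μ := μ) (∇ (t • φ).1) =
        t • (testFunctions.memLp_gradient φ.2).toLp (∇ φ.1) := by
      rw [← MemLp.toLp_const_smul]
      exact MemLp.toLp_congr _ _ (by
        rw [show (t • φ).1 = t • φ.1 from rfl, gradient_smul' φ.2.1])
    rw [h]
    rfl

variable (μ ν U) in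
/-- The closure of the triples of test functions. -/
def sobolevClosure : Submodule ℝ (SobolevTriple μ ν) :=
  (LinearMap.range (testTriple μ ν U)).topologicalClosure

theorem isClosed_sobolevClosure : IsClosed (sobolevClosure μ ν U : Set (SobolevTriple μ ν)) :=
  Submodule.isClosed_topologicalClosure _

theorem testTriple_mem (φ : testFunctions U) : testTriple μ ν U φ ∈ sobolevClosure μ ν U :=
  Submodule.le_topologicalClosure _ ⟨φ, rfl⟩

theorem sobolevClosure_mono {V : Set Plane} (h : U ⊆ V) :
    sobolevClosure μ ν U ≤ sobolevClosure μ ν V := by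
  refine Submodule.topologicalClosure_mono ?_
  rintro _ ⟨φ, rfl⟩
  exact ⟨⟨φ.1, testFunctions_mono h φ.2⟩, rfl⟩

/-- A closed condition that holds for test functions holds on the closure. -/
theorem sobolevClosure_induction {Q : SobolevTriple μ ν → Prop}
    (hQ : IsClosed {u | Q u}) (h : ∀ φ : testFunctions U, Q (testTriple μ ν U φ))
    {u : SobolevTriple μ ν} (hu : u ∈ sobolevClosure μ ν U) : Q u := by
  have hsub : (LinearMap.range (testTriple μ ν U) : Set (SobolevTriple μ ν)) ⊆ {u | Q u} := by
    rintro _ ⟨φ, rfl⟩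
    exact h φ
  exact closure_minimal hsub hQ hu

theorem exists_seq_of_mem_sobolevClosure {u : SobolevTriple μ ν} (hu : u ∈ sobolevClosure μ ν U) :
    ∃ φ : ℕ → Plane → ℝ, (∀ n, φ n ∈ testFunctions U) ∧
      Tendsto (fun n => eLpNorm (φ n - ⇑u.fst) 2 μ) atTop (𝓝 0) ∧
      Tendsto (fun n => eLpNorm (∇ (φ n) - ⇑u.snd.fst) 2 μ) atTop (𝓝 0) ∧
      Tendsto (fun n => eLpNorm (φ n - ⇑u.snd.snd) 2 ν) atTop (𝓝 0) := by
  obtain ⟨s, hs, hlim⟩ := mem_closure_iff_seq_limit.1 hu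
  choose φ hφ using hs
  refine ⟨fun n => (φ n).1, fun n => (φ n).2, ?_, ?_, ?_⟩
  · have h1 : Tendsto (fun n => (s n).fst) atTop (𝓝 u.fst) :=
      ((valL μ ν).continuous.tendsto u).comp hlim
    refine ((Lp.tendsto_Lp_iff_tendsto_eLpNorm' _ _).1 h1).congr fun n => ?_
    refine eLpNorm_congr_ae ?_
    rw [← hφ n]
    exact (MemLp.coeFn_toLp (testFunctions.memLp (φ n).2)).sub EventuallyEq.rfl
  · have h1 : Tendsto (fun n => (s n).snd.fst) atTop (𝓝 u.snd.fst) :=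
      ((gradL μ ν).continuous.tendsto u).comp hlim
    refine ((Lp.tendsto_Lp_iff_tendsto_eLpNorm' _ _).1 h1).congr fun n => ?_
    refine eLpNorm_congr_ae ?_
    rw [← hφ n]
    exact (MemLp.coeFn_toLp (testFunctions.memLp_gradient (φ n).2)).sub EventuallyEq.rfl
  · have h1 : Tendsto (fun n => (s n).snd.snd) atTop (𝓝 u.snd.snd) :=
      ((traceL μ ν).continuous.tendsto u).comp hlim
    refine ((Lp.tendsto_Lp_iff_tendsto_eLpNorm' _ _).1 h1).congr fun n => ?_
    refine eLpNorm_congr_ae ?_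
    rw [← hφ n]
    exact (MemLp.coeFn_toLp (testFunctions.memLp (φ n).2)).sub EventuallyEq.rfl

theorem integral_mul_fderiv_eq_neg {φ ψ : Plane → ℝ} (hφ : ContDiff ℝ ∞ φ) (hψ : ContDiff ℝ ∞ ψ)
    (hc : HasCompactSupport ψ) (e : Plane) :
    ∫ z, φ z * fderiv ℝ ψ z e = - ∫ z, ψ z * fderiv ℝ φ z e := by
  have hcd : HasCompactSupport fun z => fderiv ℝ ψ z e := hc.fderiv_apply ℝ e
  have h1 : Continuous fun z => fderiv ℝ ψ z e :=
    continuous_fderiv_comp hψ continuous_id continuous_const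
  have h2 : Continuous fun z => fderiv ℝ φ z e :=
    continuous_fderiv_comp hφ continuous_id continuous_const
  rw [integral_mul_fderiv_eq_neg_fderiv_mul_of_integrable]
  · simp_rw [mul_comm]
  · exact (h2.mul hψ.continuous).integrable_of_hasCompactSupport hc.mul_left
  · exact (hφ.continuous.mul h1).integrable_of_hasCompactSupport hcd.mul_left
  · exact (hφ.continuous.mul hψ.continuous).integrable_of_hasCompactSupport hc.mul_left
  · exact fun z _ => hφ.differentiable (by simp) z
  · exact fun z _ => hψ.differentiable (by simp) z

theorem setIntegral_of_tsupport_subset {E : Type*} [NormedAddCommGroup E] [NormedSpace ℝ E]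
    {f : Plane → E} (h : tsupport f ⊆ U) : ∫ z in U, f z = ∫ z, f z :=
  setIntegral_eq_integral_of_forall_compl_eq_zero fun z hz => by
    by_contra h0
    exact hz (h (subset_tsupport f h0))

theorem isWeakGradOn_of_forall {O : Set Plane} {v : Plane → ℝ} {G : Plane → Plane}
    (hv : MemLp v 2 (volume.restrict O)) (hG : MemLp G 2 (volume.restrict O))
    (h : ∀ ψ ∈ testFunctions O, ∀ k : Fin 2,
      (∫ z in O, v z * (∇ ψ z) k) = - ∫ z in O, ψ z * G z k) : IsWeakGradOn O v G := by
  refine ⟨hv, hG, fun ψ h1 h2 h3 => ?_⟩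
  have hψ : ψ ∈ testFunctions O := ⟨h1, h2, h3⟩
  have i1 : Integrable (fun z => v z • ∇ ψ z) (volume.restrict O) :=
    (memLp_one_iff_integrable).1 (MemLp.smul (p := 2) (q := 2) (testFunctions.memLp_gradient hψ) hv)
  have i2 : Integrable (fun z => ψ z • G z) (volume.restrict O) :=
    (memLp_one_iff_integrable).1 (MemLp.smul (p := 2) (q := 2) hG (testFunctions.memLp hψ))
  ext k
  have e1 := (EuclideanSpace.proj k : Plane →L[ℝ] ℝ).integral_comp_comm i1
  have e2 := (EuclideanSpace.proj k : Plane →L[ℝ] ℝ).integral_comp_comm i2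
  simp only [PiLp.proj_apply, PiLp.smul_apply, smul_eq_mul] at e1 e2
  rw [PiLp.neg_apply, ← e1, ← e2]
  exact h ψ hψ k

theorem isWeakGradOn_smooth {O : Set Plane} {φ : Plane → ℝ}
    (hφ : φ ∈ testFunctions (univ : Set Plane)) : IsWeakGradOn O φ (∇ φ) := by
  refine isWeakGradOn_of_forall (testFunctions.memLp hφ) (testFunctions.memLp_gradient hφ)
    fun ψ hψ k => ?_
  simp_rw [gradient_apply]
  rw [setIntegral_of_tsupport_subset, setIntegral_of_tsupport_subset,
    integral_mul_fderiv_eq_neg hφ.1 hψ.1 hψ.2.1]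
  · exact (tsupport_mul_subset_left).trans hψ.2.2
  · exact (tsupport_mul_subset_right).trans ((tsupport_fderiv_apply_subset ℝ _).trans hψ.2.2)

/-- For a fixed test function both sides of the defining identity are inner products with fixed `L²`
elements. The identity is therefore a closed condition, and it holds for smooth functions by partial
integration. -/
theorem isWeakGradOn_of_mem_sobolevClosure {O : Set Plane}
    {u : SobolevTriple (volume.restrict O) ν}
    (hu : u ∈ sobolevClosure (volume.restrict O) ν U) : IsWeakGradOn O u.fst u.snd.fst := by
  refine isWeakGradOn_of_forall (Lp.memLp _) (Lp.memLp _) fun ψ hψ k => ?_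
  have hψ1 : MemLp (fun z => (∇ ψ z) k) 2 (volume.restrict O) :=
    (EuclideanSpace.proj k : Plane →L[ℝ] ℝ).comp_memLp' (testFunctions.memLp_gradient hψ)
  have hψ2 : MemLp (fun z => ψ z • (EuclideanSpace.single k 1 : Plane)) 2 (volume.restrict O) :=
    ((ContinuousLinearMap.id ℝ ℝ).smulRight (EuclideanSpace.single k 1 : Plane)).comp_memLp'
      (testFunctions.memLp hψ)
  have e1 : ∀ w : SobolevTriple (volume.restrict O) ν,
      inner ℝ (hψ1.toLp _) w.fst = ∫ z in O, w.fst z * (∇ ψ z) k := by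
    intro w
    rw [L2.inner_def]
    refine integral_congr_ae ?_
    filter_upwards [hψ1.coeFn_toLp] with z hz
    rw [hz]; simp
  have e2 : ∀ w : SobolevTriple (volume.restrict O) ν,
      inner ℝ (hψ2.toLp _) w.snd.fst = ∫ z in O, ψ z * w.snd.fst z k := by
    intro w
    rw [L2.inner_def]
    refine integral_congr_ae ?_
    filter_upwards [hψ2.coeFn_toLp] with z hz
    rw [hz, inner_smul_left, EuclideanSpace.inner_single_left]; simp
  refine sobolevClosure_induction (Q := fun u : SobolevTriple (volume.restrict O) ν =>
    (∫ z in O, u.fst z * (∇ ψ z) k) = - ∫ z in O, ψ z * u.snd.fst z k) ?_ ?_ hu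
  · simp_rw [← e1, ← e2]
    have c1 : Continuous fun w : SobolevTriple (volume.restrict O) ν => w.fst :=
      (valL _ _).continuous
    have c2 : Continuous fun w : SobolevTriple (volume.restrict O) ν => w.snd.fst :=
      (gradL _ _).continuous
    exact isClosed_eq (continuous_const.inner c1) (continuous_const.inner c2).neg
  · intro φ
    have h1 := (isWeakGradOn_smooth (O := O) (testFunctions_mono (subset_univ U) φ.2)).2.2 ψ hψ.1 hψ.2.1 hψ.2.2
    have i1 : Integrable (fun z => φ.1 z • ∇ ψ z) (volume.restrict O) :=
      (memLp_one_iff_integrable).1 (MemLp.smul (p := 2) (q := 2) (testFunctions.memLp_gradient hψ) (testFunctions.memLp φ.2))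
    have i2 : Integrable (fun z => ψ z • ∇ φ.1 z) (volume.restrict O) :=
      (memLp_one_iff_integrable).1 (MemLp.smul (p := 2) (q := 2) (testFunctions.memLp_gradient φ.2) (testFunctions.memLp hψ))
    have f1 := (EuclideanSpace.proj k : Plane →L[ℝ] ℝ).integral_comp_comm i1
    have f2 := (EuclideanSpace.proj k : Plane →L[ℝ] ℝ).integral_comp_comm i2
    simp only [PiLp.proj_apply, PiLp.smul_apply, smul_eq_mul] at f1 f2
    have h2 : (∫ z in O, φ.1 z * (∇ ψ z) k) = - ∫ z in O, ψ z * (∇ φ.1 z) k := by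
      rw [f1, f2, h1]; rfl
    have g1 : (∫ z in O, (testTriple (volume.restrict O) ν U φ).fst z * (∇ ψ z) k) =
        ∫ z in O, φ.1 z * (∇ ψ z) k := by
      refine integral_congr_ae ?_
      filter_upwards [(testFunctions.memLp (μ := volume.restrict O) φ.2).coeFn_toLp] with z hz
      exact congrArg (· * _) hz
    have g2 : (∫ z in O, ψ z * (testTriple (volume.restrict O) ν U φ).snd.fst z k) =
        ∫ z in O, ψ z * (∇ φ.1 z) k := by
      refine integral_congr_ae ?_
      filter_upwards [(testFunctions.memLp_gradient (μ := volume.restrict O) φ.2).coeFn_toLp]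
        with z hz
      exact congrArg (fun w : Plane => ψ z * w k) hz
    rw [g1, g2, h2]

/-- Convergence in `L²` implies convergence in `L¹` for a finite measure. The norm may be taken for
a larger measure `M`, so that `m` can be one edge of a boundary. -/
theorem tendsto_integral_of_L2 {E : Type*} [NormedAddCommGroup E] [NormedSpace ℝ E]
    {m M : Measure Plane} [IsFiniteMeasure m] (hm : m ≤ M) {f : ℕ → Plane → E} {g : Plane → E}
    (hf : ∀ n, Integrable (f n) m) (hg : Integrable g m)
    (h : Tendsto (fun n => eLpNorm (f n - g) 2 M) atTop (𝓝 0)) :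
    Tendsto (fun n => ∫ z, f n z ∂m) atTop (𝓝 (∫ z, g z ∂m)) := by
  refine tendsto_integral_of_L1' g hg.aestronglyMeasurable (Eventually.of_forall hf) ?_
  have hC : m univ ^ (1 / (1 : ℝ≥0∞).toReal - 1 / (2 : ℝ≥0∞).toReal) ≠ ⊤ :=
    ENNReal.rpow_ne_top_of_nonneg (by norm_num) (measure_ne_top m univ)
  have h0 : Tendsto (fun n => eLpNorm (f n - g) 2 M *
      m univ ^ (1 / (1 : ℝ≥0∞).toReal - 1 / (2 : ℝ≥0∞).toReal)) atTop (𝓝 0) := by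
    simpa using ENNReal.Tendsto.mul_const h (Or.inr hC)
  refine tendsto_of_tendsto_of_tendsto_of_le_of_le tendsto_const_nhds h0 (fun n => zero_le)
    fun n => ?_
  refine (eLpNorm_le_eLpNorm_mul_rpow_measure_univ (p := 1) (q := 2) (by norm_num)
    ((hf n).sub hg).aestronglyMeasurable).trans ?_
  gcongr

/-- Uniqueness of weak gradients, by the fundamental lemma of the calculus of variations. -/
theorem IsWeakGradOn.ae_eq {U : Set Plane} (hU : IsOpen U) {v v' : Plane → ℝ} {G G' : Plane → Plane}
    (h : IsWeakGradOn U v G) (h' : IsWeakGradOn U v' G') (hv : v =ᵐ[volume.restrict U] v') :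
    G =ᵐ[volume.restrict U] G' := by
  have hG : MemLp (G - G') 2 (volume.restrict U) := h.2.1.sub h'.2.1
  have hloc : LocallyIntegrableOn (G - G') U := by
    exact locallyIntegrableOn_of_locallyIntegrable_restrict (hG.locallyIntegrable (by norm_num))
  have := hU.ae_eq_zero_of_integral_contDiff_smul_eq_zero hloc fun φ h1 h2 h3 => ?_
  · rw [EventuallyEq, ae_restrict_iff' hU.measurableSet]
    filter_upwards [this] with z hz hzU
    exact sub_eq_zero.1 (hz hzU)
  · have hφ : φ ∈ testFunctions U := ⟨h1, h2, h3⟩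
    have e1 := h.2.2 φ h1 h2 h3
    have e2 := h'.2.2 φ h1 h2 h3
    have e3 : ∫ x in U, v x • ∇ φ x = ∫ x in U, v' x • ∇ φ x := by
      refine integral_congr_ae ?_
      filter_upwards [hv] with z hz
      rw [hz]
    have i1 : Integrable (fun z => φ z • G z) (volume.restrict U) :=
      (memLp_one_iff_integrable).1 (MemLp.smul (p := 2) (q := 2) h.2.1 (testFunctions.memLp hφ))
    have i2 : Integrable (fun z => φ z • G' z) (volume.restrict U) :=
      (memLp_one_iff_integrable).1 (MemLp.smul (p := 2) (q := 2) h'.2.1 (testFunctions.memLp hφ))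
    rw [← setIntegral_of_tsupport_subset (U := U)
      (f := fun z => φ z • (G - G') z) ((closure_mono (Function.support_smul_subset_left _ _)).trans h3)]
    simp only [Pi.sub_apply, smul_sub]
    rw [integral_sub i1 i2, sub_eq_zero]
    exact neg_injective (by rw [← e1, ← e2, e3])

/-! ### Edge integrals and coercivity on an element. -/

namespace PolygonalElement

variable {K : PolygonalElement} {c : Plane} {r : ℝ}

theorem edgeMeasure_le (K : PolygonalElement) (a : Fin K.n) :
    K.edgeMeasure a ≤ K.boundaryMeasure := by
  refine Measure.le_iff.2 fun s _ => ?_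
  rw [boundaryMeasure, Measure.finsetSum_apply]
  exact Finset.single_le_sum (f := fun a => K.edgeMeasure a s) (fun _ _ => zero_le) (Finset.mem_univ a)

theorem integrable_edgeMeasure_of_memLp {g : Plane → ℝ} (hg : MemLp g 2 K.boundaryMeasure)
    (a : Fin K.n) : Integrable g (K.edgeMeasure a) :=
  (hg.mono_measure (K.edgeMeasure_le a)).integrable (by norm_num)

/-- Integration over the `a`-th edge, as a functional on `L²(∂K)`. -/
def edgeIntegral (K : PolygonalElement) (a : Fin K.n) : Lp ℝ 2 K.boundaryMeasure →L[ℝ] ℝ :=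
  LinearMap.mkContinuous
    { toFun := fun g => ∫ z, g z ∂(K.edgeMeasure a)
      map_add' := fun f g => by
        rw [← integral_add (integrable_edgeMeasure_of_memLp (Lp.memLp f) a)
          (integrable_edgeMeasure_of_memLp (Lp.memLp g) a)]
        exact integral_congr_ae (ae_mono (K.edgeMeasure_le a) (Lp.coeFn_add f g))
      map_smul' := fun t f => by
        rw [RingHom.id_apply, smul_eq_mul, ← integral_const_mul]
        exact integral_congr_ae (ae_mono (K.edgeMeasure_le a) (Lp.coeFn_smul t f)) }
    (K.edgeMeasure a univ ^ (1 / (1 : ℝ≥0∞).toReal - 1 / (2 : ℝ≥0∞).toReal)).toReal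
    (fun g => by
      have hC : K.edgeMeasure a univ ^ (1 / (1 : ℝ≥0∞).toReal - 1 / (2 : ℝ≥0∞).toReal) ≠ ⊤ :=
        ENNReal.rpow_ne_top_of_nonneg (by norm_num) (measure_ne_top _ univ)
      have hg := integrable_edgeMeasure_of_memLp (Lp.memLp g) a
      change ‖∫ z, g z ∂(K.edgeMeasure a)‖ ≤ _
      refine (norm_integral_le_integral_norm _).trans ?_
      rw [integral_norm_eq_lintegral_enorm hg.aestronglyMeasurable, ← eLpNorm_one_eq_lintegral_enorm,
        Lp.norm_def, ← ENNReal.toReal_mul]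
      refine ENNReal.toReal_mono (ENNReal.mul_ne_top hC (Lp.eLpNorm_ne_top g)) ?_
      rw [mul_comm]
      refine (eLpNorm_le_eLpNorm_mul_rpow_measure_univ (p := 1) (q := 2) (by norm_num)
        hg.aestronglyMeasurable).trans ?_
      gcongr
      exact K.edgeMeasure_le a)

theorem edgeIntegral_apply (a : Fin K.n) (g : Lp ℝ 2 K.boundaryMeasure) :
    K.edgeIntegral a g = ∫ z, g z ∂(K.edgeMeasure a) := rfl

theorem sq_integral_edge_le (a : Fin K.n) {f : Plane → ℝ} (hf : Continuous f) :
    (∫ z, f z ∂(K.edgeMeasure a)) ^ 2 ≤ K.edgeLength a * ∫ z, f z ^ 2 ∂(K.edgeMeasure a) := by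
  rw [integral_edgeMeasure a hf, integral_edgeMeasure a (by fun_prop : Continuous fun z => f z ^ 2),
    mul_pow, ← mul_assoc, ← pow_two]
  exact mul_le_mul_of_nonneg_left (sq_integral_le (by fun_prop)) (sq_nonneg _)

theorem integral_edge_const (a : Fin K.n) (m : ℝ) :
    ∫ _, m ∂(K.edgeMeasure a) = K.edgeLength a * m := by
  rw [integral_edgeMeasure a continuous_const]; simp

theorem integral_boundaryMeasure {f : Plane → ℝ} (hf : Continuous f) :
    ∫ z, f z ∂K.boundaryMeasure = ∑ a, ∫ z, f z ∂(K.edgeMeasure a) := by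
  rw [boundaryMeasure]
  exact integral_finsetSum_measure fun a _ => integrable_edgeMeasure a hf

/-- The `H¹(K)`-norm and the trace norm are controlled by the gradient and the edge means. -/
theorem IsStar.coercive (h : K.IsStar c r) : ∃ C : ℝ, 0 ≤ C ∧ ∀ φ : Plane → ℝ, ContDiff ℝ ∞ φ →
    (∫ z in K.openRegion, φ z ^ 2) + (∫ z, φ z ^ 2 ∂K.boundaryMeasure) ≤
      C * ((∫ z in K.openRegion, ‖∇ φ z‖ ^ 2) + ∑ a, (∫ z, φ z ∂(K.edgeMeasure a)) ^ 2) := by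
  obtain ⟨C₁, hC₁, h₁⟩ := h.poincare
  obtain ⟨C₂, hC₂, h₂⟩ := h.edge_sq_le
  let a₀ : Fin K.n := ⟨0, by have := K.three_le; omega⟩
  obtain ⟨l, hl⟩ : ∃ y, y = K.edgeLength a₀ := ⟨_, rfl⟩
  have hl0 : 0 < l := hl ▸ K.edgeLength_pos a₀
  obtain ⟨A, hA⟩ : ∃ y, y = (volume.restrict K.openRegion).real univ := ⟨_, rfl⟩
  obtain ⟨D, hD⟩ : ∃ y, y = C₂ * (C₁ + 1) := ⟨_, rfl⟩
  have hD0 : 0 ≤ D := by rw [hD]; positivity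
  obtain ⟨L, hL⟩ : ∃ y, y = ∑ a, K.edgeLength a := ⟨_, rfl⟩
  have hL0 : 0 ≤ L := hL ▸ Finset.sum_nonneg fun a _ => (K.edgeLength_pos a).le
  -- On the edge `a₀` of length `l`, the number `l * m` is the difference of the integrals of `φ`
  -- and of `φ - m`. Squaring gives `m² ≤ (2 / l²) S + (2 D / l) G`, where `D * G` bounds the
  -- squared norm of `φ - m` on the edge; `Q` dominates both coefficients.
  obtain ⟨Q, hQ⟩ : ∃ y, y = 2 / l ^ 2 + 2 * D / l := ⟨_, rfl⟩
  have hA0 : 0 ≤ A := hA ▸ measureReal_nonneg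
  have hQ0 : 0 ≤ Q := by rw [hQ]; positivity
  refine ⟨2 * C₁ + 2 * Q * A + (K.n * (2 * D) + 2 * Q * L), by positivity, fun φ hφ => ?_⟩
  obtain ⟨m, hm⟩ := h₁ φ hφ
  have hφc := hφ.continuous
  have hG0 : 0 ≤ ∫ z in K.openRegion, ‖∇ φ z‖ ^ 2 := integral_nonneg fun z => by positivity
  have hS0 : 0 ≤ ∑ a, (∫ z, φ z ∂(K.edgeMeasure a)) ^ 2 := Finset.sum_nonneg fun a _ => sq_nonneg _
  obtain ⟨G, hG⟩ : ∃ y, y = ∫ z in K.openRegion, ‖∇ φ z‖ ^ 2 := ⟨_, rfl⟩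
  obtain ⟨S, hS⟩ : ∃ y, y = ∑ a, (∫ z, φ z ∂(K.edgeMeasure a)) ^ 2 := ⟨_, rfl⟩
  rw [← hG] at hm hG0 ⊢
  rw [← hS] at hS0 ⊢
  have hψ : ContDiff ℝ ∞ fun z => φ z - m := hφ.sub contDiff_const
  have hgr : ∀ z, ∇ (fun z => φ z - m) z = ∇ φ z := fun z => by
    rw [gradient, gradient, fderiv_sub_const]
  have hedge : ∀ a, ∫ z, (φ z - m) ^ 2 ∂(K.edgeMeasure a) ≤ D * G := by
    intro a
    refine (h₂ _ hψ a).trans ?_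
    simp_rw [hgr]
    rw [hD, mul_assoc, ← hG]
    gcongr
    linarith
  -- the mean value is controlled
  have hm2 : m ^ 2 ≤ Q * (G + S) := by
    have e1 : ∫ z, φ z ∂(K.edgeMeasure a₀) = (∫ z, (φ z - m) ∂(K.edgeMeasure a₀)) + l * m := by
      rw [hl, ← integral_edge_const, ← integral_add (integrable_edgeMeasure a₀ hψ.continuous)
        (integrable_const _)]
      simp
    have e2 := sq_integral_edge_le a₀ hψ.continuous
    have e3 := hedge a₀
    rw [← hl] at e2
    have e4 : (∫ z, φ z ∂(K.edgeMeasure a₀)) ^ 2 ≤ S := hS ▸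
      Finset.single_le_sum (f := fun a => (∫ z, φ z ∂(K.edgeMeasure a)) ^ 2)
        (fun a _ => sq_nonneg _) (Finset.mem_univ a₀)
    generalize ∫ z, φ z ∂(K.edgeMeasure a₀) = p at *
    generalize ∫ z, (φ z - m) ∂(K.edgeMeasure a₀) = q at *
    generalize ∫ z, (φ z - m) ^ 2 ∂(K.edgeMeasure a₀) = q2 at *
    have e5 : (l * m) ^ 2 ≤ 2 * S + 2 * (l * (D * G)) := by
      have : l * m = p - q := by linarith
      rw [this]
      have e6 : q ^ 2 ≤ l * (D * G) := e2.trans (mul_le_mul_of_nonneg_left e3 hl0.le)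
      nlinarith [sq_nonneg (p + q)]
    have e7 : m ^ 2 ≤ 2 / l ^ 2 * S + 2 * D / l * G := by
      have : 2 / l ^ 2 * S + 2 * D / l * G = (2 * S + 2 * (l * (D * G))) / l ^ 2 := by
        field_simp
      rw [this, le_div_iff₀ (by positivity)]
      linarith [mul_pow l m 2]
    refine e7.trans ?_
    rw [hQ]
    have f1 : 0 ≤ 2 / l ^ 2 * G := by positivity
    have f2 : 0 ≤ 2 * D / l * S := by positivity
    linarith
  have hint : ∫ z in K.openRegion, φ z ^ 2 ≤ 2 * C₁ * G + 2 * m ^ 2 * A := by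
    have i1 : IntegrableOn (fun z => 2 * (φ z - m) ^ 2) K.openRegion :=
      K.integrableOn_of_continuous (by fun_prop)
    calc ∫ z in K.openRegion, φ z ^ 2 ≤ ∫ z in K.openRegion, (2 * (φ z - m) ^ 2 + 2 * m ^ 2) := by
          refine integral_mono (K.integrableOn_of_continuous (by fun_prop))
            (K.integrableOn_of_continuous (by fun_prop)) fun z => ?_
          dsimp only
          nlinarith [sq_nonneg (φ z - 2 * m)]
      _ = 2 * (∫ z in K.openRegion, (φ z - m) ^ 2) + 2 * m ^ 2 * A := by
          rw [integral_add i1 (integrable_const _), integral_const_mul, integral_const, ← hA,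
            smul_eq_mul, mul_comm A]
      _ ≤ _ := by linarith
  have hbd : ∀ a, ∫ z, φ z ^ 2 ∂(K.edgeMeasure a) ≤ 2 * D * G + 2 * m ^ 2 * K.edgeLength a := by
    intro a
    calc ∫ z, φ z ^ 2 ∂(K.edgeMeasure a)
        ≤ ∫ z, (2 * (φ z - m) ^ 2 + 2 * m ^ 2) ∂(K.edgeMeasure a) := by
          refine integral_mono (integrable_edgeMeasure a (by fun_prop))
            (integrable_edgeMeasure a (by fun_prop)) fun z => ?_
          dsimp only
          nlinarith [sq_nonneg (φ z - 2 * m)]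
      _ = 2 * (∫ z, (φ z - m) ^ 2 ∂(K.edgeMeasure a)) + 2 * m ^ 2 * K.edgeLength a := by
          rw [integral_add (integrable_edgeMeasure a (by fun_prop)) (integrable_const _),
            integral_const_mul, integral_edge_const]
          ring
      _ ≤ _ := by linarith [hedge a]
  have hbs : ∫ z, φ z ^ 2 ∂K.boundaryMeasure ≤ K.n * (2 * D * G) + 2 * m ^ 2 * L := by
    rw [integral_boundaryMeasure (by fun_prop : Continuous fun z => φ z ^ 2)]
    refine (Finset.sum_le_sum fun a _ => hbd a).trans_eq ?_
    rw [Finset.sum_add_distrib, Finset.sum_const, Finset.card_fin, nsmul_eq_mul, hL,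
      Finset.mul_sum]
  have g1 : m ^ 2 * (2 * A + 2 * L) ≤ Q * (G + S) * (2 * A + 2 * L) :=
    mul_le_mul_of_nonneg_right hm2 (by positivity)
  have g2 : 0 ≤ 2 * C₁ * S := by positivity
  have g3 : 0 ≤ K.n * (2 * D) * S := by positivity
  linarith

end PolygonalElement

theorem norm_toLp_sq {E : Type*} [NormedAddCommGroup E] [InnerProductSpace ℝ E] {μ : Measure Plane}
    {f : Plane → E} (hf : MemLp f 2 μ) : ‖hf.toLp f‖ ^ 2 = ∫ z, ‖f z‖ ^ 2 ∂μ := by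
  rw [← real_inner_self_eq_norm_sq, L2.inner_def]
  refine integral_congr_ae ?_
  filter_upwards [hf.coeFn_toLp] with z hz
  rw [hz, real_inner_self_eq_norm_sq]

theorem exists_cutoff {A : Set Plane} (hA : IsCompact A) :
    ∃ χ ∈ testFunctions univ, ∃ U : Set Plane, IsOpen U ∧ A ⊆ U ∧ ∀ z ∈ U, χ z = 1 := by
  obtain ⟨R, hR0, hR⟩ := hA.isBounded.subset_ball_lt 0 0
  let χ : ContDiffBump (0 : Plane) := ⟨R, R + 1, hR0, by linarith⟩
  exact ⟨χ, ⟨χ.contDiff, χ.hasCompactSupport, subset_univ _⟩, Metric.ball 0 R, Metric.isOpen_ball, hR,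
    fun z hz => χ.one_of_mem_closedBall (Metric.ball_subset_closedBall hz)⟩

/-! ### Neumann and Dirichlet problems on an element. -/

namespace PolygonalElement

variable {K : PolygonalElement} {c : Plane} {r : ℝ}

theorem integral_edge_congr (a : Fin K.n) {f g : Plane → ℝ} (hf : Continuous f) (hg : Continuous g)
    (h : ∀ z ∈ K.edge a, f z = g z) :
    ∫ z, f z ∂(K.edgeMeasure a) = ∫ z, g z ∂(K.edgeMeasure a) := by
  rw [integral_edgeMeasure a hf, integral_edgeMeasure a hg]
  congr 1
  refine intervalIntegral.integral_congr fun s hs => h _ (K.mem_edge.2 ⟨s, ?_, rfl⟩)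
  rwa [uIcc_of_le zero_le_one] at hs

variable (K) in
/-- The `H¹(K)` functions with their gradients and traces. -/
abbrev H1 : Submodule ℝ (SobolevTriple (volume.restrict K.openRegion) K.boundaryMeasure) :=
  sobolevClosure (volume.restrict K.openRegion) K.boundaryMeasure univ

variable (K) in
/-- The gradient together with the edge means. -/
def gradEdge : SobolevTriple (volume.restrict K.openRegion) K.boundaryMeasure →L[ℝ]
    WithLp 2 (Lp Plane 2 (volume.restrict K.openRegion) × EuclideanSpace ℝ (Fin K.n)) :=
  (WithLp.prodContinuousLinearEquiv 2 ℝ _ _).symm.toContinuousLinearMap.comp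
    ((gradL _ _).prod ((EuclideanSpace.equiv (Fin K.n) ℝ).symm.toContinuousLinearMap.comp
      (ContinuousLinearMap.pi fun a => (K.edgeIntegral a).comp (traceL _ _))))

theorem inner_gradEdge (u w : SobolevTriple (volume.restrict K.openRegion) K.boundaryMeasure) :
    inner ℝ (K.gradEdge u) (K.gradEdge w) = inner ℝ u.snd.fst w.snd.fst +
      ∑ a, K.edgeIntegral a u.snd.snd * K.edgeIntegral a w.snd.snd := by
  rw [WithLp.prod_inner_apply, PiLp.inner_apply]
  congr 1
  refine Finset.sum_congr rfl fun a _ => ?_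
  exact mul_comm _ _

theorem norm_gradEdge_sq (u : SobolevTriple (volume.restrict K.openRegion) K.boundaryMeasure) :
    ‖K.gradEdge u‖ ^ 2 = ‖u.snd.fst‖ ^ 2 + ∑ a, K.edgeIntegral a u.snd.snd ^ 2 := by
  rw [← real_inner_self_eq_norm_sq, inner_gradEdge, real_inner_self_eq_norm_sq]
  simp_rw [pow_two]

theorem edgeIntegral_testTriple (a : Fin K.n) {U : Set Plane} (φ : testFunctions U) :
    K.edgeIntegral a (testTriple (volume.restrict K.openRegion) K.boundaryMeasure U φ).snd.snd =
      ∫ z, φ.1 z ∂(K.edgeMeasure a) := by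
  rw [edgeIntegral_apply]
  exact integral_congr_ae (ae_mono (K.edgeMeasure_le a) (testFunctions.memLp φ.2).coeFn_toLp)

theorem inner_grad_testTriple {U : Set Plane} (φ : testFunctions U)
    (G : Lp Plane 2 (volume.restrict K.openRegion)) :
    inner ℝ G (testTriple (volume.restrict K.openRegion) K.boundaryMeasure U φ).snd.fst =
      ∫ z in K.openRegion, inner ℝ (G z) (∇ φ.1 z) := by
  rw [L2.inner_def]
  refine integral_congr_ae ?_
  filter_upwards [(testFunctions.memLp_gradient (μ := volume.restrict K.openRegion) φ.2).coeFn_toLp]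
    with z hz
  exact congrArg (fun w : Plane => inner ℝ (G z) w) hz

/-- Both sides are continuous, so `coercive` passes from test functions to the closure. The `1`
added to `C` accounts for the gradient part of the norm. -/
theorem IsStar.coercive_H1 (h : K.IsStar c r) :
    ∃ C : ℝ, ∀ u ∈ K.H1, ‖u‖ ^ 2 ≤ C * ‖K.gradEdge u‖ ^ 2 := by
  obtain ⟨C, hC0, hC⟩ := h.coercive
  refine ⟨C + 1, fun u hu => ?_⟩
  refine sobolevClosure_induction (Q := fun u => ‖u‖ ^ 2 ≤ (C + 1) * ‖K.gradEdge u‖ ^ 2)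
    (isClosed_le (by fun_prop) (by fun_prop)) (fun φ => ?_) hu
  have h1 := hC φ.1 φ.2.1
  rw [norm_gradEdge_sq, WithLp.prod_norm_sq_eq_of_L2, WithLp.prod_norm_sq_eq_of_L2]
  simp_rw [edgeIntegral_testTriple]
  change ‖(testFunctions.memLp φ.2).toLp φ.1‖ ^ 2 +
    (‖(testFunctions.memLp_gradient φ.2).toLp (∇ φ.1)‖ ^ 2 +
      ‖(testFunctions.memLp φ.2).toLp φ.1‖ ^ 2) ≤
    (C + 1) * (‖(testFunctions.memLp_gradient φ.2).toLp (∇ φ.1)‖ ^ 2 + _)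
  rw [norm_toLp_sq, norm_toLp_sq, norm_toLp_sq]
  simp only [Real.norm_eq_abs, sq_abs]
  have h2 : 0 ≤ ∑ a, (∫ z, φ.1 z ∂(K.edgeMeasure a)) ^ 2 := Finset.sum_nonneg fun a _ => sq_nonneg _
  linarith

/-- A bump centered at the midpoint of the edge and supported away from all the other edges. -/
theorem exists_edge_bump (K : PolygonalElement) (a : Fin K.n) : ∃ w ∈ testFunctions univ,
    0 < ∫ z, w z ∂(K.edgeMeasure a) ∧ ∀ b ≠ a, ∫ z, w z ∂(K.edgeMeasure b) = 0 := by
  set m := K.poly a + (1 / 2 : ℝ) • K.edgeVec a with hm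
  have hh : (1 / 2 : ℝ) ∈ Ioo (0 : ℝ) 1 := by norm_num
  have hcl : IsClosed (⋃ b ∈ {b | b ≠ a}, K.edge b) :=
    (toFinite {b | b ≠ a}).isClosed_biUnion fun b _ => (K.isCompact_edge b).isClosed
  have hnhds : (⋃ b ∈ {b | b ≠ a}, K.edge b)ᶜ ∈ 𝓝 m := by
    refine hcl.isOpen_compl.mem_nhds fun hmem => ?_
    obtain ⟨b, hb, hmb⟩ := mem_iUnion₂.1 hmem
    exact hb (K.edge_eq_of_mem hmb (edge_point_mem hh) (edge_point_ne hh))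
  obtain ⟨w, hw1, hw2, hw3, hw4, hw5⟩ := exists_contDiff_tsupport_subset (n := ⊤) hnhds
  have hw3 : ContDiff ℝ ∞ w := hw3
  refine ⟨w, ⟨hw3, hw2, subset_univ _⟩, ?_, fun b hb => ?_⟩
  · rw [integral_edgeMeasure a hw3.continuous]
    refine mul_pos (K.edgeLength_pos a) (intervalIntegral.integral_pos zero_lt_one
      (hw3.continuous.comp (by fun_prop)).continuousOn
      (fun s _ => (hw4 ⟨_, rfl⟩).1) ⟨1 / 2, Ioo_subset_Icc_self hh, ?_⟩)
    rw [← hm, hw5]; exact one_pos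
  · rw [integral_edge_congr b hw3.continuous continuous_const (g := fun _ => 0), integral_zero]
    intro z hz
    by_contra h0
    exact hw1 (subset_tsupport w h0) (mem_iUnion₂.2 ⟨b, hb, hz⟩)

/-- `HasNormalDeriv` quantifies over all smooth functions. Multiplication by a cutoff equal to one
near the element makes the support compact without affecting either side. -/
theorem hasNormalDeriv_of_testFunctions {G : Plane → Plane} {d : Fin K.n → ℝ}
    (h : ∀ w ∈ testFunctions univ, ∫ x in K.openRegion, inner ℝ (G x) (∇ w x) =
      ∑ a, d a * ∫ z, w z ∂(K.edgeMeasure a)) : HasNormalDeriv K G d := by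
  intro w hw
  obtain ⟨χ, hχ, U, hU, hKU, hχU⟩ := exists_cutoff K.isCompact
  have hmem : (fun z => χ z * w z) ∈ testFunctions univ :=
    ⟨hχ.1.mul hw, hχ.2.1.mul_right, subset_univ _⟩
  have heq : ∀ z ∈ U, χ z * w z = w z := fun z hz => by rw [hχU z hz, one_mul]
  have := h _ hmem
  simp_rw [integral_const_mul]
  convert this using 1
  · refine setIntegral_congr_fun K.measurableSet_openRegion fun z hz => ?_
    have : (fun z => χ z * w z) =ᶠ[𝓝 z] w := by
      filter_upwards [hU.mem_nhds (hKU (K.openRegion_subset hz))] with y hy using heq y hy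
    rw [this.gradient_eq]
  · refine Finset.sum_congr rfl fun a _ => ?_
    rw [integral_edge_congr a hw.continuous hmem.1.continuous
      fun z hz => (heq z (hKU (K.edge_subset_carrier a hz))).symm]

theorem integral_edge_eq_zero (a : Fin K.n) {φ : Plane → ℝ} (hφ : φ ∈ testFunctions K.openRegion) :
    ∫ z, φ z ∂(K.edgeMeasure a) = 0 := by
  rw [integral_edge_congr a hφ.1.continuous continuous_const (g := fun _ => 0), integral_zero]
  intro z hz
  by_contra h0
  exact not_mem_edge_of_mem_openRegion (hφ.2.2 (subset_tsupport φ h0)) a hz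

theorem HasNormalDeriv.isWeaklyHarmonic {G : Plane → Plane} {d : Fin K.n → ℝ}
    (h : HasNormalDeriv K G d) : IsWeaklyHarmonic K.openRegion G := by
  intro φ h1 h2 h3
  rw [h φ h1]
  refine Finset.sum_eq_zero fun a _ => ?_
  rw [integral_const_mul, integral_edge_eq_zero a ⟨h1, h2, h3⟩, mul_zero]

variable (K) in
/-- The vector of edge integrals. -/
def edgeIntegrals : SobolevTriple (volume.restrict K.openRegion) K.boundaryMeasure →ₗ[ℝ]
    EuclideanSpace ℝ (Fin K.n) :=
  ((EuclideanSpace.equiv (Fin K.n) ℝ).symm.toContinuousLinearMap.comp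
    (ContinuousLinearMap.pi fun a => (K.edgeIntegral a).comp (traceL _ _))).toLinearMap

theorem edgeIntegrals_apply (u : SobolevTriple (volume.restrict K.openRegion) K.boundaryMeasure)
    (a : Fin K.n) : K.edgeIntegrals u a = K.edgeIntegral a u.snd.snd := rfl

variable (K) in
/-- The weak solutions of Neumann problems with edgewise constant data. -/
def neumannSpace :
    Submodule ℝ (SobolevTriple (volume.restrict K.openRegion) K.boundaryMeasure) where
  carrier := {u | u ∈ K.H1 ∧ ∃ d : Fin K.n → ℝ, ∀ w ∈ K.H1, inner ℝ u.snd.fst w.snd.fst =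
    ∑ a, d a * K.edgeIntegral a w.snd.snd}
  zero_mem' := ⟨Submodule.zero_mem _, 0, fun w _ => by
    change inner ℝ (0 : Lp Plane 2 (volume.restrict K.openRegion)) _ = _
    simp⟩
  add_mem' := by
    rintro u v ⟨hu, d, hd⟩ ⟨hv, e, he⟩
    refine ⟨Submodule.add_mem _ hu hv, d + e, fun w hw => ?_⟩
    change inner ℝ (u.snd.fst + v.snd.fst) _ = _
    rw [inner_add_left, hd w hw, he w hw, ← Finset.sum_add_distrib]
    simp [add_mul]
  smul_mem' := by
    rintro s u ⟨hu, d, hd⟩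
    refine ⟨Submodule.smul_mem _ s hu, s • d, fun w hw => ?_⟩
    change inner ℝ (s • u.snd.fst) _ = _
    rw [inner_smul_left, hd w hw, Finset.mul_sum]
    simp [mul_assoc]

/-- With the edge integrals added, the Dirichlet form is coercive on all of `H¹`, constants
included. The solution solves a Neumann problem with data `d a` minus its own edge integrals. -/
theorem IsStar.exists_robin (h : K.IsStar c r) (d : Fin K.n → ℝ) :
    ∃ u ∈ K.H1, ∀ w ∈ K.H1, inner ℝ u.snd.fst w.snd.fst +
      ∑ a, K.edgeIntegral a u.snd.snd * K.edgeIntegral a w.snd.snd =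
        ∑ a, d a * K.edgeIntegral a w.snd.snd := by
  obtain ⟨C, hC⟩ := h.coercive_H1
  obtain ⟨u, hu, hsol⟩ := exists_variational_solution K.H1 isClosed_sobolevClosure K.gradEdge hC
    (∑ a, d a • (K.edgeIntegral a).comp (traceL _ _))
  refine ⟨u, hu, fun w hw => ?_⟩
  rw [← inner_gradEdge, hsol w hw, sum_apply]
  rfl

/-- Let `d` be orthogonal to the edge integrals of all Neumann solutions. The Robin solution `u`
with data `d` is one of them, so testing its equation with `u` gives zero energy and `u = 0`. The
equation then says that `d` annihilates all edge integrals, and edge bumps give `d = 0`. -/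
theorem IsStar.map_neumannSpace_orthogonal (h : K.IsStar c r) :
    (K.neumannSpace.map K.edgeIntegrals)ᗮ = ⊥ := by
  obtain ⟨C, hC⟩ := h.coercive_H1
  rw [Submodule.eq_bot_iff]
  intro d hd
  obtain ⟨u, hu, hsol⟩ := h.exists_robin d
  have huS : u ∈ K.neumannSpace := by
    refine ⟨hu, fun a => d a - K.edgeIntegral a u.snd.snd, fun w hw => ?_⟩
    have := hsol w hw
    simp only [sub_mul, Finset.sum_sub_distrib]
    linarith
  have hzero : ∑ a, d a * K.edgeIntegral a u.snd.snd = 0 := by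
    have := (Submodule.mem_orthogonal _ _).1 hd _ (Submodule.mem_map_of_mem huS)
    rw [PiLp.inner_apply] at this
    exact this
  have hu0 : u = 0 := by
    have h1 := hsol u hu
    rw [hzero, ← inner_gradEdge, real_inner_self_eq_norm_sq] at h1
    have h2 := hC u hu
    rw [h1, mul_zero] at h2
    exact norm_eq_zero.1 (pow_eq_zero_iff two_ne_zero |>.1 (le_antisymm h2 (sq_nonneg _)))
  ext a
  obtain ⟨w, hw, hwa, hwb⟩ := K.exists_edge_bump a
  have h3 := hsol _ (testTriple_mem ⟨w, hw⟩)
  rw [← inner_gradEdge, hu0, map_zero, inner_zero_left] at h3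
  simp_rw [edgeIntegral_testTriple] at h3
  rw [Finset.sum_eq_single a (fun b _ hb => by rw [hwb b hb, mul_zero]) (by simp)] at h3
  exact (mul_eq_zero.1 h3.symm).resolve_right (ne_of_gt hwa)

/-- The Neumann problem: the edge means are degrees of freedom of `V_nc(K)`. -/
theorem IsStar.exists_neumann (h : K.IsStar c r) (t : Fin K.n → ℝ) :
    ∃ u ∈ K.H1, (∃ d, HasNormalDeriv K u.snd.fst d) ∧ ∀ a, K.edgeIntegral a u.snd.snd = t a := by
  have htop : ∀ R : Submodule ℝ (EuclideanSpace ℝ (Fin K.n)), Rᗮ = ⊥ → R = ⊤ :=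
    fun R => (Submodule.orthogonal_eq_bot_iff).1
  have ht : WithLp.toLp 2 t ∈ K.neumannSpace.map K.edgeIntegrals := by
    rw [htop _ h.map_neumannSpace_orthogonal]
    exact Submodule.mem_top
  obtain ⟨u, ⟨hu, d, hd⟩, hut⟩ := ht
  refine ⟨u, hu, ⟨d, hasNormalDeriv_of_testFunctions fun w hw => ?_⟩, fun a => ?_⟩
  · have := hd _ (testTriple_mem ⟨w, hw⟩)
    rw [inner_grad_testTriple] at this
    simp_rw [edgeIntegral_testTriple] at this
    exact this
  · rw [← edgeIntegrals_apply, hut]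

/-- The Dirichlet problem: every `H¹(K)` function is harmonic up to an `H₀¹(K)` correction. -/
theorem IsStar.exists_dirichlet (h : K.IsStar c r)
    (u : SobolevTriple (volume.restrict K.openRegion) K.boundaryMeasure) :
    ∃ w ∈ sobolevClosure (volume.restrict K.openRegion) K.boundaryMeasure K.openRegion,
      ∀ φ ∈ testFunctions K.openRegion,
        ∫ x in K.openRegion, inner ℝ ((u + w).snd.fst x) (∇ φ x) = 0 := by
  obtain ⟨C, hC⟩ := h.coercive_H1
  -- Edge integrals vanish on the closure of functions supported in the open element. There the
  -- coercive form of `gradEdge` is just the Dirichlet form.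
  have hedge : ∀ w ∈ sobolevClosure (volume.restrict K.openRegion) K.boundaryMeasure K.openRegion,
      ∀ a, K.edgeIntegral a w.snd.snd = 0 := by
    intro w hw a
    refine sobolevClosure_induction (Q := fun w => K.edgeIntegral a w.snd.snd = 0)
      (isClosed_eq ((K.edgeIntegral a).comp (traceL _ _)).continuous continuous_const)
      (fun φ => ?_) hw
    rw [edgeIntegral_testTriple, integral_edge_eq_zero a φ.2]
  obtain ⟨w, hw, hsol⟩ := exists_variational_solution
    (sobolevClosure (volume.restrict K.openRegion) K.boundaryMeasure K.openRegion)
    isClosed_sobolevClosure K.gradEdge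
    (fun v hv => hC v (sobolevClosure_mono (subset_univ _) hv))
    (-((innerSL ℝ u.snd.fst).comp (gradL _ _)))
  refine ⟨w, hw, fun φ hφ => ?_⟩
  have h1 := hsol _ (testTriple_mem ⟨φ, hφ⟩)
  rw [inner_gradEdge, Finset.sum_eq_zero fun a _ => by rw [hedge w hw a, zero_mul], add_zero] at h1
  have h2 : inner ℝ w.snd.fst (testTriple (volume.restrict K.openRegion) K.boundaryMeasure _
      ⟨φ, hφ⟩).snd.fst = - inner ℝ u.snd.fst (testTriple (volume.restrict K.openRegion)
        K.boundaryMeasure _ ⟨φ, hφ⟩).snd.fst := h1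
  have h3 := inner_grad_testTriple (K := K) ⟨φ, hφ⟩ (u + w).snd.fst
  rw [← h3]
  change inner ℝ (u.snd.fst + w.snd.fst) _ = _
  rw [inner_add_left, h2, add_neg_cancel]

theorem hasTrace_of_mem_H1 {u : SobolevTriple (volume.restrict K.openRegion) K.boundaryMeasure}
    (hu : u ∈ K.H1) : HasTrace K u.fst u.snd.snd := by
  obtain ⟨φ, hφ, h1, h2, h3⟩ := exists_seq_of_mem_sobolevClosure hu
  exact ⟨Lp.memLp _, u.snd.fst, isWeakGradOn_of_mem_sobolevClosure hu, φ, fun n => (hφ n).1,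
    ⟨h1, h2⟩, h3⟩

/-- Green's formula for a function with a trace. -/
theorem IsStar.green_trace (h : K.IsStar c r) {v g : Plane → ℝ} (hv : HasTrace K v g)
    {G : Plane → Plane} (hG : IsWeakGradOn K.openRegion v G) (k : Fin 2) :
    ∫ z in K.openRegion, G z k =
      ∑ a, K.normal c a (EuclideanSpace.single k 1) * ∫ z, g z ∂(K.edgeMeasure a) := by
  obtain ⟨hg, G', hG', φ, hφ, ⟨-, h2⟩, h3⟩ := hv
  have hGG : G' =ᵐ[volume.restrict K.openRegion] G :=
    hG'.ae_eq K.isOpen_openRegion hG EventuallyEq.rfl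
  have i1 : Integrable G' (volume.restrict K.openRegion) := hG'.2.1.integrable (by norm_num)
  have e1 := tendsto_integral_of_L2 le_rfl
    (fun n => K.integrableOn_of_continuous (continuous_gradient (hφ n))) i1 h2
  have e2 := ((EuclideanSpace.proj k : Plane →L[ℝ] ℝ).continuous.tendsto _).comp e1
  have e3 : ∀ n, (EuclideanSpace.proj k : Plane →L[ℝ] ℝ) (∫ z in K.openRegion, ∇ (φ n) z) =
      ∑ a, K.normal c a (EuclideanSpace.single k 1) * ∫ z, φ n z ∂(K.edgeMeasure a) := by
    intro n
    rw [← h.green (hφ n), ← ContinuousLinearMap.integral_comp_comm _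
      (K.integrableOn_of_continuous (continuous_gradient (hφ n)))]
    simp only [PiLp.proj_apply, gradient_apply]
  have e4 : Tendsto (fun n => ∑ a, K.normal c a (EuclideanSpace.single k 1) *
      ∫ z, φ n z ∂(K.edgeMeasure a)) atTop
      (𝓝 (∑ a, K.normal c a (EuclideanSpace.single k 1) * ∫ z, g z ∂(K.edgeMeasure a))) :=
    tendsto_finsetSum _ fun a _ => (tendsto_integral_of_L2 (K.edgeMeasure_le a)
      (fun n => integrable_edgeMeasure a (hφ n).continuous)
      (integrable_edgeMeasure_of_memLp hg a) h3).const_mul _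
  have e5 := tendsto_nhds_unique (e2.congr e3) e4
  rw [← e5, ← ContinuousLinearMap.integral_comp_comm _ i1]
  refine integral_congr_ae ?_
  filter_upwards [hGG] with z hz
  rw [hz]; rfl

end PolygonalElement

/-! ### Edges shared by two elements. -/

namespace PolygonalElement

variable {K K' : PolygonalElement} {r r' : ℝ} {c c' : Plane}

/-- Equal edges coincide up to orientation. -/
theorem eq_or_reverse_of_edge_eq {a : Fin K.n} {b : Fin K'.n} (h : K.edge a = K'.edge b) :
    (K'.poly b = K.poly a ∧ K'.edgeVec b = K.edgeVec a) ∨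
      (K'.poly b = K.poly a + K.edgeVec a ∧ K'.edgeVec b = - K.edgeVec a) := by
  have r1 : K'.poly (finRotate K'.n b) = K'.poly b + K'.edgeVec b := by rw [edgeVec]; abel
  have r2 : K.poly (finRotate K.n a) = K.poly a + K.edgeVec a := by rw [edgeVec]; abel
  obtain ⟨s, hs, e1⟩ := K.mem_edge.1 (h ▸ K'.left_mem_edge b : K'.poly b ∈ K.edge a)
  obtain ⟨s', hs', e2⟩ := K.mem_edge.1 (h ▸ K'.right_mem_edge b : _ ∈ K.edge a)
  obtain ⟨t, ht, e3⟩ := K'.mem_edge.1 (h ▸ K.left_mem_edge a : K.poly a ∈ K'.edge b)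
  obtain ⟨t', ht', e4⟩ := K'.mem_edge.1 (h ▸ K.right_mem_edge a : _ ∈ K'.edge b)
  rw [r1] at e2
  rw [r2] at e4
  have f1 : K'.edgeVec b = (s' - s) • K.edgeVec a := by
    rw [← e1] at e2
    rw [sub_smul, eq_sub_iff_add_eq, add_comm]
    rw [add_assoc] at e2
    exact (add_left_cancel e2).symm
  have f2 : K.edgeVec a = (t' - t) • K'.edgeVec b := by
    rw [← e3] at e4
    rw [sub_smul, eq_sub_iff_add_eq, add_comm]
    rw [add_assoc] at e4
    exact (add_left_cancel e4).symm
  -- Both factors lie in `[-1, 1]`, so each is `1` or each is `-1`: the same or the reverse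
  -- orientation.
  have f3 : (t' - t) * (s' - s) = 1 := by
    rw [f1, smul_smul] at f2
    have : ((t' - t) * (s' - s) - 1) • K.edgeVec a = 0 := by
      rw [sub_smul, one_smul, ← f2, sub_self]
    exact sub_eq_zero.1 ((smul_eq_zero.1 this).resolve_right (K.edgeVec_ne_zero a))
  rcases lt_or_ge s s' with hlt | hle
  · have h1 : s' - s = 1 := by nlinarith [hs.1, hs'.2, ht.1, ht'.2, hs.2, hs'.1, ht.2, ht'.1]
    have h0 : s = 0 := by linarith [hs.1, hs'.2]
    left
    rw [f1, h1, one_smul, ← e1, h0, zero_smul, add_zero]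
    exact ⟨rfl, rfl⟩
  · have h1 : s' - s = -1 := by nlinarith [hs.1, hs'.2, ht.1, ht'.2, hs.2, hs'.1, ht.2, ht'.1]
    have h0 : s = 1 := by linarith [hs.2, hs'.1]
    right
    rw [f1, h1, neg_smul, one_smul, ← e1, h0, one_smul]
    exact ⟨rfl, rfl⟩

theorem edgeLength_eq_of_edge_eq {a : Fin K.n} {b : Fin K'.n} (h : K.edge a = K'.edge b) :
    K'.edgeLength b = K.edgeLength a := by
  rw [edgeLength_eq, edgeLength_eq]
  rcases eq_or_reverse_of_edge_eq h with ⟨-, e⟩ | ⟨-, e⟩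
  · rw [e]
  · rw [e, norm_neg]

theorem edgeMeasure_eq_of_edge_eq {a : Fin K.n} {b : Fin K'.n} (h : K.edge a = K'.edge b) :
    K'.edgeMeasure b = K.edgeMeasure a := by
  rw [edgeMeasure, edgeMeasure, edgeLength_eq_of_edge_eq h]
  congr 1
  rcases eq_or_reverse_of_edge_eq h with ⟨e1, e2⟩ | ⟨e1, e2⟩
  · congr 1
    ext1 s
    rw [edgePath_apply, edgePath_apply, e1, e2]
  · have hp : MeasurePreserving (fun s : ℝ => 1 - s) (volume.restrict (Icc (0 : ℝ) 1))
        (volume.restrict (Icc (0 : ℝ) 1)) := by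
      have := (Measure.measurePreserving_sub_left (volume : Measure ℝ) 1).restrict_preimage
        (measurableSet_Icc (a := (0 : ℝ)) (b := 1))
      simpa using this
    have hc : (K'.poly.edgePath ℝ b : ℝ → Plane) = K.poly.edgePath ℝ a ∘ fun s => 1 - s := by
      funext s
      rw [Function.comp, edgePath_apply, edgePath_apply, e1, e2]
      module
    rw [hc, ← Measure.map_map (K.measurable_edgePath a) hp.measurable, hp.map_eq]

theorem edge_injective {a b : Fin K.n} (h : K.edge a = K.edge b) : a = b := by
  have hh : (1 / 2 : ℝ) ∈ Ioo (0 : ℝ) 1 := by norm_num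
  exact K.edge_eq_of_mem (edge_point_mem hh) (h ▸ edge_point_mem hh) (edge_point_ne hh)

/-- Two star-shaped elements on the same side of a common edge overlap. -/
theorem IsStar.not_disjoint_of_same_side (h : K.IsStar c r) (h' : K'.IsStar c' r')
    {p τ : Plane} (hτ : τ ≠ 0)
    (hp : ∀ s ∈ Icc (0 : ℝ) 1, p + s • τ ∈ K.carrier ∧ p + s • τ ∈ K'.carrier)
    (hs : 0 < cross (c - p) τ * cross (c' - p) τ) :
    ¬ Disjoint K.openRegion K'.openRegion := by
  set H := cross (c - p) τ with hH
  set H' := cross (c' - p) τ with hH'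
  have hH0 : H ≠ 0 := fun e => by rw [e, zero_mul] at hs; exact hs.false
  have hH'0 : H' ≠ 0 := fun e => by rw [e, mul_zero] at hs; exact hs.false
  -- Scaled by each other's height over the edge line, the two centers have equal height, so their
  -- difference is a multiple `κ` of `τ`.
  have hcr : cross τ (|H'| • (c - p) - |H| • (c' - p)) = 0 := by
    rw [cross_sub_right, cross_smul_right, cross_smul_right, cross_comm τ, cross_comm τ, ← hH, ← hH']
    rcases pos_and_pos_or_neg_and_neg_of_mul_pos hs with ⟨h1, h2⟩ | ⟨h1, h2⟩
    · rw [abs_of_pos h1, abs_of_pos h2]; ring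
    · rw [abs_of_neg h1, abs_of_neg h2]; ring
  obtain ⟨κ, hκ⟩ := exists_smul_eq_of_cross_eq_zero hτ hcr
  -- Going from the midpoint of the edge towards `c` by the fraction `ε * |H'|`, and from the point
  -- with parameter `s' ε` towards `c'` by the fraction `ε * |H|`, leads to the same point, interior
  -- to both elements.
  let s' : ℝ → ℝ := fun ε => ((1 - ε * |H'|) / 2 + ε * κ) / (1 - ε * |H|)
  have hs'c : ContinuousAt s' 0 := ContinuousAt.div (by fun_prop) (by fun_prop) (by simp)
  have hs'0 : s' 0 = 1 / 2 := by simp [s']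
  have e1 : ∀ᶠ ε in 𝓝 (0 : ℝ), 0 < s' ε := hs'c.eventually (lt_mem_nhds (by rw [hs'0]; norm_num))
  have e2 : ∀ᶠ ε in 𝓝 (0 : ℝ), s' ε < 1 := hs'c.eventually (gt_mem_nhds (by rw [hs'0]; norm_num))
  have e3 : ∀ᶠ ε in 𝓝 (0 : ℝ), ε * |H'| < 1 :=
    (show ContinuousAt (fun ε : ℝ => ε * |H'|) 0 by fun_prop).eventually (gt_mem_nhds (by simp))
  have e4 : ∀ᶠ ε in 𝓝 (0 : ℝ), ε * |H| < 1 :=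
    (show ContinuousAt (fun ε : ℝ => ε * |H|) 0 by fun_prop).eventually (gt_mem_nhds (by simp))
  obtain ⟨ε, hε, h1, h2, h3, h4⟩ := ((eventually_mem_nhdsWithin (a := (0 : ℝ)) (s := Ioi 0)).and
    (nhdsWithin_le_nhds (e1.and (e2.and (e3.and e4))))).exists
  have hε : 0 < ε := hε
  have m1 := h.mem_interior (hp (1 / 2) (by norm_num)).1 (t := ε * |H'|)
    (mul_pos hε (abs_pos.2 hH'0)) h3.le
  have m2 := h'.mem_interior (hp (s' ε) ⟨h1.le, h2.le⟩).2 (t := ε * |H|)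
    (mul_pos hε (abs_pos.2 hH0)) h4.le
  refine Set.not_disjoint_iff.2 ⟨_, m1, ?_⟩
  convert m2 using 1
  have h5 : (1 - ε * |H|) * s' ε = (1 - ε * |H'|) / 2 + ε * κ := by
    simp only [s']
    rw [mul_div_cancel₀]
    linarith
  have h6 : ε • (|H'| • (c - p) - |H| • (c' - p)) = (ε * κ) • τ := by rw [hκ, smul_smul]
  have h7 : ((1 - ε * |H|) * s' ε) • τ = ((1 - ε * |H'|) / 2 + ε * κ) • τ := by rw [h5]
  have h8 : p + (1 / 2 : ℝ) • τ + (ε * |H'|) • (c - (p + (1 / 2 : ℝ) • τ)) -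
      (p + s' ε • τ + (ε * |H|) • (c' - (p + s' ε • τ))) =
      ε • (|H'| • (c - p) - |H| • (c' - p)) + ((1 - ε * |H'|) / 2) • τ -
        ((1 - ε * |H|) * s' ε) • τ := by module
  rw [← sub_eq_zero, h8, h6, h7]
  module

theorem normal_eq (K : PolygonalElement) (c : Plane) (a : Fin K.n) (e : Plane) :
    K.normal c a e = - (SignType.sign (cross (c - K.poly a) (K.edgeVec a)) *
      cross e (K.edgeVec a) / K.edgeLength a) := by
  rw [normal, ← neg_sub c, cross_neg_left, Left.sign_neg]
  push_cast
  ring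

/-- The centers of two nonoverlapping elements lie on opposite sides of a common edge. -/
theorem IsStar.cross_mul_cross_neg (h : K.IsStar c r) (h' : K'.IsStar c' r')
    (hd : Disjoint K.openRegion K'.openRegion) {a : Fin K.n} {b : Fin K'.n}
    (hab : K.edge a = K'.edge b) :
    cross (c - K.poly a) (K.edgeVec a) * cross (c' - K.poly a) (K.edgeVec a) < 0 := by
  have h1 : cross (c - K.poly a) (K.edgeVec a) ≠ 0 := by
    rw [← neg_sub, cross_neg_left, neg_ne_zero]; exact h.cross_ne_zero a
  have h2 : cross (c' - K.poly a) (K.edgeVec a) ≠ 0 := by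
    have h3 : cross (c' - K'.poly b) (K'.edgeVec b) ≠ 0 := by
      rw [← neg_sub, cross_neg_left, neg_ne_zero]; exact h'.cross_ne_zero b
    rcases eq_or_reverse_of_edge_eq hab with ⟨e1, e2⟩ | ⟨e1, e2⟩
    · rwa [e1, e2] at h3
    · rwa [e1, e2, cross_neg_right, neg_ne_zero, ← sub_sub, cross_sub_left, cross_self,
        sub_zero] at h3
  refine lt_of_le_of_ne (not_lt.1 fun hs => ?_) (mul_ne_zero h1 h2)
  refine h.not_disjoint_of_same_side h' (K.edgeVec_ne_zero a) (fun s hs => ?_) hs hd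
  have : K.poly a + s • K.edgeVec a ∈ K.edge a := K.mem_edge.2 ⟨s, hs, rfl⟩
  exact ⟨K.edge_subset_carrier a this, K'.edge_subset_carrier b (hab ▸ this)⟩

/-- The centers lie on opposite sides of the edge, so the orientation signs differ. Reversing the
edge vector changes both the sign and the cross product in `normal`, hence not their product. -/
theorem IsStar.normal_add_normal (h : K.IsStar c r) (h' : K'.IsStar c' r')
    (hd : Disjoint K.openRegion K'.openRegion) {a : Fin K.n} {b : Fin K'.n}
    (hab : K.edge a = K'.edge b) (e : Plane) : K.normal c a e + K'.normal c' b e = 0 := by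
  have hs := h.cross_mul_cross_neg h' hd hab
  have hsg : (SignType.sign (cross (c' - K.poly a) (K.edgeVec a)) : ℝ) =
      - SignType.sign (cross (c - K.poly a) (K.edgeVec a)) := by
    rcases mul_neg_iff.1 hs with ⟨h1, h2⟩ | ⟨h1, h2⟩
    · rw [sign_pos h1, sign_neg h2]; simp
    · rw [sign_pos h2, sign_neg h1]; simp
  rw [normal_eq, normal_eq, edgeLength_eq_of_edge_eq hab]
  rcases eq_or_reverse_of_edge_eq hab with ⟨e1, e2⟩ | ⟨e1, e2⟩
  · rw [e1, e2, hsg]; ring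
  · rw [e1, e2, ← sub_sub, cross_neg_right, cross_sub_left (c' - K.poly a), cross_self, sub_zero,
      cross_neg_right, Left.sign_neg]
    push_cast
    rw [hsg]
    ring

theorem IsStar.exists_normal_ne_zero (h : K.IsStar c r) (a : Fin K.n) :
    K.normal c a (K.poly a - c) ≠ 0 := by
  rw [normal]
  have h1 := h.cross_ne_zero a
  refine div_ne_zero (mul_ne_zero ?_ h1) (K.edgeLength_pos a).ne'
  rcases h1.lt_or_gt with h2 | h2
  · rw [sign_neg h2]; simp
  · rw [sign_pos h2]; simp

end PolygonalElement

/-! ### Integrals over a macroelement; constants belong to `N(M)`. -/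

open PolygonalElement

theorem IsWeakGradOn.mono {U V : Set Plane} {v : Plane → ℝ} {G : Plane → Plane}
    (h : IsWeakGradOn U v G) (hV : V ⊆ U) : IsWeakGradOn V v G := by
  refine ⟨h.1.mono_measure (Measure.restrict_mono hV le_rfl),
    h.2.1.mono_measure (Measure.restrict_mono hV le_rfl), fun φ h1 h2 h3 => ?_⟩
  have := h.2.2 φ h1 h2 (h3.trans hV)
  have s1 : tsupport (fun x => v x • ∇ φ x) ⊆ tsupport φ :=
    (closure_mono (Function.support_smul_subset_right v (∇ φ))).trans (tsupport_gradient_subset φ)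
  have s2 : tsupport (fun x => φ x • G x) ⊆ tsupport φ :=
    closure_mono (Function.support_smul_subset_left φ G)
  rwa [setIntegral_of_tsupport_subset (s1.trans (h3.trans hV)),
    setIntegral_of_tsupport_subset (s2.trans (h3.trans hV)),
    ← setIntegral_of_tsupport_subset (s1.trans h3),
    ← setIntegral_of_tsupport_subset (s2.trans h3)] at this

section Macro

variable {ι : Type*} {K : ι → PolygonalElement} {M : Finset ι} {c : ι → Plane} {r : ι → ℝ}

theorem isOpen_macroDomain : IsOpen (macroDomain K M) := isOpen_interior

theorem macroDomain_subset : macroDomain K M ⊆ ⋃ i ∈ M, (K i).carrier := interior_subset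

theorem isCompact_biUnion_carrier : IsCompact (⋃ i ∈ M, (K i).carrier) :=
  M.isCompact_biUnion fun i _ => (K i).isCompact

instance isFiniteMeasure_macroDomain : IsFiniteMeasure (volume.restrict (macroDomain K M)) :=
  ⟨by
    rw [Measure.restrict_apply_univ]
    exact (measure_mono macroDomain_subset).trans_lt isCompact_biUnion_carrier.measure_lt_top⟩

theorem macroDomain_ae_eq : macroDomain K M =ᵐ[volume] ⋃ i ∈ M, (K i).openRegion := by
  rw [ae_eq_set]
  constructor
  · refine measure_mono_null (t := ⋃ i ∈ M, frontier (K i).carrier) ?_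
      ((measure_biUnion_null_iff M.countable_toSet).2 fun i _ => (K i).volume_frontier)
    rintro z ⟨hz, hz'⟩
    obtain ⟨i, hi, hzi⟩ := mem_iUnion₂.1 (macroDomain_subset hz)
    refine mem_iUnion₂.2 ⟨i, hi, ?_⟩
    rw [← carrier_diff]
    exact ⟨hzi, fun h => hz' (mem_iUnion₂.2 ⟨i, hi, h⟩)⟩
  · have : (⋃ i ∈ M, (K i).openRegion) \ macroDomain K M = ∅ :=
      sdiff_eq_empty.2 (iUnion₂_subset fun i hi => openRegion_subset_macroDomain K M hi)
    rw [this]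
    exact measure_empty

theorem setIntegral_macroDomain (hd : ∀ i ∈ M, ∀ j ∈ M, i ≠ j →
      Disjoint (K i).openRegion (K j).openRegion) {f : Plane → ℝ}
    (hf : IntegrableOn f (macroDomain K M)) :
    ∫ z in macroDomain K M, f z = ∑ i ∈ M, ∫ z in (K i).openRegion, f z := by
  rw [setIntegral_congr_set macroDomain_ae_eq]
  exact integral_biUnion_finset M (fun i _ => (K i).measurableSet_openRegion)
    (fun i hi j hj hij => hd i hi j hj hij)
    fun i hi => hf.mono_set (openRegion_subset_macroDomain K M hi)

theorem ae_macroDomain {p : Plane → Prop}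
    (h : ∀ i ∈ M, ∀ᵐ z ∂(volume.restrict (K i).openRegion), p z) :
    ∀ᵐ z ∂(volume.restrict (macroDomain K M)), p z := by
  rw [Measure.restrict_congr_set macroDomain_ae_eq,
    ae_restrict_biUnion_finset_iff]
  exact h

/-- The gradient of a compactly supported smooth function has integral zero, and this survives the
`L²` limit. On each element `G` agrees with the global weak gradient. -/
theorem MemH10.sum_integral_eq_zero (hd : ∀ i ∈ M, ∀ j ∈ M, i ≠ j →
      Disjoint (K i).openRegion (K j).openRegion) {v : Plane → ℝ} (hv : MemH10 (macroDomain K M) v)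
    {G : Plane → Plane} (hG : ∀ i ∈ M, IsWeakGradOn (K i).openRegion v G) (k : Fin 2) :
    ∑ i ∈ M, ∫ z in (K i).openRegion, G z k = 0 := by
  obtain ⟨G', hG', φ, hφ, -, hlim⟩ := hv
  have hi : Integrable G' (volume.restrict (macroDomain K M)) := hG'.2.1.integrable (by norm_num)
  have e1 := tendsto_integral_of_L2 le_rfl
    (fun n => memLp_one_iff_integrable.1 (MemLp.mono_exponent
      (testFunctions.memLp_gradient (U := macroDomain K M) (hφ n)) (by norm_num))) hi hlim
  have e2 := ((EuclideanSpace.proj k : Plane →L[ℝ] ℝ).continuous.tendsto _).comp e1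
  have e3 : ∀ n, (EuclideanSpace.proj k : Plane →L[ℝ] ℝ) (∫ z in macroDomain K M, ∇ (φ n) z) = 0 := by
    intro n
    rw [setIntegral_of_tsupport_subset ((tsupport_gradient_subset _).trans (hφ n).2.2),
      ← ContinuousLinearMap.integral_comp_comm]
    · simp only [PiLp.proj_apply, gradient_apply]
      have := integral_mul_fderiv_eq_neg (φ := fun _ => 1) contDiff_const (hφ n).1 (hφ n).2.1
        (EuclideanSpace.single k 1)
      simpa using this
    · exact (continuous_gradient (hφ n).1).integrable_of_hasCompactSupport
        ((hφ n).2.1.mono' ((subset_tsupport _).trans (tsupport_gradient_subset _)))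
  have e4 := tendsto_nhds_unique (e2.congr e3) tendsto_const_nhds
  rw [← ContinuousLinearMap.integral_comp_comm _ hi] at e4
  have hik : Integrable (fun z => G' z k) (volume.restrict (macroDomain K M)) :=
    (EuclideanSpace.proj k : Plane →L[ℝ] ℝ).integrable_comp hi
  have e5 := setIntegral_macroDomain hd hik
  rw [← show ∫ z in macroDomain K M, G' z k = 0 from e4, e5]
  refine Finset.sum_congr rfl fun i hi => integral_congr_ae ?_
  have := (hG i hi).ae_eq (K i).isOpen_openRegion
    (hG'.mono (openRegion_subset_macroDomain K M hi)) EventuallyEq.rfl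
  filter_upwards [this] with z hz
  rw [hz]

/-- A sum over all edges in which the contributions of shared edges cancel. -/
theorem sum_edges_eq_zero (hst : ∀ i ∈ M, (K i).IsStar (c i) (r i))
    (hd : ∀ i ∈ M, ∀ j ∈ M, i ≠ j → Disjoint (K i).openRegion (K j).openRegion)
    (f : ∀ i, Fin (K i).n → ℝ)
    (h1 : ∀ i ∈ M, ∀ j ∈ M, i ≠ j → ∀ a b, (K i).edge a = (K j).edge b → f i a + f j b = 0)
    (h2 : ∀ i ∈ M, ∀ a, (∀ j ∈ M, j ≠ i → ∀ b, (K j).edge b ≠ (K i).edge a) → f i a = 0) :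
    ∑ i ∈ M, ∑ a, f i a = 0 := by
  classical
  rw [Finset.sum_sigma']
  let Q : (Σ i, Fin (K i).n) → (Σ i, Fin (K i).n) → Prop := fun p p' =>
    p'.1 ∈ M ∧ p'.1 ≠ p.1 ∧ (K p'.1).edge p'.2 = (K p.1).edge p.2
  have huniq : ∀ p p' p'', p.1 ∈ M → Q p p' → Q p p'' → p' = p'' := by
    rintro ⟨i, a⟩ ⟨j, b⟩ ⟨k, d⟩ hi ⟨hj, hji, e1⟩ ⟨hk, hki, e2⟩
    dsimp only at *
    -- Three elements cannot share an edge: their normals would be pairwise opposite, hence zero.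
    have hjk : j = k := by
      by_contra hjk
      have n1 := (hst i hi).normal_add_normal (hst j hj) (hd i hi j hj hji.symm) e1.symm
      have n2 := (hst i hi).normal_add_normal (hst k hk) (hd i hi k hk hki.symm) e2.symm
      have n3 := (hst j hj).normal_add_normal (hst k hk) (hd j hj k hk hjk) (e1.trans e2.symm)
      refine (hst i hi).exists_normal_ne_zero a ?_
      linarith [n1 ((K i).poly a - c i), n2 ((K i).poly a - c i), n3 ((K i).poly a - c i)]
    subst hjk
    rw [edge_injective (e1.trans e2.symm)]
  -- The involution that exchanges the two sides of a shared edge and fixes the other edges.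
  let g : (Σ i, Fin (K i).n) → (Σ i, Fin (K i).n) := fun p =>
    if h : ∃ p', Q p p' then h.choose else p
  have hg1 : ∀ p, (∃ p', Q p p') → Q p (g p) := fun p h => by
    simp only [g, dif_pos h]; exact h.choose_spec
  have hg2 : ∀ p, (¬ ∃ p', Q p p') → g p = p := fun p h => by simp only [g, dif_neg h]
  have hsymm : ∀ p p', p.1 ∈ M → Q p p' → Q p' p := fun p p' hp h => ⟨hp, h.2.1.symm, h.2.2.symm⟩
  refine Finset.sum_involution (fun p _ => g p) ?_ ?_ ?_ ?_
  · rintro ⟨i, a⟩ hp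
    have hi : i ∈ M := (Finset.mem_sigma.1 hp).1
    by_cases h : ∃ p', Q ⟨i, a⟩ p'
    · obtain ⟨hj, hji, e⟩ := hg1 _ h
      exact h1 i hi _ hj (Ne.symm hji) _ _ e.symm
    · have : f i a = 0 := h2 i hi a fun j hj hji b e => h ⟨⟨j, b⟩, hj, hji, e⟩
      dsimp only
      rw [hg2 _ h, this, add_zero]
  · rintro ⟨i, a⟩ hp hne heq
    have hi : i ∈ M := (Finset.mem_sigma.1 hp).1
    by_cases h : ∃ p', Q ⟨i, a⟩ p'
    · exact (hg1 _ h).2.1 (congrArg Sigma.fst heq)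
    · exact hne (h2 i hi a fun j hj hji b e => h ⟨⟨j, b⟩, hj, hji, e⟩)
  · intro p hp
    have hi : p.1 ∈ M := (Finset.mem_sigma.1 hp).1
    by_cases h : ∃ p', Q p p'
    · exact Finset.mem_sigma.2 ⟨(hg1 _ h).1, Finset.mem_univ _⟩
    · rwa [hg2 _ h]
  · intro p hp
    have hi : p.1 ∈ M := (Finset.mem_sigma.1 hp).1
    by_cases h : ∃ p', Q p p'
    · have hq := hg1 _ h
      exact huniq _ _ _ hq.1 (hg1 _ ⟨p, hsymm _ _ hi hq⟩) (hsymm _ _ hi hq)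
    · change g (g p) = p
      rw [hg2 _ h, hg2 _ h]

/-- Green's formula on each element. Opposite normals and equal edge integrals cancel on shared
edges, and the other edge integrals are zero. -/
theorem MemMacroVnc.sum_integral_eq_zero (hst : ∀ i ∈ M, (K i).IsStar (c i) (r i))
    (hd : ∀ i ∈ M, ∀ j ∈ M, i ≠ j → Disjoint (K i).openRegion (K j).openRegion)
    {v : Plane → ℝ} (hv : MemMacroVnc K M v)
    {G : Plane → Plane} (hG : ∀ i ∈ M, IsWeakGradOn (K i).openRegion v G) (k : Fin 2) :
    ∑ i ∈ M, ∫ z in (K i).openRegion, G z k = 0 := by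
  obtain ⟨-, -, g, hg, hj⟩ := hv
  rw [Finset.sum_congr rfl fun i hi => (hst i hi).green_trace (hg i hi) (hG i hi) k]
  refine sum_edges_eq_zero hst hd _ (fun i hi j hj' hij a b hab => ?_) fun i hi a ha => ?_
  · have h0 := (hj i hi a).1 j hj' hij.symm ⟨b, hab.symm⟩
    have hm := edgeMeasure_eq_of_edge_eq hab
    rw [integral_sub (integrable_edgeMeasure_of_memLp (hg i hi).1 a)
      (hm ▸ integrable_edgeMeasure_of_memLp (hg j hj').1 b)] at h0
    rw [hm]
    have hn := (hst i hi).normal_add_normal (hst j hj') (hd i hi j hj' hij) hab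
      (EuclideanSpace.single k 1)
    linear_combination (∫ z, g j z ∂(K i).edgeMeasure a) * hn +
      (K i).normal (c i) a (EuclideanSpace.single k 1) * h0
  · rw [(hj i hi a).2 ha, mul_zero]

theorem const_mem_macroN (hst : ∀ i ∈ M, (K i).IsStar (c i) (r i))
    (hd : ∀ i ∈ M, ∀ j ∈ M, i ≠ j → Disjoint (K i).openRegion (K j).openRegion)
    {q : MacroL2 K M} {t : ℝ} (hq : q =ᵐ[volume.restrict (macroDomain K M)] fun _ => t) :
    q ∈ macroN K M := by
  refine ⟨fun i hi => ⟨t, ae_mono (restrict_le K M hi) hq⟩, fun v₁ v₂ h₁ h₂ G₁ G₂ g₁ g₂ => ?_⟩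
  have e : ∀ i ∈ M, ∫ z in (K i).openRegion, (G₁ z 0 + G₂ z 1) * q z =
      t * (∫ z in (K i).openRegion, G₁ z 0) + t * ∫ z in (K i).openRegion, G₂ z 1 := by
    intro i hi
    have i1 : Integrable G₁ (volume.restrict (K i).openRegion) := (g₁ i hi).2.1.integrable (by norm_num)
    have i2 : Integrable G₂ (volume.restrict (K i).openRegion) := (g₂ i hi).2.1.integrable (by norm_num)
    have j1 : Integrable (fun z => G₁ z 0) (volume.restrict (K i).openRegion) :=
      (EuclideanSpace.proj 0 : Plane →L[ℝ] ℝ).integrable_comp i1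
    have j2 : Integrable (fun z => G₂ z 1) (volume.restrict (K i).openRegion) :=
      (EuclideanSpace.proj 1 : Plane →L[ℝ] ℝ).integrable_comp i2
    rw [← mul_add, ← integral_add j1 j2, ← integral_const_mul]
    refine integral_congr_ae ?_
    filter_upwards [ae_mono (restrict_le K M hi) hq] with z hz
    rw [hz, mul_comm]
  rw [divPairing, Finset.sum_congr rfl e, Finset.sum_add_distrib, ← Finset.mul_sum, ← Finset.mul_sum,
    h₁.sum_integral_eq_zero hst hd g₁, h₂.1.sum_integral_eq_zero hd g₂, mul_zero, add_zero]

end Macro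

/-! ### Nonconforming test functions and jumps across edges that are not horizontal. -/

theorem IsWeakGradOn.congr {U : Set Plane} {v v' : Plane → ℝ} {G G' : Plane → Plane}
    (h : IsWeakGradOn U v G) (hv : v =ᵐ[volume.restrict U] v') (hG : G =ᵐ[volume.restrict U] G') :
    IsWeakGradOn U v' G' := by
  refine ⟨h.1.ae_eq hv, h.2.1.ae_eq hG, fun φ h1 h2 h3 => ?_⟩
  have e1 : ∫ x in U, v' x • ∇ φ x = ∫ x in U, v x • ∇ φ x := by
    refine integral_congr_ae ?_
    filter_upwards [hv] with z hz
    rw [hz]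
  have e2 : ∫ x in U, φ x • G' x = ∫ x in U, φ x • G x := by
    refine integral_congr_ae ?_
    filter_upwards [hG] with z hz
    rw [hz]
  rw [e1, e2, h.2.2 φ h1 h2 h3]

theorem HasTrace.congr {K : PolygonalElement} {v v' g : Plane → ℝ} (h : HasTrace K v g)
    (hv : v =ᵐ[volume.restrict K.openRegion] v') : HasTrace K v' g := by
  obtain ⟨hg, G, hG, φ, hφ, ⟨h1, h2⟩, h3⟩ := h
  refine ⟨hg, G, hG.congr hv EventuallyEq.rfl, φ, hφ, ⟨?_, h2⟩, h3⟩
  refine h1.congr fun n => eLpNorm_congr_ae ?_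
  exact EventuallyEq.rfl.sub hv

theorem isWeakGradOn_zero (U : Set Plane) : IsWeakGradOn U 0 0 :=
  ⟨MemLp.zero, MemLp.zero, fun φ _ _ _ => by simp⟩

theorem hasTrace_zero (K : PolygonalElement) : HasTrace K 0 0 := by
  refine ⟨MemLp.zero, 0, isWeakGradOn_zero _, fun _ => 0, fun _ => contDiff_const, ⟨?_, ?_⟩, ?_⟩
  · simp
  · have : ∇ (0 : Plane → ℝ) = 0 := by
      ext z k; rw [gradient_apply]; simp
    simp [this]
  · simp

section Macro

variable {ι : Type*} {K : ι → PolygonalElement} {M : Finset ι} {c : ι → Plane} {r : ι → ℝ}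

theorem memMacroVc_zero : MemMacroVc K M 0 := by
  refine ⟨⟨0, isWeakGradOn_zero _, fun _ => 0, fun _ => ⟨contDiff_const, HasCompactSupport.zero, ?_⟩, ?_, ?_⟩,
    fun i _ => ⟨⟨0, isWeakGradOn_zero _, fun φ _ _ _ => by simp⟩, 0, hasTrace_zero _,
      continuousOn_const, fun a => ⟨0, fun z _ => by simp⟩⟩⟩
  · simp [tsupport]
  · simp
  · have : ∇ (0 : Plane → ℝ) = 0 := by
      ext z k; rw [gradient_apply]; simp
    simp [this]

variable (K M) in
/-- The function that equals `u i` on the `i`-th open element. -/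
def glue {E : Type*} [AddCommMonoid E] (u : ι → Plane → E) : Plane → E :=
  fun z => ∑ i ∈ M, (K i).openRegion.indicator (u i) z

theorem glue_eq {E : Type*} [AddCommMonoid E] (hd : ∀ i ∈ M, ∀ j ∈ M, i ≠ j →
      Disjoint (K i).openRegion (K j).openRegion) (u : ι → Plane → E) {i : ι} (hi : i ∈ M)
    {z : Plane} (hz : z ∈ (K i).openRegion) : glue K M u z = u i z := by
  rw [glue, Finset.sum_eq_single_of_mem i hi, indicator_of_mem hz]
  intro j hj hji
  exact indicator_of_notMem (fun h => Set.disjoint_left.1 (hd i hi j hj hji.symm) hz h) _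

theorem glue_ae_eq {E : Type*} [AddCommMonoid E] (hd : ∀ i ∈ M, ∀ j ∈ M, i ≠ j →
      Disjoint (K i).openRegion (K j).openRegion) (u : ι → Plane → E) {i : ι} (hi : i ∈ M) :
    u i =ᵐ[volume.restrict (K i).openRegion] glue K M u := by
  filter_upwards [ae_restrict_mem (K i).measurableSet_openRegion] with z hz
  exact (glue_eq hd u hi hz).symm

theorem memLp_indicator_openRegion {E : Type*} [NormedAddCommGroup E] {u : Plane → E} {i : ι}
    (hi : i ∈ M) (hu : MemLp u 2 (volume.restrict (K i).openRegion)) :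
    MemLp ((K i).openRegion.indicator u) 2 (volume.restrict (macroDomain K M)) := by
  rwa [memLp_indicator_iff_restrict (K i).measurableSet_openRegion,
    Measure.restrict_restrict_of_subset (openRegion_subset_macroDomain K M hi)]

theorem memLp_glue {E : Type*} [NormedAddCommGroup E] {u : ι → Plane → E}
    (hu : ∀ i ∈ M, MemLp (u i) 2 (volume.restrict (K i).openRegion)) :
    MemLp (glue K M u) 2 (volume.restrict (macroDomain K M)) :=
  memLp_finsetSum _ fun i hi => memLp_indicator_openRegion hi (hu i hi)

/-- Pairwise opposite normals of three different elements would vanish. -/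
theorem eq_of_shared_edge (hst : ∀ i ∈ M, (K i).IsStar (c i) (r i))
    (hd : ∀ i ∈ M, ∀ j ∈ M, i ≠ j → Disjoint (K i).openRegion (K j).openRegion)
    {i j k : ι} (hi : i ∈ M) (hj : j ∈ M) (hk : k ∈ M) (hij : i ≠ j) {a : Fin (K i).n}
    {b : Fin (K j).n} {d : Fin (K k).n} (e1 : (K i).edge a = (K j).edge b)
    (e2 : (K i).edge a = (K k).edge d) : k = i ∨ k = j := by
  by_contra! hne
  have n1 := (hst i hi).normal_add_normal (hst j hj) (hd i hi j hj hij) e1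
  have n2 := (hst i hi).normal_add_normal (hst k hk) (hd i hi k hk hne.1.symm) e2
  have n3 := (hst j hj).normal_add_normal (hst k hk) (hd j hj k hk hne.2.symm) (e1.symm.trans e2)
  refine (hst i hi).exists_normal_ne_zero a ?_
  linarith [n1 ((K i).poly a - c i), n2 ((K i).poly a - c i), n3 ((K i).poly a - c i)]

/-- Functions of `V_nc(M)` with mean value one over a single edge shared by two elements. -/
theorem exists_memMacroVnc (hst : ∀ i ∈ M, (K i).IsStar (c i) (r i))
    (hd : ∀ i ∈ M, ∀ j ∈ M, i ≠ j → Disjoint (K i).openRegion (K j).openRegion)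
    {i₀ j₀ : ι} (hi₀ : i₀ ∈ M) (hj₀ : j₀ ∈ M) (hij : i₀ ≠ j₀) {a₀ : Fin (K i₀).n}
    {b₀ : Fin (K j₀).n} (he : (K i₀).edge a₀ = (K j₀).edge b₀) :
    ∃ v G, MemMacroVnc K M v ∧ (∀ i ∈ M, IsWeakGradOn (K i).openRegion v G) ∧
      (∫ z in (K i₀).openRegion, G z 0 =
        (K i₀).normal (c i₀) a₀ (EuclideanSpace.single 0 1)) ∧
      (∫ z in (K j₀).openRegion, G z 0 =
        (K j₀).normal (c j₀) b₀ (EuclideanSpace.single 0 1)) ∧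
      ∀ k ∈ M, k ≠ i₀ → k ≠ j₀ → ∫ z in (K k).openRegion, G z 0 = 0 := by
  classical
  -- Edge integral one on the chosen edge, from both sides, and zero on all other edges; the jump
  -- conditions are then automatic.
  let t : ∀ i, Fin (K i).n → ℝ := fun i a => if (K i).edge a = (K i₀).edge a₀ then 1 else 0
  have hex : ∀ i, ∃ u : SobolevTriple (volume.restrict (K i).openRegion) (K i).boundaryMeasure,
      i ∈ M → u ∈ (K i).H1 ∧ (∃ d, HasNormalDeriv (K i) u.snd.fst d) ∧
        ∀ a, (K i).edgeIntegral a u.snd.snd = t i a := by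
    intro i
    by_cases hi : i ∈ M
    · obtain ⟨u, h⟩ := (hst i hi).exists_neumann (t i)
      exact ⟨u, fun _ => h⟩
    · exact ⟨0, fun h => absurd h hi⟩
  choose u hu using hex
  have hw : ∀ i ∈ M, IsWeakGradOn (K i).openRegion (u i).fst (u i).snd.fst := fun i hi =>
    isWeakGradOn_of_mem_sobolevClosure (hu i hi).1
  have hv := fun i (hi : i ∈ M) => glue_ae_eq hd (fun i => ((u i).fst : Plane → ℝ)) hi
  have hG := fun i (hi : i ∈ M) => glue_ae_eq hd (fun i => ((u i).snd.fst : Plane → Plane)) hi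
  set v := glue K M fun i => ((u i).fst : Plane → ℝ) with hvd
  set G := glue K M fun i => ((u i).snd.fst : Plane → Plane) with hGd
  have hwG : ∀ i ∈ M, IsWeakGradOn (K i).openRegion v G := fun i hi =>
    (hw i hi).congr (hv i hi) (hG i hi)
  have htr : ∀ i ∈ M, HasTrace (K i) v (u i).snd.snd := fun i hi =>
    (hasTrace_of_mem_H1 (hu i hi).1).congr (hv i hi)
  have hint : ∀ i ∈ M, ∫ z in (K i).openRegion, G z 0 =
      ∑ a, (K i).normal (c i) a (EuclideanSpace.single 0 1) * t i a := by
    intro i hi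
    rw [(hst i hi).green_trace (htr i hi) (hwG i hi)]
    refine Finset.sum_congr rfl fun a _ => ?_
    rw [← edgeIntegral_apply, (hu i hi).2.2]
  refine ⟨v, G, ⟨memLp_glue fun i hi => (hw i hi).1, fun i hi => ?_, fun i => (u i).snd.snd, htr,
    fun i hi a => ⟨fun j hj hji hb => ?_, fun hj => ?_⟩⟩, hwG, ?_, ?_, fun k hk hki hkj => ?_⟩
  · obtain ⟨d, hd'⟩ := (hu i hi).2.1
    exact ⟨_, (hw i hi).congr (hv i hi) EventuallyEq.rfl, (PolygonalElement.HasNormalDeriv.isWeaklyHarmonic hd'), d, hd'⟩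
  · obtain ⟨b, hb⟩ := hb
    have hm := edgeMeasure_eq_of_edge_eq hb
    rw [integral_sub (integrable_edgeMeasure_of_memLp (Lp.memLp _) a)
      (hm ▸ integrable_edgeMeasure_of_memLp (Lp.memLp _) b), ← edgeIntegral_apply, (hu i hi).2.2,
      hm, ← edgeIntegral_apply, (hu j hj).2.2, sub_eq_zero]
    simp only [t, hb]
  · rw [← edgeIntegral_apply, (hu i hi).2.2]
    refine if_neg fun e => ?_
    by_cases hi0 : i = i₀
    · subst hi0
      exact hj j₀ hj₀ hij.symm b₀ (he.symm.trans e.symm)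
    · exact hj i₀ hi₀ (Ne.symm hi0) a₀ e.symm
  · rw [hint i₀ hi₀, Finset.sum_eq_single a₀]
    · simp [t]
    · intro a _ ha
      rw [show t i₀ a = 0 from if_neg fun e => ha (edge_injective e), mul_zero]
    · simp
  · rw [hint j₀ hj₀, Finset.sum_eq_single b₀]
    · simp [t, he]
    · intro a _ ha
      rw [show t j₀ a = 0 from if_neg fun e => ha (edge_injective (e.trans he)), mul_zero]
    · simp
  · rw [hint k hk]
    refine Finset.sum_eq_zero fun a _ => ?_
    rw [show t k a = 0 from if_neg fun e => ?_, mul_zero]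
    rcases eq_of_shared_edge hst hd hi₀ hj₀ hk hij he e.symm with h | h
    · exact hki h
    · exact hkj h

theorem setIntegral_mul_const {q : Plane → ℝ} {s : ℝ} {U : Set Plane} {f : Plane → ℝ}
    (hq : q =ᵐ[volume.restrict U] fun _ => s) :
    ∫ z in U, f z * q z = s * ∫ z in U, f z := by
  rw [← integral_const_mul]
  refine integral_congr_ae ?_
  filter_upwards [hq] with z hz
  rw [hz, mul_comm]

/-- The values of `q ∈ N(M)` agree across a shared edge that is not horizontal. -/
theorem eq_of_mem_macroN (hst : ∀ i ∈ M, (K i).IsStar (c i) (r i))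
    (hd : ∀ i ∈ M, ∀ j ∈ M, i ≠ j → Disjoint (K i).openRegion (K j).openRegion)
    {q : MacroL2 K M} (hq : q ∈ macroN K M) {s : ι → ℝ}
    (hs : ∀ i ∈ M, q =ᵐ[volume.restrict (K i).openRegion] fun _ => s i)
    {i j : ι} (hi : i ∈ M) (hj : j ∈ M) {a : Fin (K i).n}
    {b : Fin (K j).n} (he : (K i).edge a = (K j).edge b) (hne : (K i).edgeVec a 1 ≠ 0) :
    s i = s j := by
  by_cases hij : i = j
  · rw [hij]
  obtain ⟨v, G, hv, hG, hGi, hGj, hGk⟩ := exists_memMacroVnc hst hd hi hj hij he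
  have h0 := hq.2 v 0 hv memMacroVc_zero G 0 hG fun _ _ => isWeakGradOn_zero _
  rw [divPairing] at h0
  simp only [Pi.zero_apply, PiLp.zero_apply, add_zero] at h0
  rw [Finset.sum_congr rfl fun k hk => setIntegral_mul_const (hs k hk),
    Finset.sum_eq_add_of_mem i j hi hj hij (fun k hk hkk => by
      rw [hGk k hk hkk.1 hkk.2, mul_zero]), hGi, hGj] at h0
  have hn := (hst i hi).normal_add_normal (hst j hj) (hd i hi j hj hij) he (EuclideanSpace.single 0 1)
  -- Only the two elements at the edge contribute to the pairing, with opposite normals. The first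
  -- normal component is, up to a nonzero factor, the second coordinate of the edge vector.
  have h1 : (s i - s j) * (K i).normal (c i) a (EuclideanSpace.single 0 1) = 0 := by
    linear_combination h0 - s j * hn
  refine sub_eq_zero.1 ((mul_eq_zero.1 h1).resolve_right ?_)
  rw [normal]
  have h2 := (hst i hi).cross_ne_zero a
  refine div_ne_zero (mul_ne_zero ?_ ?_) ((K i).edgeLength_pos a).ne'
  · rcases h2.lt_or_gt with h3 | h3
    · rw [sign_neg h3]; simp
    · rw [sign_pos h3]; simp
  · simpa [cross] using hne

end Macro

/-! ### Edges at a vertex, seen from that vertex. -/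

namespace PolygonalElement

variable {K : PolygonalElement} {c x z : Plane} {r : ℝ}

theorem poly_add_edgeVec (a : Fin K.n) : K.poly a + K.edgeVec a = K.poly (finRotate K.n a) := by
  rw [edgeVec]; abel

theorem IsVertex.exists_edge (h : K.IsVertex z) : ∃ a, z ∈ K.edge a := by
  obtain ⟨a, rfl⟩ := h
  exact ⟨a, K.left_mem_edge a⟩

theorem IsVertex.mem_carrier (h : K.IsVertex z) : z ∈ K.carrier := by
  obtain ⟨a, ha⟩ := h.exists_edge
  exact K.edge_subset_carrier a ha

theorem isVertex_of_edge_eq {K' : PolygonalElement} {a : Fin K.n} {b : Fin K'.n}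
    (h : K.edge a = K'.edge b) (hz : K.IsVertex z) (hza : z ∈ K.edge a) : K'.IsVertex z := by
  rcases eq_or_reverse_of_edge_eq h with ⟨e1, e2⟩ | ⟨e1, e2⟩ <;>
    rcases K.eq_or_eq_of_isVertex hz hza with rfl | rfl
  · exact ⟨b, e1⟩
  · exact ⟨finRotate K'.n b, by rw [← poly_add_edgeVec, ← poly_add_edgeVec, e1, e2]⟩
  · exact ⟨finRotate K'.n b, by rw [← poly_add_edgeVec, e1, e2]; abel⟩
  · exact ⟨b, by rw [← poly_add_edgeVec, e1]⟩

theorem IsStar.mono (h : K.IsStar c r) {c' : Plane} {r' : ℝ} (hr : 0 < r')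
    (hd : dist c' c + r' ≤ r) : K.IsStar c' r' :=
  ⟨hr, fun y hy => h.2 y (by
    rw [Metric.mem_ball] at hy ⊢
    have := dist_triangle y c' c
    linarith)⟩

/-- The center of the ball can be chosen off a given horizontal line. -/
theorem IsStar.exists_ne (h : K.IsStar c r) (t : ℝ) : ∃ c' r', K.IsStar c' r' ∧ c' 1 ≠ t := by
  by_cases hc : c 1 = t
  · refine ⟨c + EuclideanSpace.single 1 (r / 2), r / 2, h.mono (half_pos h.1) ?_, ?_⟩
    · have : ‖(EuclideanSpace.single 1 (r / 2) : Plane)‖ = r / 2 := by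
        rw [PiLp.norm_single, Real.norm_of_nonneg (half_pos h.1).le]
      rw [dist_eq_norm, add_sub_cancel_left, this]
      linarith
    · have := h.1
      simp only [PiLp.add_apply, PiLp.single_apply, if_true, hc]
      intro h0
      linarith
  · exact ⟨c, r, h, hc⟩

variable (K x) in
/-- The vector from the vertex `x` to the other end point of the edge `a`. -/
def spoke (a : Fin K.n) : Plane :=
  open Classical in if K.poly a = x then K.edgeVec a else -K.edgeVec a

theorem spoke_eq_or (a : Fin K.n) : K.spoke x a = K.edgeVec a ∨ K.spoke x a = -K.edgeVec a := by
  rw [spoke]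
  split_ifs <;> simp

theorem spoke_ne_zero (a : Fin K.n) : K.spoke x a ≠ 0 := by
  have := K.edgeVec_ne_zero a
  rcases K.spoke_eq_or (x := x) a with h | h <;> rw [h]
  · exact this
  · exact neg_ne_zero.2 this

theorem cross_spoke_mul (a : Fin K.n) (u v : Plane) :
    cross u (K.spoke x a) * cross v (K.spoke x a) =
      cross u (K.edgeVec a) * cross v (K.edgeVec a) := by
  rcases K.spoke_eq_or (x := x) a with h | h <;> rw [h]
  simp [cross_neg_right]

theorem eq_endpoint (hx : K.IsVertex x) {a : Fin K.n} (hxa : x ∈ K.edge a) :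
    (x = K.poly a ∧ K.spoke x a = K.edgeVec a) ∨
      (x = K.poly a + K.edgeVec a ∧ K.spoke x a = -K.edgeVec a) := by
  rcases K.eq_or_eq_of_isVertex hx hxa with h | h
  · exact Or.inl ⟨h, if_pos h.symm⟩
  · refine Or.inr ⟨by rw [h, poly_add_edgeVec], if_neg fun h' => ?_⟩
    rw [← poly_add_edgeVec, ← h', left_eq_add] at h
    exact K.edgeVec_ne_zero a h

theorem mem_edge_iff_spoke (hx : K.IsVertex x) {a : Fin K.n} (hxa : x ∈ K.edge a) :
    z ∈ K.edge a ↔ ∃ s ∈ Icc (0 : ℝ) 1, x + s • K.spoke x a = z := by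
  rw [K.mem_edge]
  rcases eq_endpoint hx hxa with ⟨h1, h2⟩ | ⟨h1, h2⟩
  · rw [h2, ← h1]
  · rw [h2]
    constructor
    · rintro ⟨s, hs, rfl⟩
      refine ⟨1 - s, ⟨by linarith [hs.2], by linarith [hs.1]⟩, ?_⟩
      rw [h1]; module
    · rintro ⟨s, hs, rfl⟩
      refine ⟨1 - s, ⟨by linarith [hs.2], by linarith [hs.1]⟩, ?_⟩
      rw [h1]; module

theorem isVertex_add_spoke (hx : K.IsVertex x) {a : Fin K.n} (hxa : x ∈ K.edge a) :
    K.IsVertex (x + K.spoke x a) := by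
  rcases eq_endpoint hx hxa with ⟨h1, h2⟩ | ⟨h1, h2⟩
  · exact ⟨finRotate K.n a, by rw [h2, h1, ← poly_add_edgeVec]⟩
  · exact ⟨a, by rw [h2, h1]; abel⟩

theorem cross_sub_spoke (hx : K.IsVertex x) {a : Fin K.n} (hxa : x ∈ K.edge a) (c : Plane) :
    cross (c - x) (K.edgeVec a) = cross (c - K.poly a) (K.edgeVec a) := by
  rcases eq_endpoint hx hxa with ⟨h1, -⟩ | ⟨h1, -⟩ <;> rw [h1]
  rw [← sub_sub, cross_sub_left _ (K.edgeVec a), cross_self, sub_zero]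

theorem not_isVertex_spoke (hx : K.IsVertex x) {a : Fin K.n} (hxa : x ∈ K.edge a) {s : ℝ}
    (hs : s ∈ Ioo (0 : ℝ) 1) : ¬ K.IsVertex (x + s • K.spoke x a) := by
  rcases eq_endpoint hx hxa with ⟨h1, h2⟩ | ⟨h1, h2⟩
  · rw [h2, h1]
    exact edge_point_ne hs
  · have : x + s • K.spoke x a = K.poly a + (1 - s) • K.edgeVec a := by
      rw [h2, h1]; module
    rw [this]
    exact edge_point_ne ⟨by linarith [hs.2], by linarith [hs.1]⟩

end PolygonalElement

/-! ### Local structure of the mesh around an interior vertex. -/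

namespace PolygonalMesh

variable {ι : Type*} [Fintype ι] {Ω : Set Plane} {P : PolygonalMesh ι Ω} {x z : Plane} {i j : ι}

theorem exists_isStar {ρ : ℝ} (hP : P.IsRegular ρ) (i : ι) : ∃ c r, (P.elem i).IsStar c r := by
  obtain ⟨c, hc⟩ := (hP.2 i).2
  refine ⟨c, _, mul_pos hP.1 ?_, hc⟩
  have a : Fin (P.elem i).n := ⟨0, by have := (P.elem i).three_le; omega⟩
  refine ((P.elem i).edgeLength_pos a).trans_le ?_
  exact Metric.dist_le_diam_of_mem (P.elem i).isCompact.isBounded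
    ((P.elem i).edge_subset_carrier a ((P.elem i).left_mem_edge a))
    ((P.elem i).edge_subset_carrier a ((P.elem i).right_mem_edge a))

/-- Conformity excludes hanging nodes: a common point is a vertex of both elements or lies on a
common edge, where a vertex can only be an end point. -/
theorem isVertex_of_mem (hi : (P.elem i).IsVertex z) (hj : z ∈ (P.elem j).carrier) :
    (P.elem j).IsVertex z := by
  by_cases hij : i = j
  · rwa [← hij]
  rcases P.conforming i j hij z ⟨hi.mem_carrier, hj⟩ with h | ⟨a, b, e, ha⟩
  · exact h.2
  · exact isVertex_of_edge_eq e hi ha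

theorem not_mem_openRegion_of_mem_edge {a : Fin (P.elem i).n} (hi : z ∈ (P.elem i).edge a) :
    z ∉ (P.elem j).openRegion := by
  intro hj
  by_cases hij : i = j
  · subst hij
    exact not_mem_edge_of_mem_openRegion hj a hi
  rcases P.conforming i j hij z ⟨(P.elem i).edge_subset_carrier a hi, (P.elem j).openRegion_subset hj⟩
    with ⟨-, h⟩ | ⟨a, b, e, ha⟩
  · obtain ⟨b, hb⟩ := h.exists_edge
    exact not_mem_edge_of_mem_openRegion hj b hb
  · exact not_mem_edge_of_mem_openRegion hj b (e ▸ ha)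

theorem edge_eq_of_mem {a : Fin (P.elem i).n} {b : Fin (P.elem j).n} (hi : z ∈ (P.elem i).edge a)
    (hz : ¬ (P.elem i).IsVertex z) (hj : z ∈ (P.elem j).edge b) :
    (P.elem i).edge a = (P.elem j).edge b := by
  by_cases hij : i = j
  · subst hij
    rw [(P.elem i).edge_eq_of_mem hi hj hz]
  have hz' : ¬ (P.elem j).IsVertex z := fun h =>
    hz (isVertex_of_mem h ((P.elem i).edge_subset_carrier a hi))
  rcases P.conforming i j hij z ⟨(P.elem i).edge_subset_carrier a hi,
    (P.elem j).edge_subset_carrier b hj⟩ with h | ⟨a', b', e, ha⟩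
  · exact absurd h.1 hz
  · rw [(P.elem i).edge_eq_of_mem hi ha hz, (P.elem j).edge_eq_of_mem hj (e ▸ ha) hz', e]

theorem mem_vertexPatch : i ∈ P.vertexPatch x ↔ (P.elem i).IsVertex x := by
  simp [vertexPatch]

/-- `ε` is so small that the ball of radius `ε` around the vertex `x` lies in the domain and only
meets those elements, edges and vertices that it has to meet. -/
structure IsSmallRadius (P : PolygonalMesh ι Ω) (x : Plane) (ε : ℝ) : Prop where
  pos : 0 < ε
  subset : Metric.ball x ε ⊆ ⋃ i, (P.elem i).carrier
  isVertex_of_carrier : ∀ i, ∀ z ∈ Metric.ball x ε, z ∈ (P.elem i).carrier → (P.elem i).IsVertex x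
  mem_edge : ∀ i a, ∀ z ∈ Metric.ball x ε, z ∈ (P.elem i).edge a → x ∈ (P.elem i).edge a
  eq_of_isVertex : ∀ i, ∀ z ∈ Metric.ball x ε, (P.elem i).IsVertex z → z = x

/-- Finitely many closed sets (elements, edges, vertices) that do not contain `x` all miss some ball
around it, and openness of `Ω` keeps the ball covered by elements. -/
theorem exists_isSmallRadius (hΩ : IsOpen Ω) (hx : P.IsInteriorVertex x) :
    ∃ ε, P.IsSmallRadius x ε := by
  obtain ⟨⟨i₀, hi₀⟩, hxΩ⟩ := hx
  have aux : ∀ s : Set Plane, IsClosed s → ∀ᶠ z in 𝓝 x, z ∈ s → x ∈ s := by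
    intro s hs
    by_cases h : x ∈ s
    · exact Eventually.of_forall fun _ _ => h
    · filter_upwards [hs.isOpen_compl.mem_nhds h] with z hz hz'
      exact absurd hz' hz
  have h1 : ∀ᶠ z in 𝓝 x, z ∈ Ω := hΩ.mem_nhds hxΩ
  have h2 : ∀ᶠ z in 𝓝 x, ∀ i, z ∈ (P.elem i).carrier → x ∈ (P.elem i).carrier :=
    eventually_all.2 fun i => aux _ (P.elem i).isCompact.isClosed
  have h3 : ∀ᶠ z in 𝓝 x, ∀ i a, z ∈ (P.elem i).edge a → x ∈ (P.elem i).edge a :=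
    eventually_all.2 fun i => eventually_all.2 fun a => aux _ ((P.elem i).isCompact_edge a).isClosed
  have h4 : ∀ᶠ z in 𝓝 x, ∀ i (a : Fin (P.elem i).n),
      z ∈ ({(P.elem i).poly a} : Set Plane) → x ∈ ({(P.elem i).poly a} : Set Plane) :=
    eventually_all.2 fun i => eventually_all.2 fun a => aux _ isClosed_singleton
  obtain ⟨ε, hε, h⟩ := Metric.eventually_nhds_iff_ball.1 (h1.and (h2.and (h3.and h4)))
  refine ⟨ε, hε, fun z hz => ?_, fun i z hz hzi => ?_, fun i a z hz => (h z hz).2.2.1 i a,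
    fun i z hz hzi => ?_⟩
  · rw [← P.closure_eq]
    exact subset_closure (h z hz).1
  · exact isVertex_of_mem hi₀ ((h z hz).2.1 i hzi)
  · obtain ⟨a, ha⟩ := hzi
    have := (h z hz).2.2.2 i a ha.symm
    rw [mem_singleton_iff] at this
    rw [this, ha]

namespace IsSmallRadius

variable {ε : ℝ}

theorem exists_mem (hε : P.IsSmallRadius x ε) (hz : z ∈ Metric.ball x ε) :
    ∃ i ∈ P.vertexPatch x, z ∈ (P.elem i).carrier := by
  obtain ⟨i, hi⟩ := mem_iUnion.1 (hε.subset hz)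
  exact ⟨i, mem_vertexPatch.2 (hε.isVertex_of_carrier i z hz hi), hi⟩

/-- Every edge at the interior vertex `x` is shared by two elements. -/
theorem exists_neighbour (hε : P.IsSmallRadius x ε) (hi : (P.elem i).IsVertex x) {a : Fin (P.elem i).n}
    (hxa : x ∈ (P.elem i).edge a) :
    ∃ j, (P.elem j).IsVertex x ∧ j ≠ i ∧ ∃ b, (P.elem i).edge a = (P.elem j).edge b := by
  obtain ⟨s, hs, hsb⟩ : ∃ s ∈ Ioo (0 : ℝ) 1, x + s • (P.elem i).spoke x a ∈ Metric.ball x ε := by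
    have h1 : ∀ᶠ s : ℝ in 𝓝 0, x + s • (P.elem i).spoke x a ∈ Metric.ball x ε := by
      have : Tendsto (fun s : ℝ => x + s • (P.elem i).spoke x a) (𝓝 0) (𝓝 (x + (0 : ℝ) • (P.elem i).spoke x a)) :=
        Continuous.tendsto (by fun_prop) 0
      rw [zero_smul, add_zero] at this
      exact this.eventually (Metric.ball_mem_nhds x hε.pos)
    obtain ⟨s, h1, h2⟩ := ((h1.filter_mono nhdsWithin_le_nhds).and
      (Ioo_mem_nhdsGT (zero_lt_one' ℝ))).exists
    exact ⟨s, h2, h1⟩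
  obtain ⟨z, hz⟩ : ∃ z, z = x + s • (P.elem i).spoke x a := ⟨_, rfl⟩
  have hza : z ∈ (P.elem i).edge a :=
    (mem_edge_iff_spoke hi hxa).2 ⟨s, ⟨hs.1.le, hs.2.le⟩, hz.symm⟩
  have hzv : ¬ (P.elem i).IsVertex z := hz ▸ not_isVertex_spoke hi hxa hs
  rw [← hz] at hsb
  -- As a frontier point of the element `i`, `z` is a limit of points outside it. Near `x` these lie
  -- in other elements, whose finite union is closed.
  have hcl : z ∈ ⋃ j ∈ {j : ι | j ≠ i}, (P.elem j).carrier := by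
    have hc : IsClosed (⋃ j ∈ {j : ι | j ≠ i}, (P.elem j).carrier) :=
      (Set.toFinite _).isClosed_biUnion fun j _ => (P.elem j).isCompact.isClosed
    rw [← hc.closure_eq]
    have hzf := (P.elem i).edge_subset_frontier a hza
    rw [frontier_eq_closure_inter_closure] at hzf
    rw [_root_.mem_closure_iff_nhds]
    intro t ht
    obtain ⟨w, ⟨hw1, hw2⟩, hw3⟩ := _root_.mem_closure_iff_nhds.1 hzf.2 _
      (inter_mem ht (Metric.isOpen_ball.mem_nhds hsb))
    obtain ⟨j, hj⟩ := mem_iUnion.1 (hε.subset hw2)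
    refine ⟨w, hw1, mem_iUnion₂.2 ⟨j, fun h => hw3 (h ▸ hj), hj⟩⟩
  obtain ⟨j, hji, hzj⟩ := mem_iUnion₂.1 hcl
  rcases P.conforming i j (Ne.symm hji) z ⟨(P.elem i).edge_subset_carrier a hza, hzj⟩ with
    h | ⟨a', b, e, ha⟩
  · exact absurd h.1 hzv
  · obtain rfl := (P.elem i).edge_eq_of_mem hza ha hzv
    exact ⟨j, isVertex_of_edge_eq e hi hxa, hji, b, e⟩

/-- Two elements at `x` that meet a convex part of a small punctured ball around `x` are connected
through edges at `x` that meet it. -/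
theorem exists_edge_of_ne (hε : P.IsSmallRadius x ε) {s : ι → ℝ} {U : Set Plane}
    (hU : U ⊆ Metric.ball x ε) (hc : Convex ℝ U) (hxU : x ∉ U) (hi : (P.elem i).IsVertex x) (hj : (P.elem j).IsVertex x)
    (hiU : (U ∩ (P.elem i).carrier).Nonempty) (hjU : (U ∩ (P.elem j).carrier).Nonempty)
    (hij : s i ≠ s j) : ∃ k l a b, (P.elem k).IsVertex x ∧ (P.elem l).IsVertex x ∧ s k ≠ s l ∧
      (P.elem k).edge a = (P.elem l).edge b ∧ x ∈ (P.elem k).edge a ∧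
        (U ∩ (P.elem k).edge a).Nonempty := by
  have hcl : ∀ p : ι → Prop, IsClosed (⋃ k ∈ {k | (P.elem k).IsVertex x ∧ p k}, (P.elem k).carrier) :=
    fun p => (Set.toFinite _).isClosed_biUnion fun j _ => (P.elem j).isCompact.isClosed
  -- The elements with the value `s i` and those with a different value form two closed sets
  -- covering the connected set `U`, so they meet inside it. The meeting point is not a vertex,
  -- since `x` is the only vertex in the ball; hence it lies on a common edge.
  obtain ⟨z, hzU, hz1, hz2⟩ := isPreconnected_closed_iff.1 hc.isPreconnected _ _
    (hcl fun k => s k = s i) (hcl fun k => s k ≠ s i) (fun z hz => by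
      obtain ⟨k, hk, hzk⟩ := hε.exists_mem (hU hz)
      by_cases h : s k = s i
      · exact Or.inl (mem_iUnion₂.2 ⟨k, ⟨mem_vertexPatch.1 hk, h⟩, hzk⟩)
      · exact Or.inr (mem_iUnion₂.2 ⟨k, ⟨mem_vertexPatch.1 hk, h⟩, hzk⟩))
    (hiU.mono fun z hz => ⟨hz.1, mem_iUnion₂.2 ⟨i, ⟨hi, rfl⟩, hz.2⟩⟩)
    (hjU.mono fun z hz => ⟨hz.1, mem_iUnion₂.2 ⟨j, ⟨hj, hij.symm⟩, hz.2⟩⟩)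
  obtain ⟨k, ⟨hk, hsk⟩, hzk⟩ := mem_iUnion₂.1 hz1
  obtain ⟨l, ⟨hl, hsl⟩, hzl⟩ := mem_iUnion₂.1 hz2
  have hkl : s k ≠ s l := fun h => hsl (h ▸ hsk)
  rcases P.conforming k l (fun h => hkl (h ▸ rfl)) z ⟨hzk, hzl⟩ with h | ⟨a, b, e, ha⟩
  · exact absurd (hε.eq_of_isVertex k z (hU hzU) h.1 ▸ hzU) hxU
  · exact ⟨k, l, a, b, hk, hl, hkl, e, hε.mem_edge k a z (hU hzU) ha, z, hzU, ha⟩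

end IsSmallRadius

end PolygonalMesh

/-! ### Thin hat functions along an edge. -/

/-- The coordinate along `τ`, normalized to be one at `τ`. -/
def along (τ : Plane) : Plane →L[ℝ] ℝ := (‖τ‖ ^ 2)⁻¹ • innerSL ℝ τ

/-- The coordinate across `τ`. -/
def across (τ : Plane) : Plane →L[ℝ] ℝ :=
  (‖τ‖ ^ 2)⁻¹ • (τ 0 • (EuclideanSpace.proj 1 : Plane →L[ℝ] ℝ) -
    τ 1 • (EuclideanSpace.proj 0 : Plane →L[ℝ] ℝ))

theorem norm_sq_eq (v : Plane) : ‖v‖ ^ 2 = v 0 * v 0 + v 1 * v 1 := by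
  rw [EuclideanSpace.real_norm_sq_eq, Fin.sum_univ_two]; ring

theorem along_apply (τ v : Plane) : along τ v = (‖τ‖ ^ 2)⁻¹ * (τ 0 * v 0 + τ 1 * v 1) := by
  simp [along, PiLp.inner_apply, Fin.sum_univ_two, mul_comm]

theorem across_apply (τ v : Plane) : across τ v = (‖τ‖ ^ 2)⁻¹ * cross τ v := by
  simp [across, cross]

theorem along_self {τ : Plane} (hτ : τ ≠ 0) : along τ τ = 1 := by
  rw [along_apply, ← norm_sq_eq, inv_mul_cancel₀ (pow_ne_zero 2 (norm_ne_zero_iff.2 hτ))]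

theorem across_self (τ : Plane) : across τ τ = 0 := by
  rw [across_apply, cross_self, mul_zero]

theorem norm_le_along_across {τ : Plane} (hτ : τ ≠ 0) (v : Plane) :
    ‖v‖ ≤ (|along τ v| + |across τ v|) * ‖τ‖ := by
  have ht : ‖τ‖ ^ 2 ≠ 0 := pow_ne_zero 2 (norm_ne_zero_iff.2 hτ)
  have h1 : ‖v‖ ^ 2 = (along τ v ^ 2 + across τ v ^ 2) * ‖τ‖ ^ 2 := by
    have e : (τ 0 * v 0 + τ 1 * v 1) ^ 2 + cross τ v ^ 2 = ‖τ‖ ^ 2 * ‖v‖ ^ 2 := by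
      rw [norm_sq_eq, norm_sq_eq, cross]; ring
    rw [along_apply, across_apply, mul_pow, mul_pow, ← mul_add, e]
    field_simp
  refine abs_le_of_sq_le_sq' ?_ (by positivity) |>.2
  rw [h1, mul_pow]
  refine mul_le_mul_of_nonneg_right ?_ (by positivity)
  rw [add_sq, sq_abs, sq_abs]
  nlinarith [abs_nonneg (along τ v), abs_nonneg (across τ v),
    mul_nonneg (abs_nonneg (along τ v)) (abs_nonneg (across τ v))]

theorem eq_along_smul {τ v : Plane} (hτ : τ ≠ 0) (h : across τ v = 0) : v = along τ v • τ := by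
  have := norm_le_along_across hτ (v - along τ v • τ)
  rw [map_sub, map_sub, map_smul, map_smul, along_self hτ, across_self, h] at this
  simp only [smul_eq_mul, mul_one, sub_self, mul_zero, abs_zero, add_zero, zero_mul] at this
  exact sub_eq_zero.1 (norm_le_zero_iff.1 this)

/-- A piecewise linear function with value `1` at `x` that is affine on the segment from `x` to
`x + τ`, vanishes at `x + τ` and whose positivity set is thin. -/
def hat (x τ : Plane) (L : ℝ) (z : Plane) : ℝ :=
  1 - max (along τ (z - x)) (-(L * along τ (z - x))) - L * |across τ (z - x)|

theorem exists_lipschitzWith_hat (x τ : Plane) (L : ℝ) : ∃ C, LipschitzWith C (hat x τ L) := by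
  have hs : LipschitzWith 1 fun z : Plane => z - x := LipschitzWith.of_dist_le_mul fun a b => by simp
  have h1 := (along τ).lipschitz.comp hs
  have h2 : LipschitzWith (‖(-L) • along τ‖₊ * 1) fun z => -(L * along τ (z - x)) := by
    have h := ((-L) • along τ).lipschitz.comp hs
    have e : (⇑((-L) • along τ) ∘ fun z => z - x) = fun z => -(L * along τ (z - x)) := by
      ext z; simp
    rwa [e] at h
  refine ⟨_, LipschitzWith.sub (LipschitzWith.sub (LipschitzWith.const (1 : ℝ)) (h1.max h2))
    (?_ : LipschitzWith (Real.nnabs L * (1 * (‖across τ‖₊ * 1))) _)⟩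
  refine LipschitzWith.of_dist_le_mul fun a b => ?_
  have h4 := lipschitzWith_one_norm.comp ((across τ).lipschitz.comp hs)
  have := h4.dist_le_mul a b
  simp only [Function.comp_apply, Real.norm_eq_abs] at this
  rw [Real.dist_eq, ← mul_sub, abs_mul, NNReal.coe_mul, Real.coe_nnabs, mul_assoc]
  rw [Real.dist_eq] at this
  exact mul_le_mul_of_nonneg_left this (abs_nonneg _)

section

variable {x τ : Plane} {L : ℝ}

theorem hat_add_smul (hτ : τ ≠ 0) (hL : 0 ≤ L) {s : ℝ} (hs : 0 ≤ s) :
    hat x τ L (x + s • τ) = 1 - s := by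
  rw [hat, add_sub_cancel_left, map_smul, map_smul, along_self hτ, across_self]
  simp only [smul_eq_mul, mul_one, mul_zero, abs_zero, sub_zero]
  rw [max_eq_left]
  nlinarith [mul_nonneg hL hs]

/-- `1 - hat` is positively homogeneous of degree one along rays from `x`, and it is at least `1` at
`x + v`. -/
theorem hat_add_smul_le {v : Plane} (h : hat x τ L (x + v) ≤ 0) {s : ℝ} (hs : 0 ≤ s) :
    hat x τ L (x + s • v) ≤ 1 - s := by
  rw [hat, add_sub_cancel_left] at h ⊢
  rw [map_smul, map_smul]
  simp only [smul_eq_mul, abs_mul, abs_of_nonneg hs]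
  have e : max (s * along τ v) (-(L * (s * along τ v))) =
      s * max (along τ v) (-(L * along τ v)) := by
    rw [mul_max_of_nonneg _ _ hs]
    congr 1
    ring
  rw [e]
  nlinarith

theorem along_lt_of_hat_pos {z : Plane} (h : 0 < hat x τ L z) :
    along τ (z - x) + L * |across τ (z - x)| < 1 := by
  rw [hat] at h
  linarith [le_max_left (along τ (z - x)) (-(L * along τ (z - x)))]

/-- Positivity forces the transversal coordinate below `1 / L`; behind `x` it forces even the sum of
both coordinates, in absolute value, below `1 / L`. -/
theorem norm_lt_of_hat_pos (hτ : τ ≠ 0) (hL : 0 < L) {η : ℝ} (hη : 0 < η) {z : Plane}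
    (h : 0 < hat x τ L z) (hz : along τ (z - x) < η) : ‖z - x‖ < (η + L⁻¹) * ‖τ‖ := by
  refine (norm_le_along_across hτ _).trans_lt ?_
  refine mul_lt_mul_of_pos_right ?_ (norm_pos_iff.2 hτ)
  rw [hat] at h
  have h1 := le_max_left (along τ (z - x)) (-(L * along τ (z - x)))
  have h2 := le_max_right (along τ (z - x)) (-(L * along τ (z - x)))
  have h3 := inv_pos.2 hL
  rcases le_or_gt 0 (along τ (z - x)) with h0 | h0
  · have : L * |across τ (z - x)| < L * L⁻¹ := by rw [mul_inv_cancel₀ hL.ne']; linarith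
    rw [abs_of_nonneg h0]
    linarith [lt_of_mul_lt_mul_left this hL.le]
  · have : L * (|along τ (z - x)| + |across τ (z - x)|) < L * L⁻¹ := by
      rw [mul_inv_cancel₀ hL.ne', abs_of_neg h0]; linarith
    linarith [lt_of_mul_lt_mul_left this hL.le]

/-- Away from `x`, the part of the positivity set of a thin hat function that lies on the same side
of an edge as the center of an element is contained in the element. -/
theorem PolygonalElement.IsStar.eventually_mem_of_hat_pos {K : PolygonalElement} {c : Plane} {r : ℝ}
    (h : K.IsStar c r) (hτ : τ ≠ 0) (hseg : ∀ s ∈ Icc (0 : ℝ) 1, x + s • τ ∈ K.carrier)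
    (hb : across τ (c - x) ≠ 0) {η : ℝ} (hη : 0 < η) :
    ∀ᶠ L in atTop, ∀ z, η ≤ along τ (z - x) → 0 < hat x τ L z →
      0 < across τ (z - x) * across τ (c - x) → z ∈ K.openRegion := by
  obtain ⟨a, ha⟩ : ∃ a, a = along τ (c - x) := ⟨_, rfl⟩
  obtain ⟨b, hb'⟩ : ∃ b, b = across τ (c - x) := ⟨_, rfl⟩
  rw [← hb'] at hb ⊢
  have hbp := abs_pos.2 hb
  filter_upwards [eventually_gt_atTop 0, eventually_ge_atTop (|1 - a| / |b|),
    eventually_ge_atTop (|a| / (|b| * η))] with L hL h1 h2 z hz hpos hside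
  rw [div_le_iff₀ hbp] at h1
  rw [div_le_iff₀ (mul_pos hbp hη)] at h2
  have h3 := along_lt_of_hat_pos hpos
  obtain ⟨α, hα⟩ : ∃ α, α = along τ (z - x) := ⟨_, rfl⟩
  obtain ⟨β, hβ⟩ : ∃ β, β = across τ (z - x) := ⟨_, rfl⟩
  rw [← hα] at hz h3
  rw [← hβ] at hside h3
  -- Write `z - x = l • (c - x) + (α - l * a) • τ`. The lower bounds on `L` give `0 < α - l * a` and
  -- `l + (α - l * a) < 1`, so `z` is in the triangle spanned by the edge and `c`, on a segment from
  -- an edge point to `c`.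
  obtain ⟨l, hl⟩ : ∃ l, l = β / b := ⟨_, rfl⟩
  have hlb : l * b = β := by rw [hl, div_mul_cancel₀ _ hb]
  have hl0 : 0 < l := by
    rw [← hlb, mul_assoc] at hside
    exact pos_of_mul_pos_left hside (mul_self_nonneg b)
  have hlb' : l * |b| = |β| := by rw [← hlb, abs_mul, abs_of_pos hl0]
  have hβ1 : L * |β| < 1 := by linarith
  have hμ : 0 < α - l * a := by
    have e1 : l * a ≤ l * |a| := mul_le_mul_of_nonneg_left (le_abs_self a) hl0.le
    have e2 : l * |a| ≤ l * (L * (|b| * η)) := mul_le_mul_of_nonneg_left h2 hl0.le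
    have e3 : l * (L * (|b| * η)) = L * |β| * η := by rw [← hlb']; ring
    have e4 : L * |β| * η < 1 * η := mul_lt_mul_of_pos_right hβ1 hη
    linarith
  have hsum : l + (α - l * a) < 1 := by
    have e1 : l * (1 - a) ≤ l * |1 - a| := mul_le_mul_of_nonneg_left (le_abs_self _) hl0.le
    have e2 : l * |1 - a| ≤ l * (L * |b|) := mul_le_mul_of_nonneg_left h1 hl0.le
    have e3 : l * (L * |b|) = L * |β| := by rw [← hlb']; ring
    linarith
  have hzx : z - x - l • (c - x) = (α - l * a) • τ := by
    have e := eq_along_smul (v := z - x - l • (c - x)) hτ (by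
      rw [map_sub, map_smul, ← hβ, ← hb', smul_eq_mul, hlb, sub_self])
    rw [e, map_sub, map_smul, ← hα, ← ha, smul_eq_mul]
  have h1l : 0 < 1 - l := by linarith
  have hw := hseg ((α - l * a) / (1 - l)) ⟨div_nonneg hμ.le h1l.le,
    (div_le_one h1l).2 (by linarith)⟩
  have := h.mem_interior hw hl0 (by linarith)
  convert this using 1
  have e1 : (1 - l) • (((α - l * a) / (1 - l)) • τ) = (α - l * a) • τ := by
    rw [smul_smul, mul_div_cancel₀ _ h1l.ne']
  have e2 : z = x + l • (c - x) + (α - l * a) • τ := by rw [← hzx]; abel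
  rw [e2, ← e1]
  module

end

/-- Finitely many Lipschitz functions have a Lipschitz maximum with zero. -/
theorem exists_lipschitz_sup {X κ : Type*} [PseudoMetricSpace X] (T : Finset κ) {f : κ → X → ℝ}
    (hf : ∀ k ∈ T, ∃ C, LipschitzWith C (f k)) :
    ∃ (W : X → ℝ) (C : NNReal), LipschitzWith C W ∧ (∀ z, 0 ≤ W z) ∧
      (∀ k ∈ T, ∀ z, f k z ≤ W z) ∧ ∀ z, W z = 0 ∨ ∃ k ∈ T, W z = f k z := by
  classical
  induction T using Finset.induction_on with
  | empty => exact ⟨fun _ => 0, 0, LipschitzWith.const _, fun _ => le_rfl, by simp, by simp⟩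
  | insert k T hk ih =>
    obtain ⟨W, C, h1, h2, h3, h4⟩ := ih fun l hl => hf l (Finset.mem_insert_of_mem hl)
    obtain ⟨C', hC'⟩ := hf k (Finset.mem_insert_self _ _)
    refine ⟨fun z => max (W z) (f k z), _, h1.max hC', fun z => (h2 z).trans (le_max_left _ _),
      fun l hl z => ?_, fun z => ?_⟩
    · rcases Finset.mem_insert.1 hl with rfl | hl
      · exact le_max_right _ _
      · exact (h3 l hl z).trans (le_max_left _ _)
    · rcases le_total (W z) (f k z) with h | h
      · exact Or.inr ⟨k, Finset.mem_insert_self _ _, max_eq_right h⟩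
      · rcases h4 z with h0 | ⟨l, hl, h0⟩
        · exact Or.inl ((max_eq_left h).trans h0)
        · exact Or.inr ⟨l, Finset.mem_insert_of_mem hl, (max_eq_left h).trans h0⟩

theorem across_mul_across_neg {τ u v : Plane} (hτ : τ ≠ 0) (h : cross u τ * cross v τ < 0) :
    across τ u * across τ v < 0 := by
  have h1 : 0 < (‖τ‖ ^ 2)⁻¹ := by positivity
  have e : across τ u * across τ v = (‖τ‖ ^ 2)⁻¹ * (‖τ‖ ^ 2)⁻¹ * (cross u τ * cross v τ) := by
    rw [across_apply, across_apply, cross_comm τ u, cross_comm τ v]; ring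
  rw [e]
  exact mul_neg_of_pos_of_neg (mul_pos h1 h1) h

/-! ### The nodal function of the vertex. -/

namespace PolygonalMesh

variable {ι : Type*} [Fintype ι] {Ω : Set Plane} {P : PolygonalMesh ι Ω} {x : Plane}
  {c : ι → Plane} {r : ι → ℝ} {ε : ℝ}

/-- The edge has an element on either side, with centers on opposite sides of its line. For large
`L`, the part of the positivity set away from `x` is absorbed by these two elements, apart from
points of the edge itself; the rest lies in the small ball. -/
theorem IsSmallRadius.eventually_of_hat_pos (hε : P.IsSmallRadius x ε)
    (hst : ∀ i, (P.elem i).IsStar (c i) (r i)) {i : ι} (hi : (P.elem i).IsVertex x)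
    {a : Fin (P.elem i).n} (hxa : x ∈ (P.elem i).edge a) :
    ∀ᶠ L in atTop, ∀ z, 0 < hat x ((P.elem i).spoke x a) L z → z ∈ Metric.ball x ε ∨
      (∃ j, (P.elem j).IsVertex x ∧ z ∈ (P.elem j).openRegion) ∨
      ∃ s ∈ Ioo (0 : ℝ) 1, z = x + s • (P.elem i).spoke x a := by
  obtain ⟨j, hj, hji, b, e⟩ := hε.exists_neighbour hi hxa
  have hτ := (P.elem i).spoke_ne_zero (x := x) a
  have hneg := (hst i).cross_mul_cross_neg (hst j) (P.nonoverlapping i j hji.symm) e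
  rw [← cross_sub_spoke hi hxa, ← cross_sub_spoke hi hxa, ← cross_spoke_mul (x := x)] at hneg
  have hneg' := across_mul_across_neg hτ hneg
  have hseg : ∀ s ∈ Icc (0 : ℝ) 1, x + s • (P.elem i).spoke x a ∈ (P.elem i).edge a :=
    fun s hs => (mem_edge_iff_spoke hi hxa).2 ⟨s, hs, rfl⟩
  clear hneg
  generalize (P.elem i).spoke x a = τ at hτ hneg' hseg ⊢
  have hτp : 0 < ‖τ‖ := norm_pos_iff.2 hτ
  -- With this threshold and `L ≥ 2 * ‖τ‖ / ε`, the points whose coordinate along `τ` is below the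
  -- threshold are within `ε` of `x`.
  have hη : 0 < ε / (2 * ‖τ‖) := div_pos hε.pos (by positivity)
  filter_upwards [eventually_gt_atTop 0, eventually_ge_atTop (2 * ‖τ‖ / ε),
    (hst i).eventually_mem_of_hat_pos hτ
      (fun s hs => (P.elem i).edge_subset_carrier a (hseg s hs)) (left_ne_zero_of_mul hneg'.ne) hη,
    (hst j).eventually_mem_of_hat_pos hτ
      (fun s hs => (P.elem j).edge_subset_carrier b (e ▸ hseg s hs)) (right_ne_zero_of_mul hneg'.ne)
      hη] with L hL hL1 h1 h2 z hz
  rcases lt_or_ge (along τ (z - x)) (ε / (2 * ‖τ‖)) with h0 | h0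
  · left
    rw [Metric.mem_ball, dist_eq_norm]
    refine (norm_lt_of_hat_pos hτ hL hη hz h0).trans_le ?_
    have e1 : ε / (2 * ‖τ‖) * ‖τ‖ = ε / 2 := by field_simp
    have e2 : L⁻¹ * ‖τ‖ ≤ ε / 2 := by
      rw [inv_mul_le_iff₀ hL]
      rw [div_le_iff₀ hε.pos] at hL1
      linarith
    rw [add_mul, e1]
    linarith
  right
  by_cases hβ : across τ (z - x) = 0
  · right
    have h3 := along_lt_of_hat_pos hz
    rw [hβ, abs_zero, mul_zero, add_zero] at h3
    exact ⟨_, ⟨hη.trans_le h0, h3⟩, by rw [← eq_along_smul hτ hβ]; abel⟩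
  · left
    rcases lt_or_gt_of_ne (mul_ne_zero hβ (left_ne_zero_of_mul hneg'.ne)) with h3 | h3
    · refine ⟨j, hj, h2 z h0 hz ?_⟩
      have h4 : 0 < (across τ (z - x) * across τ (c i - x)) * (across τ (c i - x) * across τ (c j - x)) :=
        mul_pos_of_neg_of_neg h3 hneg'
      have h5 : (across τ (z - x) * across τ (c i - x)) * (across τ (c i - x) * across τ (c j - x)) =
        (across τ (z - x) * across τ (c j - x)) * (across τ (c i - x) * across τ (c i - x)) := by ring
      rw [h5] at h4
      exact pos_of_mul_pos_left h4 (mul_self_nonneg _)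
    · exact ⟨i, hi, h1 z h0 hz h3⟩

/-- A Lipschitz function supported in the macroelement which on the edges agrees with the nodal
basis function of the vertex `x`. -/
theorem IsSmallRadius.exists_nodal (hε : P.IsSmallRadius x ε)
    (hst : ∀ i, (P.elem i).IsStar (c i) (r i)) : ∃ (W : Plane → ℝ) (C : NNReal), LipschitzWith C W ∧
      (∀ z, 0 ≤ W z) ∧ (∀ z, 0 < W z → z ∈ macroDomain P.elem (P.vertexPatch x)) ∧
      (∀ i, (P.elem i).IsVertex x → ∀ a, x ∈ (P.elem i).edge a → ∀ s ∈ Icc (0 : ℝ) 1,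
        W (x + s • (P.elem i).spoke x a) = 1 - s) ∧
      ∀ i, ∀ a, x ∉ (P.elem i).edge a → ∀ z ∈ (P.elem i).edge a, W z = 0 := by
  classical
  let T : Finset (Σ i, Fin (P.elem i).n) :=
    Finset.univ.filter fun k => (P.elem k.1).IsVertex x ∧ x ∈ (P.elem k.1).edge k.2
  have hT : ∀ k, k ∈ T ↔ (P.elem k.1).IsVertex x ∧ x ∈ (P.elem k.1).edge k.2 := fun k => by
    simp [T]
  obtain ⟨L, hL, hcov⟩ := ((eventually_ge_atTop (0 : ℝ)).and ((Finset.eventually_all T).2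
    fun k hk => hε.eventually_of_hat_pos hst ((hT k).1 hk).1 ((hT k).1 hk).2)).exists
  -- `W` is the maximum of zero and the hat functions of all edges at `x`, with one common slope
  -- `L`.
  obtain ⟨W, C, hW, hW0, hWge, hWeq⟩ := exists_lipschitz_sup T
    (f := fun k => hat x ((P.elem k.1).spoke x k.2) L) fun k _ => exists_lipschitzWith_hat _ _ _
  have hpos : ∀ z, 0 < W z → ∃ k ∈ T, W z = hat x ((P.elem k.1).spoke x k.2) L z ∧
      0 < hat x ((P.elem k.1).spoke x k.2) L z := by
    intro z hz
    rcases hWeq z with h | ⟨k, hk, h⟩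
    · exact absurd h hz.ne'
    · exact ⟨k, hk, h, h ▸ hz⟩
  -- hat functions vanish at the other vertices
  have hvert : ∀ k ∈ T, ∀ i y, (P.elem i).IsVertex y → y ≠ x →
      hat x ((P.elem k.1).spoke x k.2) L y ≤ 0 := by
    intro k hk i y hy hyx
    by_contra! h
    rcases hcov k hk y h with h1 | ⟨j, -, h1⟩ | ⟨s, hs, h1⟩
    · exact hyx (hε.eq_of_isVertex i y h1 hy)
    · obtain ⟨b, hb⟩ := hy.exists_edge
      exact not_mem_openRegion_of_mem_edge hb h1
    · refine not_isVertex_spoke ((hT k).1 hk).1 ((hT k).1 hk).2 hs (h1 ▸ isVertex_of_mem hy ?_)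
      rw [h1]
      exact (P.elem k.1).edge_subset_carrier k.2 ((mem_edge_iff_spoke ((hT k).1 hk).1
        ((hT k).1 hk).2).2 ⟨s, ⟨hs.1.le, hs.2.le⟩, rfl⟩)
  refine ⟨W, C, hW, hW0, fun z hz => ?_, fun i hi a ha s hs => ?_, fun i a ha z hz => ?_⟩
  · refine mem_interior.2 ⟨{z | 0 < W z}, fun w hw => ?_, isOpen_lt continuous_const hW.continuous, hz⟩
    obtain ⟨k, hk, -, hkw⟩ := hpos w hw
    rcases hcov k hk w hkw with h1 | ⟨j, hj, h1⟩ | ⟨s, hs, h1⟩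
    · obtain ⟨j, hj, hwj⟩ := hε.exists_mem h1
      exact mem_iUnion₂.2 ⟨j, hj, hwj⟩
    · exact mem_iUnion₂.2 ⟨j, mem_vertexPatch.2 hj, (P.elem j).openRegion_subset h1⟩
    · refine mem_iUnion₂.2 ⟨k.1, mem_vertexPatch.2 ((hT k).1 hk).1, ?_⟩
      rw [h1]
      exact (P.elem k.1).edge_subset_carrier k.2 ((mem_edge_iff_spoke ((hT k).1 hk).1
        ((hT k).1 hk).2).2 ⟨s, ⟨hs.1.le, hs.2.le⟩, rfl⟩)
  · have hmem : (⟨i, a⟩ : Σ i, Fin (P.elem i).n) ∈ T := (hT _).2 ⟨hi, ha⟩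
    have hτ := (P.elem i).spoke_ne_zero (x := x) a
    -- The hat function of this edge gives the lower bound. The other hat functions are nonpositive
    -- at the far end point, hence at most `1 - s` on the edge.
    refine le_antisymm ?_ ((hat_add_smul hτ hL hs.1).symm.le.trans (hWge _ hmem _))
    rcases hWeq (x + s • (P.elem i).spoke x a) with h | ⟨k, hk, h⟩
    · rw [h]; linarith [hs.2]
    · rw [h]
      refine hat_add_smul_le (hvert k hk i _ (isVertex_add_spoke hi ha) ?_) hs.1
      simpa using hτ
  · by_contra hne
    obtain ⟨k, hk, -, hkz⟩ := hpos z ((hW0 z).lt_of_ne' hne)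
    rcases hcov k hk z hkz with h1 | ⟨j, -, h1⟩ | ⟨s, hs, h1⟩
    · exact ha (hε.mem_edge i a z h1 hz)
    · exact not_mem_openRegion_of_mem_edge hz h1
    · have hzk : z ∈ (P.elem k.1).edge k.2 := (mem_edge_iff_spoke ((hT k).1 hk).1
        ((hT k).1 hk).2).2 ⟨s, ⟨hs.1.le, hs.2.le⟩, h1.symm⟩
      have := edge_eq_of_mem hzk (h1 ▸ not_isVertex_spoke ((hT k).1 hk).1 ((hT k).1 hk).2 hs) hz
      exact ha (this ▸ ((hT k).1 hk).2)

end PolygonalMesh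

/-! ### Lipschitz functions as elements of `H₀¹`. -/

/-- A bounded linear map commutes with weak limits. -/
theorem map_eq_of_tendsto_inner {κ V E : Type*} [NormedAddCommGroup V] [InnerProductSpace ℝ V]
    [CompleteSpace V] [NormedAddCommGroup E] [InnerProductSpace ℝ E] [CompleteSpace E]
    (T : V →L[ℝ] E) {u : κ → V} {l : Filter κ} [l.NeBot] {v : V} {e : E}
    (h : ∀ w, Tendsto (fun n => inner ℝ (u n) w) l (𝓝 (inner ℝ v w)))
    (he : Tendsto (fun n => T (u n)) l (𝓝 e)) : T v = e := by
  refine ext_inner_right ℝ fun w => ?_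
  have h1 := h (ContinuousLinearMap.adjoint T w)
  simp_rw [ContinuousLinearMap.adjoint_inner_right] at h1
  exact tendsto_nhds_unique h1 (he.inner tendsto_const_nhds)

/-- A consequence of weak compactness: if a bounded sequence of a Hilbert space has convergent
images under two operators, then the limits are the images of a common element. -/
theorem exists_eq_of_bounded_of_tendsto {V E F : Type*} [NormedAddCommGroup V]
    [InnerProductSpace ℝ V] [CompleteSpace V] [NormedAddCommGroup E] [InnerProductSpace ℝ E]
    [CompleteSpace E] [NormedAddCommGroup F] [InnerProductSpace ℝ F] [CompleteSpace F]
    (T : V →L[ℝ] E) (S : V →L[ℝ] F) {u : ℕ → V} {B : ℝ} (hB : ∀ n, ‖u n‖ ≤ B) {e : E} {f : F}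
    (he : Tendsto (fun n => T (u n)) atTop (𝓝 e)) (hf : Tendsto (fun n => S (u n)) atTop (𝓝 f)) :
    ∃ v, T v = e ∧ S v = f := by
  let D : ℕ → WeakDual ℝ V := fun n => StrongDual.toWeakDual (InnerProductSpace.toDual ℝ V (u n))
  have hD : ∀ n, D n ∈ WeakDual.toStrongDual ⁻¹' (Metric.closedBall (0 : StrongDual ℝ V) B) := by
    intro n
    simp only [D, mem_preimage, mem_closedBall_zero_iff]
    exact ((InnerProductSpace.toDual ℝ V).norm_map (u n)).trans_le (hB n)
  -- By Banach–Alaoglu, the bounded sequence converges weakly along any ultrafilter; passing to the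
  -- limit along one replaces the extraction of a subsequence.
  obtain ⟨W, hW⟩ : ∃ W : Ultrafilter ℕ, (W : Filter ℕ) ≤ atTop :=
    ⟨Ultrafilter.of atTop, Ultrafilter.of_le atTop⟩
  obtain ⟨d, -, hd⟩ := (WeakDual.isCompact_closedBall (0 : StrongDual ℝ V) B).ultrafilter_le_nhds
    (W.map D) (tendsto_principal.2 (Eventually.of_forall hD))
  obtain ⟨v, hv⟩ := (InnerProductSpace.toDual ℝ V).surjective (WeakDual.toStrongDual d)
  have hlim : ∀ h : V, Tendsto (fun n => inner ℝ (u n) h) W (𝓝 (inner ℝ v h)) := by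
    intro h
    have h1 : Tendsto (fun n => D n h) W (𝓝 (d h)) :=
      ((WeakDual.eval_continuous h).tendsto d).comp hd
    have h2 : d h = inner ℝ v h := by
      rw [← InnerProductSpace.toDual_apply_apply, hv]; rfl
    rw [h2] at h1
    exact h1
  exact ⟨v, map_eq_of_tendsto_inner T hlim (he.mono_left hW),
    map_eq_of_tendsto_inner S hlim (hf.mono_left hW)⟩

theorem exists_mem_of_bounded_of_tendsto {H E F : Type*} [NormedAddCommGroup H]
    [InnerProductSpace ℝ H] [CompleteSpace H] [NormedAddCommGroup E] [InnerProductSpace ℝ E]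
    [CompleteSpace E] [NormedAddCommGroup F] [InnerProductSpace ℝ F] [CompleteSpace F]
    {V : Submodule ℝ H} (hV : IsClosed (V : Set H)) (T : H →L[ℝ] E) (S : H →L[ℝ] F) {u : ℕ → H}
    (hu : ∀ n, u n ∈ V) {B : ℝ} (hB : ∀ n, ‖u n‖ ≤ B) {e : E} {f : F}
    (he : Tendsto (fun n => T (u n)) atTop (𝓝 e)) (hf : Tendsto (fun n => S (u n)) atTop (𝓝 f)) :
    ∃ v ∈ V, T v = e ∧ S v = f := by
  have : CompleteSpace V := hV.completeSpace_coe
  obtain ⟨v, h1, h2⟩ := exists_eq_of_bounded_of_tendsto (T.comp V.subtypeL) (S.comp V.subtypeL)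
    (u := fun n => ⟨u n, hu n⟩) hB he hf
  exact ⟨v, v.2, h1, h2⟩

/-- A nonnegative Lipschitz function with bounded positivity set contained in `U` is a uniform limit
of test functions with the same Lipschitz constant. -/
theorem exists_testFunction_near {U : Set Plane} (hU : IsOpen U) (hb : Bornology.IsBounded U)
    {W : Plane → ℝ} {C : NNReal} (hW : LipschitzWith C W) (hW0 : ∀ z, 0 ≤ W z)
    (hWU : ∀ z, 0 < W z → z ∈ U) {δ : ℝ} (hδ : 0 < δ) :
    ∃ φ ∈ testFunctions U, (∀ z, |φ z - W z| ≤ δ) ∧ ∀ z, ‖∇ φ z‖ ≤ C := by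
  -- Cutting `W` off at height `δ / 2` makes the support a compact subset of `U`. Mollification at a
  -- scale `t` with `t ≤ η` and `C * t ≤ δ / 2` then keeps the support in `U`, costs another `δ /
  -- 2`, and preserves the Lipschitz constant.
  obtain ⟨f, hf⟩ : ∃ f : Plane → ℝ, f = fun z => max (W z - δ / 2) 0 := ⟨_, rfl⟩
  have hfL : LipschitzWith C f := by
    have h1 : LipschitzWith C fun z => W z - δ / 2 := by
      refine LipschitzWith.of_dist_le_mul fun a b => ?_
      rw [dist_sub_right]
      exact hW.dist_le_mul a b
    rw [hf]
    exact h1.max_const 0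
  have hfc := hfL.continuous
  have hfW : ∀ z, |f z - W z| ≤ δ / 2 := by
    intro z
    rw [hf, abs_le]
    have := hW0 z
    constructor
    · linarith [le_max_left (W z - δ / 2) 0]
    · have : max (W z - δ / 2) 0 ≤ W z + δ / 2 := max_le (by linarith) (by linarith)
      linarith
  have hKc : IsCompact {z | δ / 2 ≤ W z} :=
    Metric.isCompact_of_isClosed_isBounded (isClosed_le continuous_const hW.continuous)
      (hb.subset fun z hz => hWU z ((half_pos hδ).trans_le hz))
  have hsf : tsupport f ⊆ {z | δ / 2 ≤ W z} := by
    refine closure_minimal (fun z hz => ?_) hKc.isClosed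
    by_contra h
    rw [mem_ofPred_eq, not_le] at h
    refine hz ?_
    rw [hf]
    exact max_eq_right (by linarith)
  have hcf : HasCompactSupport f := hKc.of_isClosed_subset (isClosed_tsupport f) hsf
  obtain ⟨η, hη, hηU⟩ := hKc.exists_cthickening_subset_open hU
    (fun z hz => hWU z ((half_pos hδ).trans_le hz))
  obtain ⟨t, ht0, htη, htC⟩ : ∃ t : ℝ, 0 < t ∧ t ≤ η ∧ C * t ≤ δ / 2 := by
    refine ⟨min η (δ / 2 / (C + 1)), lt_min hη (by positivity), min_le_left _ _, ?_⟩
    have h1 : (C : ℝ) * min η (δ / 2 / (C + 1)) ≤ (C + 1) * (δ / 2 / (C + 1)) :=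
      mul_le_mul (by linarith) (min_le_right _ _) (by positivity) (by positivity)
    rwa [mul_div_cancel₀ _ (by positivity)] at h1
  let ψ : ContDiffBump (0 : Plane) := ⟨t / 2, t, half_pos ht0, half_lt_self ht0⟩
  obtain ⟨φ, hφ⟩ : ∃ φ : Plane → ℝ,
    φ = convolution (ψ.normed volume) f (ContinuousLinearMap.lsmul ℝ ℝ) volume := ⟨_, rfl⟩
  have hφs : ContDiff ℝ ∞ φ := by
    rw [hφ]
    exact ψ.hasCompactSupport_normed.contDiff_convolution_left _ (ψ.contDiff_normed)
      hfc.locallyIntegrable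
  have hφf : ∀ z, |φ z - f z| ≤ δ / 2 := by
    intro z
    rw [← Real.dist_eq, hφ]
    refine ψ.dist_normed_convolution_le hfc.aestronglyMeasurable fun w hw => ?_
    refine (hfL.dist_le_mul w z).trans (le_trans ?_ htC)
    exact mul_le_mul_of_nonneg_left (Metric.mem_ball.1 hw).le C.2
  have hφsupp : tsupport φ ⊆ Metric.cthickening η {z | δ / 2 ≤ W z} := by
    refine closure_minimal ?_ Metric.isClosed_cthickening
    rw [hφ]
    refine (support_convolution_subset _).trans ?_
    rw [ψ.support_normed_eq]
    rintro _ ⟨v, hv, w, hw, rfl⟩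
    refine Metric.mem_cthickening_of_dist_le _ w _ _ (hsf (subset_tsupport f hw)) ?_
    rw [mem_ball_zero_iff] at hv
    simpa using hv.le.trans htη
  have hφL : LipschitzWith C φ := by
    refine LipschitzWith.of_dist_le_mul fun a b => ?_
    have hi : ∀ z, Integrable (fun v => ψ.normed volume v * f (z - v)) := by
      intro z
      refine Continuous.integrable_of_hasCompactSupport ?_ ψ.hasCompactSupport_normed.mul_right
      exact (ψ.contDiff_normed (n := 0)).continuous.mul (hfc.comp (by fun_prop))
    have e : φ a - φ b = ∫ v, ψ.normed volume v * (f (a - v) - f (b - v)) := by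
      simp_rw [mul_sub]
      rw [integral_sub (hi a) (hi b), hφ]
      rfl
    rw [Real.dist_eq, e, ← Real.norm_eq_abs]
    refine (norm_integral_le_of_norm_le (g := fun v => ψ.normed volume v * (C * dist a b))
      (ψ.integrable_normed.mul_const _) (Eventually.of_forall fun v => ?_)).trans_eq ?_
    · rw [norm_mul, Real.norm_of_nonneg (ψ.nonneg_normed v)]
      refine mul_le_mul_of_nonneg_left ?_ (ψ.nonneg_normed v)
      have := hfL.dist_le_mul (a - v) (b - v)
      rwa [dist_sub_right, Real.dist_eq, ← Real.norm_eq_abs] at this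
    · rw [integral_mul_const, ψ.integral_normed, one_mul]
  refine ⟨φ, ⟨hφs, ?_, hφsupp.trans hηU⟩, fun z => ?_, fun z => ?_⟩
  · exact hKc.cthickening.of_isClosed_subset (isClosed_tsupport φ) hφsupp
  · calc |φ z - W z| = |(φ z - f z) + (f z - W z)| := by ring_nf
      _ ≤ |φ z - f z| + |f z - W z| := abs_add_le _ _
      _ ≤ δ := by linarith [hφf z, hfW z]
  · rw [norm_gradient]
    exact norm_fderiv_le_of_lipschitz ℝ hφL

theorem norm_sobolevTriple_le {μ ν : Measure Plane} (w : SobolevTriple μ ν) :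
    ‖w‖ ≤ ‖w.fst‖ + ‖w.snd.fst‖ + ‖w.snd.snd‖ := by
  have h1 := WithLp.prod_norm_sq_eq_of_L2 w
  have h2 := WithLp.prod_norm_sq_eq_of_L2 w.snd
  refine le_of_sq_le_sq ?_ (by positivity)
  rw [h1, h2]
  nlinarith [norm_nonneg w.fst, norm_nonneg w.snd.fst, norm_nonneg w.snd.snd,
    mul_nonneg (norm_nonneg w.fst) (norm_nonneg w.snd.fst),
    mul_nonneg (norm_nonneg w.fst) (norm_nonneg w.snd.snd),
    mul_nonneg (norm_nonneg w.snd.fst) (norm_nonneg w.snd.snd)]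

theorem norm_toLp_le {E : Type*} [NormedAddCommGroup E] {μ : Measure Plane} [IsFiniteMeasure μ]
    {f : Plane → E} (hf : MemLp f 2 μ) {C : ℝ} (hC : 0 ≤ C) (h : ∀ z, ‖f z‖ ≤ C) :
    ‖hf.toLp f‖ ≤ (measureUnivNNReal μ : ℝ) ^ (2 : ℝ≥0∞).toReal⁻¹ * C := by
  refine Lp.norm_le_of_ae_bound hC ?_
  filter_upwards [hf.coeFn_toLp] with z hz
  rw [hz]
  exact h z

theorem tendsto_toLp_of_uniform {μ : Measure Plane} [IsFiniteMeasure μ] {φ : ℕ → Plane → ℝ}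
    {W : Plane → ℝ} (hφ : ∀ n, MemLp (φ n) 2 μ) (hW : MemLp W 2 μ) {δ : ℕ → ℝ}
    (hδ : Tendsto δ atTop (𝓝 0)) (h0 : ∀ n, 0 ≤ δ n) (h : ∀ n z, |φ n z - W z| ≤ δ n) :
    Tendsto (fun n => (hφ n).toLp (φ n)) atTop (𝓝 (hW.toLp W)) := by
  rw [tendsto_iff_norm_sub_tendsto_zero]
  have : Tendsto (fun n => (measureUnivNNReal μ : ℝ) ^ (2 : ℝ≥0∞).toReal⁻¹ * δ n) atTop (𝓝 0) := by
    simpa using hδ.const_mul ((measureUnivNNReal μ : ℝ) ^ (2 : ℝ≥0∞).toReal⁻¹)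
  refine squeeze_zero (fun n => norm_nonneg _) (fun n => ?_) this
  rw [← MemLp.toLp_sub]
  exact norm_toLp_le _ (h0 n) (h n)

theorem norm_testTriple_le {μ ν : Measure Plane} [IsFiniteMeasure μ] [IsFiniteMeasure ν]
    {U : Set Plane} {B C : ℝ} (hB0 : 0 ≤ B) (hC0 : 0 ≤ C) (φ : testFunctions U)
    (hB : ∀ z, ‖φ.1 z‖ ≤ B) (hC : ∀ z, ‖∇ φ.1 z‖ ≤ C) :
    ‖testTriple μ ν U φ‖ ≤ (measureUnivNNReal μ : ℝ) ^ (2 : ℝ≥0∞).toReal⁻¹ * B +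
      (measureUnivNNReal μ : ℝ) ^ (2 : ℝ≥0∞).toReal⁻¹ * C +
      (measureUnivNNReal ν : ℝ) ^ (2 : ℝ≥0∞).toReal⁻¹ * B :=
  (norm_sobolevTriple_le (testTriple μ ν U φ)).trans (add_le_add (add_le_add
    (norm_toLp_le (testFunctions.memLp φ.2) hB0 hB)
    (norm_toLp_le (testFunctions.memLp_gradient φ.2) hC0 hC))
    (norm_toLp_le (testFunctions.memLp φ.2) hB0 hB))

theorem valL_testTriple {μ ν : Measure Plane} [IsFiniteMeasureOnCompacts μ]
    [IsFiniteMeasureOnCompacts ν] {U : Set Plane} (φ : testFunctions U) :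
    valL μ ν (testTriple μ ν U φ) = (testFunctions.memLp φ.2).toLp φ.1 := rfl

theorem traceL_testTriple {μ ν : Measure Plane} [IsFiniteMeasureOnCompacts μ]
    [IsFiniteMeasureOnCompacts ν] {U : Set Plane} (φ : testFunctions U) :
    traceL μ ν (testTriple μ ν U φ) = (testFunctions.memLp φ.2).toLp φ.1 := rfl

/-- The gradients are only bounded, so strong convergence of the triples is not available. A weak
limit lies in the closed subspace, and its value and trace are identified by the uniform
convergence. -/
theorem exists_mem_sobolevClosure_of_uniform {μ ν : Measure Plane} [IsFiniteMeasure μ]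
    [IsFiniteMeasure ν] {U : Set Plane} {W : Plane → ℝ} (hμ : MemLp W 2 μ) (hν : MemLp W 2 ν)
    {B C : ℝ} (hB0 : 0 ≤ B) (hC0 : 0 ≤ C) {φ : ℕ → Plane → ℝ} (hφ : ∀ n, φ n ∈ testFunctions U)
    (hB : ∀ n z, ‖φ n z‖ ≤ B) (hC : ∀ n z, ‖∇ (φ n) z‖ ≤ C) {δ : ℕ → ℝ}
    (hδ : Tendsto δ atTop (𝓝 0)) (h0 : ∀ n, 0 ≤ δ n) (h : ∀ n z, |φ n z - W z| ≤ δ n) :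
    ∃ u ∈ sobolevClosure μ ν U, u.fst =ᵐ[μ] W ∧ u.snd.snd =ᵐ[ν] W := by
  have hb : ∃ D, ∀ n, ‖testTriple μ ν U ⟨φ n, hφ n⟩‖ ≤ D :=
    ⟨_, fun n => norm_testTriple_le hB0 hC0 ⟨φ n, hφ n⟩ (hB n) (hC n)⟩
  obtain ⟨D, hD⟩ := hb
  have t1 : Tendsto (fun n => valL μ ν (testTriple μ ν U ⟨φ n, hφ n⟩)) atTop (𝓝 (hμ.toLp W)) := by
    simp_rw [valL_testTriple]
    exact tendsto_toLp_of_uniform (fun n => testFunctions.memLp (hφ n)) hμ hδ h0 h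
  have t2 : Tendsto (fun n => traceL μ ν (testTriple μ ν U ⟨φ n, hφ n⟩)) atTop (𝓝 (hν.toLp W)) := by
    simp_rw [traceL_testTriple]
    exact tendsto_toLp_of_uniform (fun n => testFunctions.memLp (hφ n)) hν hδ h0 h
  obtain ⟨v, hv, hv1, hv2⟩ := exists_mem_of_bounded_of_tendsto isClosed_sobolevClosure (valL μ ν)
    (traceL μ ν) (fun n => testTriple_mem _) hD t1 t2
  exact ⟨v, hv, (Lp.ext_iff.1 hv1).trans hμ.coeFn_toLp, (Lp.ext_iff.1 hv2).trans hν.coeFn_toLp⟩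

/-- A Lipschitz function as in `exists_testFunction_near` belongs to the Sobolev space of functions
that vanish on the boundary of `U`, and is its own trace. -/
theorem exists_mem_sobolevClosure_of_lipschitz {μ ν : Measure Plane} [IsFiniteMeasure μ]
    [IsFiniteMeasure ν] {U : Set Plane} (hU : IsOpen U) (hb : Bornology.IsBounded U)
    {W : Plane → ℝ} {C : NNReal} (hW : LipschitzWith C W) (hW0 : ∀ z, 0 ≤ W z)
    (hWU : ∀ z, 0 < W z → z ∈ U) :
    ∃ u ∈ sobolevClosure μ ν U, u.fst =ᵐ[μ] W ∧ u.snd.snd =ᵐ[ν] W := by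
  obtain ⟨B, hB0, hB⟩ : ∃ B, 0 ≤ B ∧ ∀ z, W z ≤ B := by
    by_cases hne : U.Nonempty
    · obtain ⟨z₀, -⟩ := hne
      obtain ⟨R, hR⟩ := hb.subset_closedBall z₀
      have hR' : 0 ≤ W z₀ + C * |R| := add_nonneg (hW0 _) (by positivity)
      refine ⟨W z₀ + C * |R|, hR', fun z => ?_⟩
      rcases (hW0 z).eq_or_lt with h | h
      · rw [← h]; exact hR'
      · have h1 := hW.dist_le_mul z z₀
        have h2 : dist z z₀ ≤ |R| := (Metric.mem_closedBall.1 (hR (hWU z h))).trans (le_abs_self R)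
        rw [Real.dist_eq] at h1
        have h3 : (C : ℝ) * dist z z₀ ≤ C * |R| := mul_le_mul_of_nonneg_left h2 C.2
        linarith [le_abs_self (W z - W z₀)]
    · refine ⟨0, le_rfl, fun z => ?_⟩
      by_contra! h
      exact hne ⟨z, hWU z h⟩
  have hWm : ∀ (ξ : Measure Plane) [IsFiniteMeasure ξ], MemLp W 2 ξ := fun ξ _ =>
    MemLp.of_bound hW.continuous.aestronglyMeasurable B (Eventually.of_forall fun z => by
      rw [Real.norm_of_nonneg (hW0 z)]; exact hB z)
  choose φ hφ hφW hφG using fun n : ℕ =>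
    exists_testFunction_near hU hb hW hW0 hWU (Nat.one_div_pos_of_nat (α := ℝ) (n := n))
  have hφB : ∀ n z, ‖φ n z‖ ≤ B + 1 := by
    intro n z
    have h1 : (1 : ℝ) / (n + 1) ≤ 1 := by
      rw [div_le_one (by positivity)]; linarith [(Nat.cast_nonneg n : (0 : ℝ) ≤ n)]
    have h2 := abs_le.1 (hφW n z)
    rw [Real.norm_eq_abs, abs_le]
    constructor <;> linarith [hB z, hW0 z]
  have hlim : Tendsto (fun n : ℕ => (1 : ℝ) / (n + 1)) atTop (𝓝 0) :=
    tendsto_one_div_add_atTop_nhds_zero_nat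
  have hpos : ∀ n : ℕ, (0 : ℝ) ≤ 1 / (n + 1) := fun n => by positivity
  exact exists_mem_sobolevClosure_of_uniform (hWm μ) (hWm ν) (add_nonneg hB0 zero_le_one) C.2 hφ
    hφB hφG hlim hpos hφW

section

variable {μ ν : Measure Plane} [IsFiniteMeasureOnCompacts μ] [IsFiniteMeasureOnCompacts ν]
  {U : Set Plane}

/-- The triple of a function, its gradient and its trace. -/
def sobolevTriple {v : Plane → ℝ} {G : Plane → Plane} {g : Plane → ℝ} (hv : MemLp v 2 μ)
    (hG : MemLp G 2 μ) (hg : MemLp g 2 ν) : SobolevTriple μ ν :=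
  WithLp.toLp 2 (hv.toLp v, WithLp.toLp 2 (hG.toLp G, hg.toLp g))

theorem mem_sobolevClosure_of_tendsto {v : Plane → ℝ} {G : Plane → Plane} {g : Plane → ℝ}
    (hv : MemLp v 2 μ) (hG : MemLp G 2 μ) (hg : MemLp g 2 ν) {φ : ℕ → Plane → ℝ}
    (hφ : ∀ n, φ n ∈ testFunctions U)
    (h1 : Tendsto (fun n => eLpNorm (φ n - v) 2 μ) atTop (𝓝 0))
    (h2 : Tendsto (fun n => eLpNorm (∇ (φ n) - G) 2 μ) atTop (𝓝 0))
    (h3 : Tendsto (fun n => eLpNorm (φ n - g) 2 ν) atTop (𝓝 0)) :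
    sobolevTriple hv hG hg ∈ sobolevClosure μ ν U := by
  have t1 := (Lp.tendsto_Lp_iff_tendsto_eLpNorm'' φ
    (fun n => testFunctions.memLp (μ := μ) (hφ n)) v hv).2 h1
  have t2 := (Lp.tendsto_Lp_iff_tendsto_eLpNorm'' (fun n => ∇ (φ n))
    (fun n => testFunctions.memLp_gradient (μ := μ) (hφ n)) G hG).2 h2
  have t3 := (Lp.tendsto_Lp_iff_tendsto_eLpNorm'' φ
    (fun n => testFunctions.memLp (μ := ν) (hφ n)) g hg).2 h3
  refine isClosed_sobolevClosure.mem_of_tendsto (b := atTop)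
    (f := fun n => testTriple μ ν U ⟨φ n, hφ n⟩) ?_ (Eventually.of_forall fun n => testTriple_mem _)
  have t4 := ((WithLp.prod_continuous_toLp 2 (Lp Plane 2 μ) (Lp ℝ 2 ν)).tendsto _).comp
    (t2.prodMk_nhds t3)
  exact ((WithLp.prod_continuous_toLp 2 (Lp ℝ 2 μ) (WithLp 2 (Lp Plane 2 μ × Lp ℝ 2 ν))).tendsto
    _).comp (t1.prodMk_nhds t4)

theorem eLpNorm_sub_indicator {E : Type*} [NormedAddCommGroup E] {O : Set Plane}
    (hO : MeasurableSet O) (hOU : O ⊆ U) {f w : Plane → E} (hf : ∀ z ∉ O, f z = 0) :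
    eLpNorm (f - O.indicator w) 2 (volume.restrict U) = eLpNorm (f - w) 2 (volume.restrict O) := by
  have e : f - O.indicator w = O.indicator (f - w) := by
    ext z
    by_cases hz : z ∈ O
    · simp [hz]
    · simp [hz, hf z hz]
  rw [e, eLpNorm_indicator_eq_eLpNorm_restrict hO, Measure.restrict_restrict_of_subset hOU]

theorem memLp_indicator {E : Type*} [NormedAddCommGroup E] {O : Set Plane}
    (hO : MeasurableSet O) (hOU : O ⊆ U) {w : Plane → E} (hw : MemLp w 2 (volume.restrict O)) :
    MemLp (O.indicator w) 2 (volume.restrict U) := by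
  rwa [memLp_indicator_iff_restrict hO, Measure.restrict_restrict_of_subset hOU]

/-- Extension by zero. -/
theorem extend_mem_sobolevClosure {O : Set Plane} (hO : IsOpen O) (hOU : O ⊆ U) {ξ : Measure Plane}
    [IsFiniteMeasureOnCompacts ξ] (hν : ν O = 0) {w : SobolevTriple (volume.restrict O) ξ}
    (hw : w ∈ sobolevClosure (volume.restrict O) ξ O) :
    sobolevTriple (memLp_indicator hO.measurableSet hOU (Lp.memLp w.fst))
      (memLp_indicator hO.measurableSet hOU (Lp.memLp w.snd.fst))
      (MemLp.zero (μ := ν) (ε := ℝ)) ∈ sobolevClosure (volume.restrict U) ν U := by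
  obtain ⟨φ, hφ, h1, h2, -⟩ := exists_seq_of_mem_sobolevClosure hw
  have hz : ∀ n, ∀ z ∉ O, φ n z = 0 := fun n z hz => by
    by_contra h0
    exact hz ((hφ n).2.2 (subset_tsupport _ h0))
  have hz' : ∀ n, ∀ z ∉ O, ∇ (φ n) z = 0 := fun n z hz => by
    by_contra h0
    exact hz ((hφ n).2.2 (tsupport_gradient_subset _ (subset_tsupport _ h0)))
  refine mem_sobolevClosure_of_tendsto _ _ _ (fun n => testFunctions_mono hOU (hφ n)) ?_ ?_ ?_
  · simpa only [eLpNorm_sub_indicator hO.measurableSet hOU (hz _)] using h1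
  · simpa only [eLpNorm_sub_indicator hO.measurableSet hOU (hz' _)] using h2
  · refine tendsto_const_nhds.congr fun n => ?_
    have : φ n - 0 =ᵐ[ν] 0 := by
      filter_upwards [measure_eq_zero_iff_ae_notMem.1 hν] with z h0
      simp [hz n z h0]
    rw [eLpNorm_congr_ae this, eLpNorm_zero]

end

theorem memH10_of_mem_sobolevClosure {U : Set Plane} {ν : Measure Plane}
    [IsFiniteMeasureOnCompacts (volume.restrict U)] [IsFiniteMeasureOnCompacts ν]
    {u : SobolevTriple (volume.restrict U) ν} (hu : u ∈ sobolevClosure (volume.restrict U) ν U) :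
    MemH10 U u.fst := by
  obtain ⟨φ, hφ, h1, h2, -⟩ := exists_seq_of_mem_sobolevClosure hu
  exact ⟨u.snd.fst, isWeakGradOn_of_mem_sobolevClosure hu, φ, hφ, h1, h2⟩

theorem edgeMeasure_eq_zero {K : PolygonalElement} {a : Fin K.n} {O : Set Plane}
    (hO : MeasurableSet O) (h : Disjoint (K.edge a) O) : K.edgeMeasure a O = 0 := by
  have hm := K.measurable_edgePath a
  rw [edgeMeasure, Measure.smul_apply, Measure.map_apply hm hO, Measure.restrict_apply (hm hO)]
  have : (K.poly.edgePath ℝ a : ℝ → Plane) ⁻¹' O ∩ Icc (0 : ℝ) 1 = ∅ := by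
    rw [eq_empty_iff_forall_notMem]
    rintro s ⟨h1, h2⟩
    refine Set.disjoint_left.1 h (K.mem_edge.2 ⟨s, h2, ?_⟩) h1
    rw [edgePath_apply]
  rw [this, measure_empty, smul_zero]

/-! ### Harmonic correction and the conforming test function. -/

section Macro

variable {ι : Type*} {K : ι → PolygonalElement} {M : Finset ι} {c : ι → Plane} {r : ι → ℝ}

variable (K M) in
/-- Arc length on all edges of a macroelement, counted with multiplicity. -/
def skeletonMeasure : Measure Plane := ∑ i ∈ M, (K i).boundaryMeasure

instance isFiniteMeasure_skeletonMeasure : IsFiniteMeasure (skeletonMeasure K M) := by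
  rw [skeletonMeasure]; infer_instance

theorem boundaryMeasure_le_skeletonMeasure {i : ι} (hi : i ∈ M) :
    (K i).boundaryMeasure ≤ skeletonMeasure K M :=
  Finset.single_le_sum (f := fun i => (K i).boundaryMeasure) (fun _ _ => Measure.zero_le _) hi

theorem skeletonMeasure_eq_zero {O : Set Plane} (hO : MeasurableSet O)
    (h : ∀ i ∈ M, ∀ a, Disjoint ((K i).edge a) O) : skeletonMeasure K M O = 0 := by
  rw [skeletonMeasure, Measure.finsetSum_apply]
  refine Finset.sum_eq_zero fun i hi => ?_
  rw [boundaryMeasure, Measure.finsetSum_apply]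
  exact Finset.sum_eq_zero fun a _ => edgeMeasure_eq_zero hO (h i hi a)

theorem hasTrace_of_mem_sobolevClosure
    {u : SobolevTriple (volume.restrict (macroDomain K M)) (skeletonMeasure K M)}
    (hu : u ∈ sobolevClosure (volume.restrict (macroDomain K M)) (skeletonMeasure K M)
      (macroDomain K M)) {g : Plane → ℝ} (hg : u.snd.snd =ᵐ[skeletonMeasure K M] g) {i : ι}
    (hi : i ∈ M) : HasTrace (K i) u.fst g := by
  obtain ⟨φ, hφ, h1, h2, h3⟩ := exists_seq_of_mem_sobolevClosure hu
  have hle := boundaryMeasure_le_skeletonMeasure (K := K) hi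
  refine ⟨((Lp.memLp u.snd.snd).ae_eq hg).mono_measure hle, u.snd.fst,
    (isWeakGradOn_of_mem_sobolevClosure hu).mono (openRegion_subset_macroDomain K M hi), φ,
    fun n => (hφ n).1, ⟨?_, ?_⟩, ?_⟩
  · exact tendsto_of_tendsto_of_tendsto_of_le_of_le tendsto_const_nhds h1 (fun n => zero_le)
      fun n => eLpNorm_mono_measure _ (restrict_le K M hi)
  · exact tendsto_of_tendsto_of_tendsto_of_le_of_le tendsto_const_nhds h2 (fun n => zero_le)
      fun n => eLpNorm_mono_measure _ (restrict_le K M hi)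
  · refine tendsto_of_tendsto_of_tendsto_of_le_of_le tendsto_const_nhds h3 (fun n => zero_le)
      fun n => (eLpNorm_mono_measure _ hle).trans_eq ?_
    exact eLpNorm_congr_ae (EventuallyEq.rfl.sub hg.symm)

/-- Functions of `H¹₀` can be made harmonic on the elements without changing the traces. -/
theorem exists_harmonic (hst : ∀ i ∈ M, (K i).IsStar (c i) (r i))
    (hd : ∀ i ∈ M, ∀ j ∈ M, i ≠ j → Disjoint (K i).openRegion (K j).openRegion)
    (he : ∀ i ∈ M, ∀ j ∈ M, ∀ a, Disjoint ((K j).edge a) (K i).openRegion)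
    {u : SobolevTriple (volume.restrict (macroDomain K M)) (skeletonMeasure K M)}
    (hu : u ∈ sobolevClosure (volume.restrict (macroDomain K M)) (skeletonMeasure K M)
      (macroDomain K M)) {S : Finset ι} (hS : S ⊆ M) :
    ∃ t ∈ sobolevClosure (volume.restrict (macroDomain K M)) (skeletonMeasure K M)
      (macroDomain K M), t.snd.snd =ᵐ[skeletonMeasure K M] u.snd.snd ∧
        ∀ i ∈ S, IsWeaklyHarmonic (K i).openRegion t.snd.fst := by
  classical
  -- One element is corrected at a time. The correction, extended by zero, changes neither the
  -- traces on the skeleton, which misses the open element, nor the gradient on the other elements.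
  induction S using Finset.induction_on with
  | empty => exact ⟨u, hu, EventuallyEq.rfl, by simp⟩
  | insert i S hiS ih =>
    obtain ⟨t, ht, htr, hh⟩ := ih fun j hj => hS (Finset.mem_insert_of_mem hj)
    have hi : i ∈ M := hS (Finset.mem_insert_self _ _)
    have m1 := (Lp.memLp t.fst).mono_measure (restrict_le K M hi)
    have m2 := (Lp.memLp t.snd.fst).mono_measure (restrict_le K M hi)
    -- The Dirichlet problem only involves the gradient component, so the trace component may be
    -- filled with zero.
    obtain ⟨w, hw, hharm⟩ := (hst i hi).exists_dirichlet
      (sobolevTriple m1 m2 (MemLp.zero (μ := (K i).boundaryMeasure) (ε := ℝ)))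
    have hO := (K i).isOpen_openRegion
    have hOU := openRegion_subset_macroDomain K M hi
    have hext := extend_mem_sobolevClosure (ν := skeletonMeasure K M) hO hOU
      (skeletonMeasure_eq_zero hO.measurableSet fun j hj a => he i hi j hj a) hw
    obtain ⟨y, hy⟩ : ∃ y, y = sobolevTriple
      (memLp_indicator hO.measurableSet hOU (Lp.memLp w.fst))
      (memLp_indicator hO.measurableSet hOU (Lp.memLp w.snd.fst))
      (MemLp.zero (μ := skeletonMeasure K M) (ε := ℝ)) := ⟨_, rfl⟩
    rw [← hy] at hext
    have y1 : y.snd.fst =ᵐ[volume.restrict (macroDomain K M)]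
        (K i).openRegion.indicator w.snd.fst := by
      rw [hy]
      exact (memLp_indicator hO.measurableSet hOU (Lp.memLp w.snd.fst)).coeFn_toLp
    have y2 : y.snd.snd =ᵐ[skeletonMeasure K M] 0 := by
      rw [hy]
      exact (MemLp.zero (μ := skeletonMeasure K M) (ε := ℝ)).coeFn_toLp
    have s1 : (t + y).snd.fst =ᵐ[volume.restrict (macroDomain K M)]
        t.snd.fst + (K i).openRegion.indicator w.snd.fst :=
      (Lp.coeFn_add t.snd.fst y.snd.fst).trans (EventuallyEq.rfl.add y1)
    refine ⟨t + y, Submodule.add_mem _ ht hext, ?_, fun j hj φ p1 p2 p3 => ?_⟩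
    · refine (Lp.coeFn_add t.snd.snd y.snd.snd).trans ?_
      filter_upwards [htr, y2] with z h1 h2
      rw [Pi.add_apply, h1, h2, Pi.zero_apply, add_zero]
    · have hjM := hS hj
      rcases Finset.mem_insert.1 hj with rfl | hj
      · rw [← hharm φ ⟨p1, p2, p3⟩]
        refine integral_congr_ae ?_
        have s2 := (Lp.coeFn_add (m2.toLp _) w.snd.fst)
        filter_upwards [ae_mono (restrict_le K M hjM) s1, s2, m2.coeFn_toLp,
          ae_restrict_mem hO.measurableSet] with z h1 h2 h3 h4
        have h5 : (sobolevTriple m1 m2 (MemLp.zero (μ := (K j).boundaryMeasure) (ε := ℝ)) + w).snd.fst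
            z = t.snd.fst z + w.snd.fst z := by
          refine Eq.trans h2 ?_
          rw [Pi.add_apply, h3]
        rw [h1, h5, Pi.add_apply, indicator_of_mem h4]
      · rw [← hh j hj φ p1 p2 p3]
        refine integral_congr_ae ?_
        filter_upwards [ae_mono (restrict_le K M hjM) s1,
          ae_restrict_mem (K j).isOpen_openRegion.measurableSet] with z h1 h4
        have h6 : z ∉ (K i).openRegion := fun h =>
          Set.disjoint_left.1 (hd i hi j hjM fun e => hiS (e ▸ hj)) h h4
        rw [h1, Pi.add_apply, indicator_of_notMem h6, add_zero]

end Macro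

theorem memMacroVnc_zero {ι : Type*} {K : ι → PolygonalElement} {M : Finset ι} :
    MemMacroVnc K M 0 := by
  refine ⟨MemLp.zero, fun i _ => ⟨0, isWeakGradOn_zero _, fun φ _ _ _ => by simp, 0, fun w _ => by simp⟩,
    fun _ => 0, fun i _ => hasTrace_zero _, fun i _ a => ⟨fun j _ _ _ => by simp, fun _ => by simp⟩⟩

/-- The nodal function integrates to half of the length of an edge at the vertex. -/
theorem integral_edge_nodal {K : PolygonalElement} {x : Plane} (hx : K.IsVertex x) {a : Fin K.n}
    (hxa : x ∈ K.edge a) {W : Plane → ℝ} (hW : Continuous W)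
    (h : ∀ s ∈ Icc (0 : ℝ) 1, W (x + s • K.spoke x a) = 1 - s) :
    ∫ z, W z ∂(K.edgeMeasure a) = K.edgeLength a / 2 := by
  rw [integral_edgeMeasure a hW]
  rcases eq_endpoint hx hxa with ⟨h1, h2⟩ | ⟨h1, h2⟩
  · have : ∫ s in (0 : ℝ)..1, W (K.poly a + s • K.edgeVec a) = ∫ s in (0 : ℝ)..1, (1 - s) := by
      refine intervalIntegral.integral_congr fun s hs => ?_
      rw [uIcc_of_le zero_le_one] at hs
      beta_reduce
      rw [← h s hs, h2, ← h1]
    rw [this, intervalIntegral.integral_sub (by simp) (by simp)]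
    simp
    ring
  · have : ∫ s in (0 : ℝ)..1, W (K.poly a + s • K.edgeVec a) = ∫ s in (0 : ℝ)..1, s := by
      refine intervalIntegral.integral_congr fun s hs => ?_
      rw [uIcc_of_le zero_le_one] at hs
      have h3 := h (1 - s) ⟨by linarith [hs.2], by linarith [hs.1]⟩
      have h4 : x + (1 - s) • K.spoke x a = K.poly a + s • K.edgeVec a := by
        rw [h2, h1]; module
      beta_reduce
      rw [← h4, h3]
      ring
    rw [this]
    simp
    ring

/-- The outward normal on a horizontal edge points straight down when the element's center is above
the edge. -/
theorem normal_vertical_eq_neg_one {K : PolygonalElement} {c : Plane} {a : Fin K.n}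
    (h0 : K.edgeVec a 1 = 0) (hc : 0 < c 1 - K.poly a 1) :
    K.normal c a (EuclideanSpace.single 1 1) = -1 := by
  have hv : K.edgeVec a 0 ≠ 0 := by
    intro h
    refine K.edgeVec_ne_zero a ?_
    ext k
    fin_cases k
    · exact h
    · exact h0
  have hl : K.edgeLength a = |K.edgeVec a 0| := by
    rw [edgeLength_eq, ← Real.sqrt_sq (norm_nonneg _), norm_sq_eq, h0, mul_zero, add_zero,
      Real.sqrt_mul_self_eq_abs]
  have e1 : cross (K.poly a - c) (K.edgeVec a) = (c 1 - K.poly a 1) * K.edgeVec a 0 := by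
    simp only [cross, h0, PiLp.sub_apply]; ring
  have e2 : cross (EuclideanSpace.single 1 1 : Plane) (K.edgeVec a) = - K.edgeVec a 0 := by
    simp [cross]
  rw [normal, e1, e2, hl, sign_mul, sign_pos hc, one_mul]
  rcases hv.lt_or_gt with h | h
  · rw [sign_neg h, abs_of_neg h]; simp [h.ne]
  · rw [sign_pos h, abs_of_pos h]; simp [h.ne']

namespace PolygonalMesh

variable {ι : Type*} [Fintype ι] {Ω : Set Plane} {P : PolygonalMesh ι Ω} {x : Plane}
  {c : ι → Plane} {r : ι → ℝ} {ε : ℝ}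

open Classical in
/-- The conforming test function at the vertex `x`. -/
theorem IsSmallRadius.exists_memMacroVc (hε : P.IsSmallRadius x ε)
    (hst : ∀ i, (P.elem i).IsStar (c i) (r i)) :
    ∃ v G, MemMacroVc P.elem (P.vertexPatch x) v ∧
      (∀ i ∈ P.vertexPatch x, IsWeakGradOn (P.elem i).openRegion v G) ∧
      ∀ i ∈ P.vertexPatch x, ∫ z in (P.elem i).openRegion, G z 1 =
        ∑ a, (P.elem i).normal (c i) a (EuclideanSpace.single 1 1) *
          if x ∈ (P.elem i).edge a then (P.elem i).edgeLength a / 2 else 0 := by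
  obtain ⟨W, C, hW, hW0, hWU, hWx, hWn⟩ := hε.exists_nodal hst
  obtain ⟨u, hu, -, hutr⟩ := exists_mem_sobolevClosure_of_lipschitz
    (μ := volume.restrict (macroDomain P.elem (P.vertexPatch x)))
    (ν := skeletonMeasure P.elem (P.vertexPatch x)) isOpen_macroDomain
    (isCompact_biUnion_carrier.isBounded.subset macroDomain_subset) hW hW0 hWU
  obtain ⟨t, ht, httr, hharm⟩ := exists_harmonic (fun i _ => hst i)
    (fun i _ j _ hij => P.nonoverlapping i j hij)
    (fun i _ j _ a => Set.disjoint_left.2 fun z h1 h2 => not_mem_openRegion_of_mem_edge h1 h2) hu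
    Finset.Subset.rfl
  have htrace := fun i hi => hasTrace_of_mem_sobolevClosure ht (httr.trans hutr) (i := i) hi
  have hgrad : ∀ i ∈ P.vertexPatch x, IsWeakGradOn (P.elem i).openRegion t.fst t.snd.fst :=
    fun i hi => (isWeakGradOn_of_mem_sobolevClosure ht).mono
      (openRegion_subset_macroDomain P.elem (P.vertexPatch x) hi)
  refine ⟨t.fst, t.snd.fst, ⟨memH10_of_mem_sobolevClosure ht, fun i hi => ⟨⟨t.snd.fst, hgrad i hi,
    hharm i hi⟩, W, htrace i hi, hW.continuous.continuousOn, fun a => ?_⟩⟩, hgrad, fun i hi => ?_⟩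
  · have hxi := mem_vertexPatch.1 hi
    by_cases hxa : x ∈ (P.elem i).edge a
    · have hτ := (P.elem i).spoke_ne_zero (x := x) a
      -- The affine function `z ↦ 1 - along τ (z - x)` with `τ` the spoke; it equals `1 - s` at `x +
      -- s • τ`.
      refine ⟨AffineMap.const ℝ Plane (1 + along ((P.elem i).spoke x a) x) -
        (along ((P.elem i).spoke x a)).toLinearMap.toAffineMap, fun z hz => ?_⟩
      obtain ⟨s, hs, rfl⟩ := (mem_edge_iff_spoke hxi hxa).1 hz
      rw [hWx i hxi a hxa s hs]
      simp [along_self hτ]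
      ring
    · exact ⟨0, fun z hz => by rw [hWn i a hxa z hz]; simp⟩
  · have hxi := mem_vertexPatch.1 hi
    rw [(hst i).green_trace (htrace i hi) (hgrad i hi)]
    refine Finset.sum_congr rfl fun a _ => ?_
    congr 1
    split_ifs with hxa
    · exact integral_edge_nodal hxi hxa hW.continuous (hWx i hxi a hxa)
    · rw [integral_edge_congr a hW.continuous continuous_const (g := fun _ => 0) (hWn i a hxa),
        integral_zero]

end PolygonalMesh

/-! ### Values above and below the vertex, and the conclusion. -/

namespace PolygonalElement

theorem apply_one_eq_of_horizontal {K : PolygonalElement} {x z : Plane} (hx : K.IsVertex x)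
    {a : Fin K.n} (hxa : x ∈ K.edge a) (h0 : K.edgeVec a 1 = 0) (hz : z ∈ K.edge a) :
    z 1 = x 1 := by
  obtain ⟨s, -, rfl⟩ := (mem_edge_iff_spoke hx hxa).1 hz
  rcases K.spoke_eq_or (x := x) a with h | h <;> simp [h, h0]

theorem edgeVec_one_eq_zero_iff {K K' : PolygonalElement} {a : Fin K.n} {b : Fin K'.n}
    (h : K.edge a = K'.edge b) : K.edgeVec a 1 = 0 ↔ K'.edgeVec b 1 = 0 := by
  rcases eq_or_reverse_of_edge_eq h with ⟨-, e⟩ | ⟨-, e⟩ <;> rw [e]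
  simp

end PolygonalElement

namespace PolygonalMesh

variable {ι : Type*} [Fintype ι] {Ω : Set Plane} {P : PolygonalMesh ι Ω} {x : Plane}
  {c : ι → Plane} {r : ι → ℝ} {ε : ℝ} {i j : ι}

/-- A half disc. -/
def halfDisc (x : Plane) (ε : ℝ) (l : Plane →L[ℝ] ℝ) : Set Plane :=
  Metric.ball x ε ∩ {z | l x < l z}

theorem convex_halfDisc (l : Plane →L[ℝ] ℝ) : Convex ℝ (halfDisc x ε l) :=
  (convex_ball x ε).inter (convex_halfSpace_gt l.toLinearMap.isLinear _)

theorem not_mem_halfDisc (l : Plane →L[ℝ] ℝ) : x ∉ halfDisc x ε l := fun h => lt_irrefl (l x) h.2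

theorem exists_add_smul_mem_halfDisc (hε : 0 < ε) (v : Plane) :
    ∃ t ∈ Ioc (0 : ℝ) 1, x + t • v ∈ Metric.ball x ε ∧
      ∀ l : Plane →L[ℝ] ℝ, 0 < l v → x + t • v ∈ halfDisc x ε l := by
  have h1 : ∀ᶠ t : ℝ in 𝓝 0, x + t • v ∈ Metric.ball x ε := by
    have : Tendsto (fun t : ℝ => x + t • v) (𝓝 0) (𝓝 (x + (0 : ℝ) • v)) :=
      Continuous.tendsto (by fun_prop) 0
    rw [zero_smul, add_zero] at this
    exact this.eventually (Metric.ball_mem_nhds x hε)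
  obtain ⟨t, h1, h2⟩ := ((h1.filter_mono nhdsWithin_le_nhds).and
    (Ioc_mem_nhdsGT (zero_lt_one' ℝ))).exists
  refine ⟨t, h2, h1, fun l hl => ⟨h1, ?_⟩⟩
  have := mul_pos h2.1 hl
  simpa using this

theorem halfDisc_inter_nonempty (hε : 0 < ε) (hst : (P.elem i).IsStar (c i) (r i))
    (hi : (P.elem i).IsVertex x) (l : Plane →L[ℝ] ℝ) (hl : l x < l (c i)) :
    (halfDisc x ε l ∩ (P.elem i).carrier).Nonempty := by
  obtain ⟨t, ht, -, h⟩ := exists_add_smul_mem_halfDisc (x := x) hε (c i - x)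
  exact ⟨_, h l (by rw [map_sub]; linarith),
    (P.elem i).openRegion_subset (hst.mem_interior hi.mem_carrier ht.1 ht.2)⟩

theorem horizontal_of_ne (hst : ∀ i, (P.elem i).IsStar (c i) (r i))
    {q : MacroL2 P.elem (P.vertexPatch x)} (hq : q ∈ macroN P.elem (P.vertexPatch x)) {s : ι → ℝ}
    (hs : ∀ i ∈ P.vertexPatch x, q =ᵐ[volume.restrict (P.elem i).openRegion] fun _ => s i)
    {k l : ι} (hk : (P.elem k).IsVertex x) (hl : (P.elem l).IsVertex x)
    {a : Fin (P.elem k).n} {b : Fin (P.elem l).n} (e : (P.elem k).edge a = (P.elem l).edge b)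
    (hne : s k ≠ s l) : (P.elem k).edgeVec a 1 = 0 := by
  by_contra h
  exact hne (eq_of_mem_macroN (fun i _ => hst i) (fun i _ j _ hij => P.nonoverlapping i j hij) hq hs
    (mem_vertexPatch.2 hk) (mem_vertexPatch.2 hl) e h)

/-- The elements that meet the upper (or lower) half disc have the same value. -/
theorem eq_of_halfDisc (hε : P.IsSmallRadius x ε) (hst : ∀ i, (P.elem i).IsStar (c i) (r i))
    {q : MacroL2 P.elem (P.vertexPatch x)} (hq : q ∈ macroN P.elem (P.vertexPatch x)) {s : ι → ℝ}
    (hs : ∀ i ∈ P.vertexPatch x, q =ᵐ[volume.restrict (P.elem i).openRegion] fun _ => s i)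
    {l : Plane →L[ℝ] ℝ} (hl : ∀ z : Plane, z 1 = x 1 → l z = l x)
    (hi : (P.elem i).IsVertex x) (hj : (P.elem j).IsVertex x)
    (hiU : (halfDisc x ε l ∩ (P.elem i).carrier).Nonempty)
    (hjU : (halfDisc x ε l ∩ (P.elem j).carrier).Nonempty) : s i = s j := by
  by_contra hij
  obtain ⟨k, m, a, b, hk, hm, hkm, e, hxa, z, hzU, hza⟩ := hε.exists_edge_of_ne inter_subset_left
    (convex_halfDisc l) (not_mem_halfDisc l) hi hj hiU hjU hij
  -- A jump occurs only across a horizontal edge. At `x` such an edge lies on the line where `l = l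
  -- x`, so it misses the open half disc.
  have h0 := horizontal_of_ne hst hq hs hk hm e hkm
  exact hzU.2.ne' (hl z (apply_one_eq_of_horizontal hk hxa h0 hza))

/-- If the values above and below `x` differ then there is a horizontal edge at `x`. -/
theorem exists_horizontal (hε : P.IsSmallRadius x ε) (hst : ∀ i, (P.elem i).IsStar (c i) (r i))
    {q : MacroL2 P.elem (P.vertexPatch x)} (hq : q ∈ macroN P.elem (P.vertexPatch x)) {s : ι → ℝ}
    (hs : ∀ i ∈ P.vertexPatch x, q =ᵐ[volume.restrict (P.elem i).openRegion] fun _ => s i)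
    (hi : (P.elem i).IsVertex x) (hj : (P.elem j).IsVertex x)
    (hci : x 1 < c i 1) (hcj : c j 1 < x 1) (hij : s i ≠ s j) :
    ∃ k a, (P.elem k).IsVertex x ∧ x ∈ (P.elem k).edge a ∧ (P.elem k).edgeVec a 1 = 0 := by
  -- The point `x + t • (1, σ)` lies in the right half disc and also, for `σ = 1` or `σ = -1`, in
  -- the upper or the lower one. An element containing it thus shares the value of `i` and reaches
  -- into the right half disc.
  have key : ∀ (σ : ℝ) (i : ι), (P.elem i).IsVertex x → 0 < σ * (c i 1 - x 1) → ∃ k,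
      (P.elem k).IsVertex x ∧ s k = s i ∧
        (halfDisc x ε (EuclideanSpace.proj 0) ∩ (P.elem k).carrier).Nonempty := by
    intro σ i hi hσ
    have hσ0 : σ ≠ 0 := by rintro rfl; simp at hσ
    obtain ⟨t, ht, hb, h⟩ := exists_add_smul_mem_halfDisc (x := x) hε.pos
      (EuclideanSpace.single 0 1 + EuclideanSpace.single 1 σ)
    obtain ⟨k, hk, hzk⟩ := hε.exists_mem hb
    have hk' := mem_vertexPatch.1 hk
    refine ⟨k, hk', ?_, _, h _ (by simp), hzk⟩
    refine eq_of_halfDisc hε hst hq hs (l := σ • (EuclideanSpace.proj 1 : Plane →L[ℝ] ℝ))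
      (fun z hz => by simp [hz]) hk' hi ⟨_, h _ ?_, hzk⟩
      (halfDisc_inter_nonempty hε.pos (hst i) hi _ ?_)
    · simpa using hσ0
    · simp only [_root_.smul_apply, PiLp.proj_apply, smul_eq_mul]
      linarith
  obtain ⟨k, hk, hks, hkU⟩ := key 1 i hi (by linarith)
  obtain ⟨l, hl, hls, hlU⟩ := key (-1) j hj (by linarith)
  obtain ⟨m, n, a, b, hm, hn, hmn, e, hxa, -⟩ := hε.exists_edge_of_ne (s := s)
    inter_subset_left (convex_halfDisc _) (not_mem_halfDisc _) hk hl hkU hlU (by rwa [hks, hls])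
  exact ⟨m, a, hm, hxa, horizontal_of_ne hst hq hs hm hn e hmn⟩

/-- The flux of the conforming test function. -/
theorem eq_of_above_of_below (hε : P.IsSmallRadius x ε) (hst : ∀ i, (P.elem i).IsStar (c i) (r i))
    {q : MacroL2 P.elem (P.vertexPatch x)} (hq : q ∈ macroN P.elem (P.vertexPatch x)) {s : ι → ℝ}
    (hs : ∀ i ∈ P.vertexPatch x, q =ᵐ[volume.restrict (P.elem i).openRegion] fun _ => s i)
    (hi : (P.elem i).IsVertex x) (hj : (P.elem j).IsVertex x)
    (hci : x 1 < c i 1) (hcj : c j 1 < x 1) : s i = s j := by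
  classical
  by_contra hij
  obtain ⟨k₀, a₀, hk₀, hxa₀, h0₀⟩ := exists_horizontal hε hst hq hs hi hj hci hcj hij
  have habove : ∀ k, (P.elem k).IsVertex x → x 1 < c k 1 → s k = s i := fun k hk hck =>
    eq_of_halfDisc hε hst hq hs (l := EuclideanSpace.proj 1) (fun z hz => by simp [hz]) hk hi
      (halfDisc_inter_nonempty hε.pos (hst k) hk _ (by simpa using hck))
      (halfDisc_inter_nonempty hε.pos (hst i) hi _ (by simpa using hci))
  have hbelow : ∀ k, (P.elem k).IsVertex x → c k 1 < x 1 → s k = s j := fun k hk hck =>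
    eq_of_halfDisc hε hst hq hs (l := -EuclideanSpace.proj 1) (fun z hz => by simp [hz]) hk hj
      (halfDisc_inter_nonempty hε.pos (hst k) hk _ (by simpa using hck))
      (halfDisc_inter_nonempty hε.pos (hst j) hj _ (by simpa using hcj))
  obtain ⟨v, G, hv, hG, hint⟩ := hε.exists_memMacroVc hst
  have h0 := hq.2 0 v memMacroVnc_zero hv 0 G (fun _ _ => isWeakGradOn_zero _) hG
  rw [divPairing] at h0
  simp only [Pi.zero_apply, PiLp.zero_apply, zero_add] at h0
  rw [Finset.sum_congr rfl fun k hk => (setIntegral_mul_const (hs k hk)).trans (by rw [hint k hk])]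
    at h0
  -- The vertical flux through a horizontal edge at `x`, weighted with `s`, amounts to `-(s i - s
  -- j)` times half the length. Adding half of the opposite amount on each of its two sides makes
  -- every edge cancel. As the flux terms sum to zero by `h0`, so do the added terms, whose common
  -- factor `s i - s j` multiplies a positive number.
  have h1 := sum_edges_eq_zero (K := P.elem) (M := P.vertexPatch x) (fun i _ => hst i)
    (fun i _ j _ hij => P.nonoverlapping i j hij)
    (fun k a => s k * ((P.elem k).normal (c k) a (EuclideanSpace.single 1 1) *
      if x ∈ (P.elem k).edge a then (P.elem k).edgeLength a / 2 else 0) + (s i - s j) / 2 *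
        if x ∈ (P.elem k).edge a ∧ (P.elem k).edgeVec a 1 = 0 then (P.elem k).edgeLength a / 2
          else 0) ?_ ?_
  · simp only [Finset.sum_add_distrib, ← Finset.mul_sum] at h1
    rw [h0, zero_add] at h1
    have hterm : ∀ k a, 0 ≤ if x ∈ (P.elem k).edge a ∧ (P.elem k).edgeVec a 1 = 0 then
        (P.elem k).edgeLength a / 2 else 0 := by
      intro k a
      split_ifs
      · exact (half_pos ((P.elem k).edgeLength_pos a)).le
      · exact le_rfl
    have hpos := Finset.sum_pos' (s := P.vertexPatch x)
      (fun k _ => Finset.sum_nonneg fun a (_ : a ∈ Finset.univ) => hterm k a)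
      ⟨k₀, mem_vertexPatch.2 hk₀, Finset.sum_pos' (fun a _ => hterm k₀ a)
        ⟨a₀, Finset.mem_univ _, by
          rw [if_pos ⟨hxa₀, h0₀⟩]; exact half_pos ((P.elem k₀).edgeLength_pos a₀)⟩⟩
    have := (mul_eq_zero.1 h1).resolve_right hpos.ne'
    exact hij (by linarith)
  · intro k hk l hl hkl a b e
    have hk' := mem_vertexPatch.1 hk
    have hl' := mem_vertexPatch.1 hl
    have hN := (hst k).normal_add_normal (hst l) (P.nonoverlapping k l hkl) e
      (EuclideanSpace.single 1 1)
    have hlen := edgeLength_eq_of_edge_eq e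
    have hlb := edgeVec_one_eq_zero_iff e
    by_cases hx : x ∈ (P.elem k).edge a
    · have hxb : x ∈ (P.elem l).edge b := e ▸ hx
      by_cases h0 : (P.elem k).edgeVec a 1 = 0
      · have hp : (P.elem k).poly a 1 = x 1 :=
          apply_one_eq_of_horizontal hk' hx h0 ((P.elem k).left_mem_edge a)
        have hp' : (P.elem l).poly b 1 = x 1 :=
          apply_one_eq_of_horizontal hl' hxb (hlb.1 h0) ((P.elem l).left_mem_edge b)
        have hside := (hst k).cross_mul_cross_neg (hst l) (P.nonoverlapping k l hkl) e
        have e1 : cross (c k - (P.elem k).poly a) ((P.elem k).edgeVec a) *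
            cross (c l - (P.elem k).poly a) ((P.elem k).edgeVec a) =
            (c k 1 - x 1) * (c l 1 - x 1) * ((P.elem k).edgeVec a 0 * (P.elem k).edgeVec a 0) := by
          simp only [cross, h0, PiLp.sub_apply, hp]; ring
        rw [e1] at hside
        have hside' : (c k 1 - x 1) * (c l 1 - x 1) < 0 :=
          neg_of_mul_neg_left hside (mul_self_nonneg _)
        rw [if_pos hx, if_pos hxb, if_pos ⟨hx, h0⟩, if_pos ⟨hxb, hlb.1 h0⟩, ← hlen]
        rcases mul_neg_iff.1 hside' with ⟨u1, u2⟩ | ⟨u1, u2⟩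
        · have n1 := normal_vertical_eq_neg_one (c := c k) h0 (by rw [hp]; exact u1)
          rw [n1] at hN
          rw [n1, show (P.elem l).normal (c l) b (EuclideanSpace.single 1 1) = 1 by linarith,
            habove k hk' (by linarith), hbelow l hl' (by linarith)]
          ring
        · have n1 := normal_vertical_eq_neg_one (c := c l) (hlb.1 h0) (by rw [hp']; exact u2)
          rw [n1] at hN
          rw [n1, show (P.elem k).normal (c k) a (EuclideanSpace.single 1 1) = 1 by linarith,
            habove l hl' (by linarith), hbelow k hk' (by linarith)]
          ring
      · have hkl' : s k = s l := by
          by_contra hne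
          exact h0 (horizontal_of_ne hst hq hs hk' hl' e hne)
        rw [if_pos hx, if_pos hxb, if_neg fun h => h0 h.2, if_neg fun h => h0 (hlb.2 h.2), ← hlen,
          hkl', eq_neg_of_add_eq_zero_left hN]
        ring
    · have hxb : x ∉ (P.elem l).edge b := e ▸ hx
      rw [if_neg hx, if_neg hxb, if_neg fun h => hx h.1, if_neg fun h => hxb h.1]
      ring
  · intro k hk a h
    by_cases hx : x ∈ (P.elem k).edge a
    -- An edge at the interior vertex `x` is always shared, so unshared edges carry no contribution.
    · obtain ⟨l, hl, hlk, b, e⟩ := hε.exists_neighbour (mem_vertexPatch.1 hk) hx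
      exact absurd e.symm (h l (mem_vertexPatch.2 hl) hlk b)
    · rw [if_neg hx, if_neg fun h => hx h.1]
      ring

theorem eq_of_isVertex (hε : P.IsSmallRadius x ε) (hst : ∀ i, (P.elem i).IsStar (c i) (r i))
    {q : MacroL2 P.elem (P.vertexPatch x)} (hq : q ∈ macroN P.elem (P.vertexPatch x)) {s : ι → ℝ}
    (hs : ∀ i ∈ P.vertexPatch x, q =ᵐ[volume.restrict (P.elem i).openRegion] fun _ => s i)
    (hc : ∀ i, c i 1 ≠ x 1) (hi : (P.elem i).IsVertex x)
    (hj : (P.elem j).IsVertex x) : s i = s j := by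
  rcases (hc i).lt_or_gt with h | h <;> rcases (hc j).lt_or_gt with h' | h'
  · exact eq_of_halfDisc hε hst hq hs (l := -EuclideanSpace.proj 1) (fun z hz => by simp [hz]) hi hj
      (halfDisc_inter_nonempty hε.pos (hst i) hi _ (by simpa using h))
      (halfDisc_inter_nonempty hε.pos (hst j) hj _ (by simpa using h'))
  · exact (eq_of_above_of_below hε hst hq hs hj hi h' h).symm
  · exact eq_of_above_of_below hε hst hq hs hi hj h h'
  · exact eq_of_halfDisc hε hst hq hs (l := EuclideanSpace.proj 1) (fun z hz => by simp [hz]) hi hj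
      (halfDisc_inter_nonempty hε.pos (hst i) hi _ (by simpa using h))
      (halfDisc_inter_nonempty hε.pos (hst j) hj _ (by simpa using h'))

theorem mem_macroN_iff (hΩ : IsOpen Ω) {ρ : ℝ} (hP : P.IsRegular ρ) (hx : P.IsInteriorVertex x)
    (q : MacroL2 P.elem (P.vertexPatch x)) : q ∈ macroN P.elem (P.vertexPatch x) ↔
      ∃ t : ℝ, q =ᵐ[volume.restrict (macroDomain P.elem (P.vertexPatch x))] fun _ => t := by
  -- Centers are chosen off the horizontal line through `x`, so that every element has its center
  -- strictly above or strictly below it.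
  have hex : ∀ i, ∃ c r, (P.elem i).IsStar c r ∧ c 1 ≠ x 1 := fun i => by
    obtain ⟨c, r, h⟩ := exists_isStar hP i
    exact h.exists_ne (x 1)
  choose c r hst using hex
  refine ⟨fun hq => ?_, fun ⟨t, ht⟩ => const_mem_macroN (fun i _ => (hst i).1)
    (fun i _ j _ hij => P.nonoverlapping i j hij) ht⟩
  obtain ⟨ε, hε⟩ := exists_isSmallRadius hΩ hx
  obtain ⟨⟨i₀, hi₀⟩, -⟩ := hx
  have hs : ∀ i, ∃ t : ℝ, i ∈ P.vertexPatch x →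
      q =ᵐ[volume.restrict (P.elem i).openRegion] fun _ => t := fun i => by
    by_cases hi : i ∈ P.vertexPatch x
    · obtain ⟨t, ht⟩ := hq.1 i hi
      exact ⟨t, fun _ => ht⟩
    · exact ⟨0, fun h => absurd h hi⟩
  choose s hs using hs
  refine ⟨s i₀, ae_macroDomain fun i hi => ?_⟩
  rw [eq_of_isVertex hε (fun i => (hst i).1) hq hs (fun i => (hst i).2) hi₀ (mem_vertexPatch.1 hi)]
  exact hs i hi

theorem finrank_macroN (hΩ : IsOpen Ω) {ρ : ℝ} (hP : P.IsRegular ρ) (hx : P.IsInteriorVertex x) :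
    Module.finrank ℝ (macroN P.elem (P.vertexPatch x)) = 1 := by
  have hone : MemLp (fun _ : Plane => (1 : ℝ)) 2
      (volume.restrict (macroDomain P.elem (P.vertexPatch x))) := memLp_const 1
  have hmem : hone.toLp _ ∈ macroN P.elem (P.vertexPatch x) :=
    (mem_macroN_iff hΩ hP hx _).2 ⟨1, hone.coeFn_toLp⟩
  refine finrank_eq_one_iff'.2 ⟨⟨hone.toLp _, hmem⟩, fun h => ?_, fun ⟨q, hq⟩ => ?_⟩
  -- The constant one is nonzero in `L²`, because the macroelement is open and contains the center
  -- of an element, hence has positive measure.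
  · have h0 : (fun _ : Plane => (1 : ℝ)) =ᵐ[volume.restrict (macroDomain P.elem (P.vertexPatch x))]
        0 := by
      rw [← MemLp.toLp_eq_toLp_iff hone MemLp.zero]
      exact (Subtype.ext_iff.1 h).trans (MemLp.toLp_zero _).symm
    obtain ⟨⟨i, hi⟩, -⟩ := hx
    obtain ⟨c, r, hst⟩ := exists_isStar hP i
    have hne : (macroDomain P.elem (P.vertexPatch x)).Nonempty :=
      ⟨c, openRegion_subset_macroDomain _ _ (mem_vertexPatch.2 hi) hst.center_mem⟩
    have hpos := isOpen_macroDomain.measure_pos volume hne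
    have hf : ∀ᵐ z ∂(volume.restrict (macroDomain P.elem (P.vertexPatch x))), False := by
      filter_upwards [h0] with z hz
      exact one_ne_zero hz
    rw [eventually_false_iff_eq_bot, ae_eq_bot, Measure.restrict_eq_zero] at hf
    exact hpos.ne' hf
  · obtain ⟨t, ht⟩ := (mem_macroN_iff hΩ hP hx q).1 hq
    refine ⟨t, Subtype.ext (Lp.ext ?_)⟩
    refine (Lp.coeFn_smul t (hone.toLp _)).trans ?_
    filter_upwards [ht, hone.coeFn_toLp] with z h1 h2
    rw [h1, Pi.smul_apply, h2, smul_eq_mul, mul_one]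

end PolygonalMesh

end KouhiaStenberg

end

theorem lemma4p1 {ι : Type*} [Fintype ι] {Ω : Set KouhiaStenberg.Plane} (hΩ : IsOpen Ω)
    (P : KouhiaStenberg.PolygonalMesh ι Ω) (ρ : ℝ) (hP : P.IsRegular ρ)
    (x : KouhiaStenberg.Plane) (hx : P.IsInteriorVertex x) :
    Module.finrank ℝ (KouhiaStenberg.macroN P.elem (P.vertexPatch x)) = 1 ∧
      ∀ q : KouhiaStenberg.MacroL2 P.elem (P.vertexPatch x),
        q ∈ KouhiaStenberg.macroN P.elem (P.vertexPatch x) ↔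
          ∃ c : ℝ, q =ᵐ[MeasureTheory.volume.restrict
            (KouhiaStenberg.macroDomain P.elem (P.vertexPatch x))] fun _ => c :=
  ⟨KouhiaStenberg.PolygonalMesh.finrank_macroN hΩ hP hx,
    KouhiaStenberg.PolygonalMesh.mem_macroN_iff hΩ hP hx⟩
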